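/- Let $D\subset\mathbb{R}^d$ ($d\ge 2$) be a bounded domain whose boundary is locally the graph of a Lipschitz function, and let $\gamma$ be a real Lipschitz function on $\overline D$ with $\gamma\ge\gamma_0>0$. Let $H^{1/2}(\partial D)\subset L^2(\partial D)$ be the space of traces of functions in $H^1(D)$ (complex-valued). For $f,g\in H^{1/2}(\partial D)$ put $$\int_{\partial D}\Lambda_\gamma f\,g=\int_D\gamma\,\nabla u\cdot\nabla v,$$ where $u\in H^1(D)$ is the weak solution of $\nabla\cdot(\gamma\nabla u)=0$ in $D$, $u|_{\partial D}=f$, and $v\in H^1(D)$ is any function with $v|_{\partial D}=g$. Let $\{X_\alpha:\alpha\in\mathbb{N}^2\}$ be independent complex Gaussian random variables on a probability space $\Omega$ with $\mathbb{E}X_\alpha=0$, $\mathbb{E}(X_\alpha\overline{X_\alpha})=1$, $\mathbb{E}(X_\alpha X_\alpha)=0$, let $\{e_n:n\in\mathbb{N}\}$ be an orthonormal basis of $L^2(\partial D)$, write $(\phi|\psi)=\int_{\partial D}\phi\overline\psi$, and define the noisy data $$\mathcal{N}_\gamma(f,g)=\int_{\partial D}\Lambda_\gamma f\,g+\sum_{\alpha\in\mathbb{N}^2}(f|e_{\alpha_1})(g|e_{\alpha_2})X_\alpha,$$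 the series converging in $L^2(\Omega)$. For $P\in\partial D$ consider the following data. (a) Orthonormal coordinates $y=(y',y_d)\in\mathbb{R}^{d-1}\times\mathbb{R}$, a radius $\rho>0$ and a Lipschitz function $\phi:\mathbb{R}^{d-1}\to\mathbb{R}$ such that in the ball $B(P,\rho)$ the set $D$ is $\{y_d>\phi(y')\}$ and $\partial D$ is $\{y_d=\phi(y')\}$, and such that, with $P=(p',\phi(p'))$, $\phi$ is differentiable at $p'$ and $$\lim_{r\to0}\frac1{r^{d-1}}\int_{|x'|\le r}|\nabla\phi(x'+p')-\nabla\phi(p')|^2\,dx'=0.$$ (b) A smooth $\eta:\mathbb{R}\to[0,1]$ with $\eta(t)=1$ for $|t|\le1/2$ and $\eta(t)=0$ for $|t|\ge1$. (c) A vector $\xi\in\mathbb{R}^d\setminus\{0\}$ with $\xi\cdot A\xi=e_d\cdot Ae_d$ and $\xi\cdot Ae_d=0$, where $A=BB^t$, $B=\begin{pmatrix}I_{d-1}&0\\-\nabla\phi(p')&1\end{pmatrix}$. Given these, let $F(x)=(x'+p',\,x_d+\phi(x'+p'))$, let $$C_P=\Big((1+|\nabla\phi(p')|^2)\int_{\mathbb{R}^{d-1}}\eta(|x'|)^2\,dx'\Big)^{-1/2},$$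 and, for $N\in\mathbb{N}\setminus\{0\}$ and $M=N^{1/2}$, let $f_N$ be the restriction to $\partial D$ of the function $$N^{-1/2}M^{(d-1)/2}\,C_P\;a_{M,N}\circ F^{-1},\qquad a_{M,N}(x)=\eta(M|x'|)\,\eta(Mx_d)\,e^{N(i\xi-e_d)\cdot x}.$$ Then for almost every $P\in\partial D$ (with respect to surface measure) data (a), (b), (c) exist and, for every choice of them, $f_N\in H^{1/2}(\partial D)$ for all $N\ge1$ and $$\lim_{N\to\infty}\mathcal{N}_\gamma(f_N,\overline{f_N})=\gamma(P)\quad\text{almost surely.}$$ -/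

import Mathlib

open MeasureTheory ProbabilityTheory Filter Topology
open scoped ENNReal NNReal ContDiff

namespace Calderon

/-- Euclidean space `ℝ^d`. -/
abbrev E (d : ℕ) : Type := EuclideanSpace ℝ (Fin d)

/-- The space `ℝ^{d-1} × ℝ` of pairs `(y', y_d)`, with its Euclidean structure. -/
abbrev Coord (d : ℕ) : Type := WithLp 2 (E (d - 1) × ℝ)

/-! ### Lipschitz domains -/

/-- A local representation of the boundary of `D` near `P`: orthonormal coordinates
`y ↦ (y', y_d)`, a radius `ρ > 0` and a Lipschitz function `φ` on the whole of `ℝ^{d-1}` such that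
inside `B(P, ρ)` the set `D` is `{y_d > φ(y')}` and `∂D` is `{y_d = φ(y')}`. -/
structure BoundaryChart {d : ℕ} (D : Set (E d)) (P : E d) where
  /-- the orthonormal coordinate system -/
  coord : E d ≃ₗᵢ[ℝ] Coord d
  /-- the function whose graph is the boundary -/
  φ : E (d - 1) → ℝ
  /-- the radius -/
  ρ : ℝ
  ρ_pos : 0 < ρ
  lipschitz : ∃ K : ℝ≥0, LipschitzWith K φ
  mem_iff : ∀ y ∈ Metric.ball P ρ, (y ∈ D ↔ φ (coord y).fst < (coord y).snd)
  mem_frontier_iff : ∀ y ∈ Metric.ball P ρ, (y ∈ frontier D ↔ (coord y).snd = φ (coord y).fst)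

/-- The boundary of `D` is locally the graph of a Lipschitz function. -/
def HasLipschitzBoundary {d : ℕ} (D : Set (E d)) : Prop :=
  ∀ P ∈ frontier D, Nonempty (BoundaryChart D P)

/-- The surface measure of `∂D`: the `(d-1)`-dimensional Hausdorff measure, normalised as in
Euclidean geometry, restricted to the boundary. -/
noncomputable def surfaceMeasure {d : ℕ} (D : Set (E d)) : Measure (E d) :=
  (μHE[d - 1] : Measure (E d)).restrict (frontier D)

/-- The complex Hilbert space `L²(∂D)`. -/
abbrev L2Boundary {d : ℕ} (D : Set (E d)) : Type := Lp ℂ 2 (surfaceMeasure D)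

/-! ### The space `H¹(D)`, traces and `H^{1/2}(∂D)` -/

/-- The (classical) gradient of a complex-valued function on `ℝ^d`. -/
noncomputable def cgrad {d : ℕ} (w : E d → ℂ) (x : E d) : EuclideanSpace ℂ (Fin d) :=
  WithLp.toLp 2 fun i => fderiv ℝ w x (EuclideanSpace.single i (1 : ℝ))

/-- The elements of `H¹(D)` (complex-valued): a function in `L²(D)` together with its weak gradient,
which is in `L²(D)` too. -/
structure H1 {d : ℕ} (D : Set (E d)) where
  /-- the function -/
  toFun : E d → ℂ
  /-- its weak gradient -/
  grad : E d → EuclideanSpace ℂ (Fin d)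
  memLp : MemLp toFun 2 (volume.restrict D)
  memLp_grad : MemLp grad 2 (volume.restrict D)
  weak_grad : ∀ ψ : E d → ℝ, ContDiff ℝ ∞ ψ → HasCompactSupport ψ → tsupport ψ ⊆ D →
    ∀ i : Fin d, ∫ x in D, toFun x * (fderiv ℝ ψ x (EuclideanSpace.single i (1 : ℝ)) : ℂ)
      = - ∫ x in D, grad x i * (ψ x : ℂ)

/-- `u|_{∂D} = f` in the sense of traces: `u` is the limit in `H¹(D)` of (restrictions of) smooth
functions on `ℝ^d` whose boundary values converge to `f` in `L²(∂D)`. On a bounded Lipschitz domain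
this is the graph of the trace operator, the continuous extension to `H¹(D)` of the restriction
map. -/
def H1.HasTrace {d : ℕ} {D : Set (E d)} (u : H1 D) (f : L2Boundary D) : Prop :=
  ∃ w : ℕ → E d → ℂ, (∀ n, ContDiff ℝ ∞ (w n)) ∧
    Tendsto (fun n => eLpNorm (w n - u.toFun) 2 (volume.restrict D)) atTop (𝓝 0) ∧
    Tendsto (fun n => eLpNorm (cgrad (w n) - u.grad) 2 (volume.restrict D)) atTop (𝓝 0) ∧
    Tendsto (fun n => eLpNorm (w n - ⇑f) 2 (surfaceMeasure D)) atTop (𝓝 0)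

/-- `H^{1/2}(∂D)`: the space of traces of the functions in `H¹(D)`. -/
def HHalf {d : ℕ} (D : Set (E d)) : Set (L2Boundary D) :=
  {f | ∃ u : H1 D, u.HasTrace f}

/-! ### The Dirichlet-to-Neumann map -/

/-- The Dirichlet form `∫_D γ ∇u · ∇v` (bilinear, without complex conjugation). -/
noncomputable def dirichletForm {d : ℕ} {D : Set (E d)} (γ : E d → ℝ) (u v : H1 D) : ℂ :=
  ∫ x in D, (γ x : ℂ) * ∑ i : Fin d, u.grad x i * v.grad x i

/-- `∇ · (γ ∇u) = 0` in `D`, weakly: the Dirichlet form vanishes on all test functions in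
`H¹(D)` whose trace is zero, that is, on `H¹₀(D)`. -/
def H1.IsSolution {d : ℕ} {D : Set (E d)} (u : H1 D) (γ : E d → ℝ) : Prop :=
  ∀ v : H1 D, v.HasTrace 0 → dirichletForm γ u v = 0

/-- `z = ⟨Λ_γ f, g⟩`, in the weak sense: `z = ∫_D γ ∇u · ∇v` where `u` solves the conductivity
equation with `u|_{∂D} = f`, and `v ∈ H¹(D)` satisfies `v|_{∂D} = g`. -/
def IsDNValue {d : ℕ} (D : Set (E d)) (γ : E d → ℝ) (f g : L2Boundary D) (z : ℂ) : Prop :=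
  ∃ u v : H1 D, u.HasTrace f ∧ u.IsSolution γ ∧ v.HasTrace g ∧ z = dirichletForm γ u v

open Classical in
/-- The duality pairing `∫_{∂D} Λ_γ f g` between `H^{-1/2}(∂D)` and `H^{1/2}(∂D)`, for
`f, g ∈ H^{1/2}(∂D)` (and zero for other boundary functions). -/
noncomputable def dnPairing {d : ℕ} (D : Set (E d)) (γ : E d → ℝ) (f g : L2Boundary D) : ℂ :=
  if h : ∃ z, IsDNValue D γ f g z then h.choose else 0

/-! ### The noise -/

/-- A family of independent complex Gaussian random variables `X_α`, `α ∈ ℕ²`, with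
`𝔼 X_α = 0`, `𝔼 (X_α conj X_α) = 1` and `𝔼 (X_α X_α) = 0`. -/
structure IsWhiteNoise {Ω : Type*} [MeasurableSpace Ω] (Pr : Measure Ω) (X : ℕ × ℕ → Ω → ℂ) :
    Prop where
  indep : iIndepFun X Pr
  gaussian : ∀ α, HasGaussianLaw (X α) Pr
  mean : ∀ α, ∫ s, X α s ∂Pr = 0
  variance : ∀ α, ∫ s, X α s * (starRingEnd ℂ) (X α s) ∂Pr = 1
  pseudo_variance : ∀ α, ∫ s, X α s * X α s ∂Pr = 0

section Noise

variable {Ω : Type*} [MeasurableSpace Ω] {Pr : Measure Ω} {X : ℕ × ℕ → Ω → ℂ}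
  {d : ℕ} {D : Set (E d)}

theorem IsWhiteNoise.memLp (hX : IsWhiteNoise Pr X) (α : ℕ × ℕ) : MemLp (X α) 2 Pr :=
  (hX.gaussian α).memLp_two

/-- The term `(f|e_{α₁}) (g|e_{α₂}) X_α` of the error, as an element of `L²(Ω)`. Here
`(f|e) = ∫_{∂D} f conj(e)`, which is `inner ℂ e f` in Mathlib's convention. -/
noncomputable def noiseTerm (hX : IsWhiteNoise Pr X) (e : HilbertBasis ℕ ℂ (L2Boundary D))
    (f g : L2Boundary D) (α : ℕ × ℕ) : Lp ℂ 2 Pr :=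
  (inner ℂ (e α.1) f * inner ℂ (e α.2) g) • (hX.memLp α).toLp (X α)

/-- The noisy data `𝒩_γ(f, g) = ∫_{∂D} Λ_γ f g + ∑_{α ∈ ℕ²} (f|e_{α₁}) (g|e_{α₂}) X_α`, a random
variable in `L²(Ω)`; the series converges in `L²(Ω)` (see `summable_noiseTerm`). -/
noncomputable def noisyData [IsProbabilityMeasure Pr] (γ : E d → ℝ) (hX : IsWhiteNoise Pr X)
    (e : HilbertBasis ℕ ℂ (L2Boundary D)) (f g : L2Boundary D) : Lp ℂ 2 Pr :=
  Lp.const 2 Pr (dnPairing D γ f g) + ∑' α : ℕ × ℕ, noiseTerm hX e f g α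

theorem IsWhiteNoise.orthonormal (hX : IsWhiteNoise Pr X) :
    Orthonormal ℂ (fun α => (hX.memLp α).toLp (X α)) := by
  classical
  rw [orthonormal_iff_ite]
  intro α β
  have h1 : inner ℂ ((hX.memLp α).toLp (X α)) ((hX.memLp β).toLp (X β))
      = ∫ s, X β s * (starRingEnd ℂ) (X α s) ∂Pr := by
    rw [L2.inner_def]
    refine integral_congr_ae ?_
    filter_upwards [(hX.memLp α).coeFn_toLp, (hX.memLp β).coeFn_toLp] with s ha hb
    rw [ha, hb, RCLike.inner_apply]
  rw [h1]
  split_ifs with hab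
  · subst hab
    exact hX.variance α
  · have hi : IndepFun (X β) (fun s => (starRingEnd ℂ) (X α s)) Pr :=
      (hX.indep.indepFun (Ne.symm hab)).comp measurable_id
        (Complex.continuous_conj.measurable)
    have h2 := hi.integral_fun_mul_eq_mul_integral (hX.memLp β).aestronglyMeasurable
      (Complex.continuous_conj.comp_aestronglyMeasurable (hX.memLp α).aestronglyMeasurable)
    simpa [hX.mean β] using h2

/-- The series that defines the error converges in `L²(Ω)`. -/
theorem summable_noiseTerm (hX : IsWhiteNoise Pr X) (e : HilbertBasis ℕ ℂ (L2Boundary D))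
    (f g : L2Boundary D) : Summable (noiseTerm hX e f g) := by
  have hO := hX.orthonormal
  have hf : Summable fun n => ‖inner ℂ (e n) f‖ ^ 2 := e.orthonormal.inner_products_summable f
  have hg : Summable fun n => ‖inner ℂ (e n) g‖ ^ 2 := e.orthonormal.inner_products_summable g
  have hfg := hf.mul_of_nonneg hg (fun _ => by positivity) (fun _ => by positivity)
  have h := (hO.orthogonalFamily.summable_iff_norm_sq_summable
    (f := fun α : ℕ × ℕ => inner ℂ (e α.1) f * inner ℂ (e α.2) g)).2
    (by simpa [mul_pow] using hfg)
  simp only [LinearIsometry.toSpanSingleton_apply] at h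
  exact h

end Noise

/-! ### Brown's oscillating boundary data -/

/-- The data out of which the boundary functions at `P` are built: a local representation of the
boundary whose function `φ` is differentiable at `p'` and satisfies
`r^{1-d} ∫_{|x'| ≤ r} |∇φ(x'+p') - ∇φ(p')|² dx' → 0`, a smooth cut-off `η`, and a direction `ξ`. -/
structure BrownData {d : ℕ} (D : Set (E d)) (P : E d) extends BoundaryChart D P where
  differentiableAt : DifferentiableAt ℝ φ (coord P).fst
  lebesgue : Tendsto (fun r : ℝ => (r ^ (d - 1))⁻¹ *
    ∫ x in Metric.closedBall (0 : E (d - 1)) r,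
      ‖gradient φ (x + (coord P).fst) - gradient φ (coord P).fst‖ ^ 2) (𝓝[>] 0) (𝓝 0)
  /-- the cut-off -/
  η : ℝ → ℝ
  η_smooth : ContDiff ℝ ∞ η
  η_mem : ∀ t, η t ∈ Set.Icc (0 : ℝ) 1
  η_one : ∀ t, |t| ≤ 1 / 2 → η t = 1
  η_zero : ∀ t, 1 ≤ |t| → η t = 0
  /-- the direction of the oscillations -/
  ξ : Coord d
  ξ_ne : ξ ≠ 0
  /-- `ξ · A ξ = e_d · A e_d`, where `A = B Bᵗ` and `B = ∇F⁻¹(P)`, so that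
  `Bᵗ (ζ', ζ_d) = (ζ' - ζ_d ∇φ(p'), ζ_d)`. The coefficient matrix of the flattened equation at the
  origin is `A` multiplied by the positive number `γ(P)`, which drops out of both conditions. -/
  ξ_norm :
    ‖ξ.fst - ξ.snd • gradient φ (coord P).fst‖ ^ 2 + ξ.snd ^ 2
      = ‖gradient φ (coord P).fst‖ ^ 2 + 1
  /-- `ξ · A e_d = 0`. -/
  ξ_orth :
    inner ℝ (ξ.fst - ξ.snd • gradient φ (coord P).fst) (-gradient φ (coord P).fst) + ξ.snd = 0

namespace BrownData

variable {d : ℕ} {D : Set (E d)} {P : E d} (b : BrownData D P)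

/-- The point `p'`, where `(p', φ(p'))` are the coordinates of `P ∈ ∂D`. -/
noncomputable def p' : E (d - 1) := (b.coord P).fst

/-- The flattening `F⁻¹`, where (in the coordinates) `F(x) = (x' + p', x_d + φ(x' + p'))`. -/
noncomputable def flatten (y : E d) : Coord d :=
  WithLp.toLp 2 ((b.coord y).fst - b.p', (b.coord y).snd - b.φ (b.coord y).fst)

/-- Brown's oscillating function
`a_{M,N}(x) = η(M|x'|) η(M x_d) exp(N (iξ - e_d) · x)`. -/
noncomputable def a (M N : ℝ) (x : Coord d) : ℂ :=
  (b.η (M * ‖x.fst‖) : ℂ) * (b.η (M * x.snd) : ℂ) *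
    Complex.exp ((N : ℂ) * (Complex.I * (inner ℝ b.ξ x : ℝ) - (x.snd : ℝ)))

/-- The constant `C_P = ((1 + |∇φ(p')|²) ∫_{ℝ^{d-1}} η(|x'|)² dx')^{-1/2}`. -/
noncomputable def C : ℝ :=
  ((1 + ‖gradient b.φ b.p'‖ ^ 2) * ∫ x : E (d - 1), b.η ‖x‖ ^ 2) ^ (-(1 / 2) : ℝ)

/-- The function `N^{-1/2} M^{(d-1)/2} C_P a_{M,N} ∘ F⁻¹` with `M = N^{1/2}`. Its restriction to the
boundary is the boundary value of Brown's oscillating solution. -/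
noncomputable def boundaryFun (N : ℕ) (y : E d) : ℂ :=
  (((N : ℝ) ^ (-(1 / 2) : ℝ) * ((N : ℝ) ^ (1 / 2 : ℝ)) ^ (((d : ℝ) - 1) / 2) * b.C : ℝ) : ℂ) *
    b.a ((N : ℝ) ^ (1 / 2 : ℝ)) N (b.flatten y)

end BrownData

end Calderon

/-! Noise and signal are treated separately. By orthonormality of the `X α` and Bessel's inequality,
the noise attached to `f_N` has second moment at most `‖f_N‖⁴`. On `∂D` the exponential has modulus
one and the cut-off lives on a set of measure `O(M^{-(d-1)})`, so `‖f_N‖² = O(1/N)`. The second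
moments are therefore summable and the noise tends to zero almost surely (`norm_tsum_noiseTerm_le`,
`BrownData.exists_norm_sq_le`, `ae_tendsto_noisyData`).

For the signal, let `u_N` be Brown's function in the interior of `D`. It is Lipschitz, hence in
`H¹(D)` with trace `f_N`. The solution with the same trace is `u_N - r`, where `∇r` is the
orthogonal projection of `∇u_N`, in `L²(γ dx)`, on the gradients of functions with zero trace. Hence
the pairing equals `‖∇u_N‖² - ‖∇r‖²`, and `‖∇r‖` is at most the norm of the functional `v ↦ ∫ γ ∇u_N
· ∇v` on zero-trace functions (`IsElliptic.norm_dnPairing_sub_le`). It remains to show that the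
energy tends to `γ(P)` and that the residual tends to zero.

Both facts come from `∇u_N ≈ lead · freq`, where `freq` is the vector `iξ - e_d` carried back to the
original coordinates with the slope of `φ` frozen at `p'`. The energy sits in a layer of depth `1/N`
over a disc of radius `1/M`; `C_P` is the constant that normalises it. The conditions on `ξ` say
that the real and imaginary parts of `freq` are orthogonal and of equal length, so `freq · freq =
0`. After an integration by parts the order `N` derivative of the exponential cancels and only
derivatives of the cut-off, of order `M`, survive (`BrownData.exists_enorm_integral_lead_le`).

Since `φ` is merely Lipschitz, its gradient is never differentiated: `∇φ - ∇φ(p')` is kept as an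
error factor. All errors are dominated by one weight whose squared `L²` norm is at most `C_P²` times
the mean square of `∇φ - ∇φ(p')` at scale `1/M` plus a multiple of `1/N`. This is where the
Lebesgue-point condition enters; `M = N^{1/2}` makes both `1/M` and `M/N` small. Rademacher's
theorem and Lebesgue differentiation supply such points almost everywhere. -/

namespace Calderon

/-! ### Surface measure and volume in graph charts -/

section Hausdorff

theorem euclideanHausdorffMeasure_image_le {X Y : Type*} [EMetricSpace X] [MeasurableSpace X]
    [BorelSpace X] [EMetricSpace Y] [MeasurableSpace Y] [BorelSpace Y] {K : ℝ≥0} {f : X → Y}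
    (hf : LipschitzWith K f) (k : ℕ) (s : Set X) :
    μHE[k] (f '' s) ≤ (K : ℝ≥0∞) ^ k * μHE[k] s := by
  have h := hf.hausdorffMeasure_image_le (d := k) (Nat.cast_nonneg k) s
  rw [ENNReal.rpow_natCast] at h
  simp only [Measure.euclideanHausdorffMeasure_def, Measure.smul_apply, ENNReal.smul_def,
    smul_eq_mul]
  calc _ ≤ _ * ((K : ℝ≥0∞) ^ k * μH[k] s) := by gcongr
    _ = _ := by ring

end Hausdorff

namespace BoundaryChart

variable {d : ℕ} {D : Set (E d)} {P : E d} (c : BoundaryChart D P)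

/-- The projection `y ↦ y'`. -/
noncomputable def proj (y : E d) : E (d - 1) := (c.coord y).fst

/-- The parametrisation `(x, t) ↦ (x, t + φ x)` of the whole space, in the coordinates. -/
noncomputable def param (z : E (d - 1) × ℝ) : E d :=
  c.coord.symm (WithLp.toLp 2 (z.1, z.2 + c.φ z.1))

/-- The parametrisation of the graph of `φ`. -/
noncomputable def graph (x : E (d - 1)) : E d := c.param (x, 0)

theorem coord_param (z : E (d - 1) × ℝ) :
    c.coord (c.param z) = WithLp.toLp 2 (z.1, z.2 + c.φ z.1) := by
  simp [param]

@[simp] theorem proj_param (z : E (d - 1) × ℝ) : c.proj (c.param z) = z.1 := by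
  simp [proj, coord_param]

@[simp] theorem proj_graph (x : E (d - 1)) : c.proj (c.graph x) = x := by
  simp [graph]

theorem norm_fst_le (x : Coord d) : ‖x.fst‖ ≤ ‖x‖ := by
  rw [WithLp.prod_norm_eq_of_L2]
  exact Real.le_sqrt_of_sq_le (by nlinarith [sq_nonneg ‖x.snd‖])

theorem norm_snd_le (x : Coord d) : ‖x.snd‖ ≤ ‖x‖ := by
  rw [WithLp.prod_norm_eq_of_L2]
  exact Real.le_sqrt_of_sq_le (by nlinarith [sq_nonneg ‖x.fst‖])

theorem norm_le_add (x : Coord d) : ‖x‖ ≤ ‖x.fst‖ + ‖x.snd‖ := by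
  rw [WithLp.prod_norm_eq_of_L2]
  exact Real.sqrt_le_iff.2 ⟨by positivity, by nlinarith [norm_nonneg x.fst, norm_nonneg x.snd]⟩

theorem lipschitzWith_proj : LipschitzWith 1 c.proj := by
  refine LipschitzWith.of_dist_le_mul fun x y => ?_
  rw [dist_eq_norm, dist_eq_norm, NNReal.coe_one, one_mul]
  have := norm_fst_le (c.coord (x - y))
  rw [c.coord.norm_map] at this
  simpa [proj, map_sub] using this

theorem dist_param_le {K : ℝ≥0} (hK : LipschitzWith K c.φ) (z w : E (d - 1) × ℝ) :
    dist (c.param z) (c.param w) ≤ (1 + K) * dist z.1 w.1 + dist z.2 w.2 := by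
  rw [param, param, c.coord.symm.isometry.dist_eq, dist_eq_norm]
  refine (norm_le_add _).trans ?_
  have h1 := hK.dist_le_mul z.1 w.1
  simp only [WithLp.sub_fst, WithLp.sub_snd]
  rw [← dist_eq_norm, ← dist_eq_norm]
  have h2 := dist_add_add_le z.2 (c.φ z.1) w.2 (c.φ w.1)
  change dist z.1 w.1 + dist (z.2 + c.φ z.1) (w.2 + c.φ w.1) ≤ _
  linarith

theorem lipschitzWith_graph {K : ℝ≥0} (hK : LipschitzWith K c.φ) :
    LipschitzWith (1 + K) c.graph := by
  refine LipschitzWith.of_dist_le_mul fun x y => ?_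
  simpa [graph] using c.dist_param_le hK (x, 0) (y, 0)

theorem continuous_φ : Continuous c.φ := c.lipschitz.choose_spec.continuous

theorem continuous_graph : Continuous c.graph :=
  (c.lipschitzWith_graph c.lipschitz.choose_spec).continuous

theorem param_eq_of_coord {y : E d} {t : ℝ} (h : (c.coord y).snd = t + c.φ (c.proj y)) :
    c.param (c.proj y, t) = y := by
  rw [param, LinearIsometryEquiv.symm_apply_eq]
  refine WithLp.ofLp_injective 2 (Prod.ext rfl ?_)
  simpa using h.symm

theorem graph_proj_of_mem {y : E d} (hy : y ∈ Metric.ball P c.ρ) (h : y ∈ frontier D) :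
    c.graph (c.proj y) = y :=
  c.param_eq_of_coord (by simpa [proj] using (c.mem_frontier_iff y hy).1 h)

theorem param_mem_iff {z : E (d - 1) × ℝ} (hz : c.param z ∈ Metric.ball P c.ρ) :
    c.param z ∈ D ↔ 0 < z.2 := by
  rw [c.mem_iff _ hz, coord_param]; simp

theorem graph_mem_frontier {x : E (d - 1)} (hz : c.graph x ∈ Metric.ball P c.ρ) :
    c.graph x ∈ frontier D := by
  rw [c.mem_frontier_iff _ hz, graph, coord_param]; simp

/-- The projection is 1-Lipschitz, and the graph map is Lipschitz. The two resulting one-sided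
bounds replace the area formula: the exact surface density never matters, because the limit constant
comes from volume integrals and the boundary only enters through estimates. -/
theorem volume_proj_image_le (A : Set (E d)) : volume (c.proj '' A) ≤ μHE[d - 1] A := by
  rw [← EuclideanSpace.euclideanHausdorffMeasure_eq_volume]
  simpa using euclideanHausdorffMeasure_image_le c.lipschitzWith_proj (d - 1) A

theorem graph_image_measure_le {K : ℝ≥0} (hK : LipschitzWith K c.φ) (S : Set (E (d - 1))) :
    μHE[d - 1] (c.graph '' S) ≤ ((1 + K : ℝ≥0) : ℝ≥0∞) ^ (d - 1) * volume S := by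
  rw [← EuclideanSpace.euclideanHausdorffMeasure_eq_volume]
  exact euclideanHausdorffMeasure_image_le (c.lipschitzWith_graph hK) (d - 1) S

theorem map_graph_restrict_le {S : Set (E (d - 1))}
    (h : c.graph '' S ⊆ frontier D) :
    (volume.restrict S).map c.graph ≤ surfaceMeasure D := by
  refine Measure.le_iff.2 fun T hT => ?_
  rw [Measure.map_apply c.continuous_graph.measurable hT,
    Measure.restrict_apply (c.continuous_graph.measurable hT), surfaceMeasure,
    Measure.restrict_apply hT]
  refine le_trans (measure_mono ?_) (c.volume_proj_image_le (T ∩ frontier D))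
  rintro x ⟨hx, hxS⟩
  exact ⟨c.graph x, ⟨hx, h ⟨x, hxS, rfl⟩⟩, by simp⟩

theorem surfaceMeasure_le_of_subset {K : ℝ≥0} (hK : LipschitzWith K c.φ) {A : Set (E d)}
    (hA : MeasurableSet A) (hAP : A ⊆ Metric.ball P c.ρ) {S : Set (E (d - 1))}
    (hS : c.proj '' (A ∩ frontier D) ⊆ S) :
    surfaceMeasure D A ≤ ((1 + K : ℝ≥0) : ℝ≥0∞) ^ (d - 1) * volume S := by
  rw [surfaceMeasure, Measure.restrict_apply hA]
  refine le_trans (measure_mono ?_) (c.graph_image_measure_le hK S)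
  rintro y ⟨hy, hyD⟩
  exact ⟨c.proj y, hS ⟨y, ⟨hy, hyD⟩, rfl⟩, c.graph_proj_of_mem (hAP hy) hyD⟩

/-- A shear translates each vertical fibre, so Fubini gives invariance of volume without any
differentiability of `φ`. -/
theorem measurePreserving_param : MeasurePreserving c.param (volume.prod volume) volume := by
  have h1 : MeasurePreserving (fun z : E (d - 1) × ℝ => (z.1, z.2 + c.φ z.1))
      (volume.prod volume) (volume.prod volume) := by
    refine (MeasurePreserving.id volume).skew_product (g := fun x t => t + c.φ x) ?_ ?_
    · exact (measurable_snd.add (c.continuous_φ.measurable.comp measurable_fst))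
    · exact ae_of_all _ fun x => map_add_right_eq_self _ _
  have h2 := WithLp.volume_preserving_toLp (E (d - 1)) ℝ
  exact c.coord.symm.measurePreserving.comp (h2.comp h1)

theorem continuous_param : Continuous c.param := by
  have := c.continuous_φ
  unfold param
  refine c.coord.symm.continuous.comp ((WithLp.prod_continuous_toLp 2 _ _).comp ?_)
  fun_prop

/-- The inverse of the parametrisation. -/
noncomputable def paramInv (y : E d) : E (d - 1) × ℝ :=
  (c.proj y, (c.coord y).snd - c.φ (c.proj y))

theorem continuous_paramInv : Continuous c.paramInv := by
  have h1 := c.lipschitzWith_proj.continuous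
  have h2 := c.continuous_φ
  have h3 : Continuous fun y => (c.coord y).snd :=
    (continuous_snd.comp (WithLp.prod_continuous_ofLp 2 _ _)).comp c.coord.continuous
  unfold paramInv
  fun_prop

theorem param_paramInv (y : E d) : c.param (c.paramInv y) = y :=
  c.param_eq_of_coord (by simp)

theorem paramInv_param (z : E (d - 1) × ℝ) : c.paramInv (c.param z) = z := by
  ext1
  · simp [paramInv]
  · simp [paramInv, coord_param]

/-- The parametrisation as a homeomorphism. -/
noncomputable def paramHomeo : (E (d - 1) × ℝ) ≃ₜ E d where
  toFun := c.param
  invFun := c.paramInv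
  left_inv := c.paramInv_param
  right_inv := c.param_paramInv
  continuous_toFun := c.continuous_param
  continuous_invFun := c.continuous_paramInv

theorem measurableEmbedding_param : MeasurableEmbedding c.param :=
  c.paramHomeo.measurableEmbedding

end BoundaryChart

/-- The boundary is compact, and within a chart ball it is a Lipschitz image of a bounded piece of
`ℝ^{d-1}`. -/
theorem isFiniteMeasure_surfaceMeasure {d : ℕ} {D : Set (E d)}
    (hD_bdd : Bornology.IsBounded D) (hD_lip : HasLipschitzBoundary D) :
    IsFiniteMeasure (surfaceMeasure D) := by
  have hc : IsCompact (frontier D) :=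
    Metric.isCompact_of_isClosed_isBounded isClosed_frontier
      (hD_bdd.closure.subset frontier_subset_closure)
  have key : surfaceMeasure D (frontier D) < ⊤ := by
    refine hc.measure_lt_top_of_nhdsWithin fun P hP => ?_
    obtain ⟨c⟩ := hD_lip P hP
    refine ⟨Metric.ball P c.ρ, mem_nhdsWithin_of_mem_nhds (Metric.ball_mem_nhds P c.ρ_pos), ?_⟩
    obtain ⟨K, hK⟩ := c.lipschitz
    refine (c.surfaceMeasure_le_of_subset hK measurableSet_ball subset_rfl
      (S := Metric.ball (c.proj P) c.ρ) ?_).trans_lt ?_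
    · rintro _ ⟨y, ⟨hy, -⟩, rfl⟩
      have := c.lipschitzWith_proj.dist_le_mul y P
      simp only [NNReal.coe_one, one_mul] at this
      exact this.trans_lt hy
    · exact ENNReal.mul_lt_top (ENNReal.pow_lt_top ENNReal.coe_lt_top) measure_ball_lt_top
  refine ⟨?_⟩
  rw [surfaceMeasure, Measure.restrict_apply_univ]
  rwa [surfaceMeasure, Measure.restrict_apply_self] at key

end Calderon

/-! ### Complex gradients, `L²` convergence, and elements of `H¹(D)` -/

namespace Calderon

section Gradient

variable {d : ℕ}

theorem fderiv_eq_sum_cgrad (w : E d → ℂ) (x v : E d) :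
    fderiv ℝ w x v = ∑ i, (v i : ℂ) * cgrad w x i := by
  have hv : v = ∑ i, v i • EuclideanSpace.single i (1 : ℝ) := by
    simpa using ((EuclideanSpace.basisFun (Fin d) ℝ).sum_repr v).symm
  conv_lhs => rw [hv]
  rw [map_sum]
  simp [cgrad]

theorem norm_fderiv_apply_le (w : E d → ℂ) (x v : E d) :
    ‖fderiv ℝ w x v‖ ≤ ‖v‖ * ‖cgrad w x‖ := by
  rw [fderiv_eq_sum_cgrad]
  refine (norm_sum_le _ _).trans ?_
  rw [EuclideanSpace.norm_eq, EuclideanSpace.norm_eq]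
  simp only [norm_mul, Complex.norm_real]
  exact Real.sum_mul_le_sqrt_mul_sqrt _ _ _

theorem norm_cgrad_le (w : E d → ℂ) (x : E d) : ‖cgrad w x‖ ≤ d * ‖fderiv ℝ w x‖ := by
  rw [EuclideanSpace.norm_eq]
  refine Real.sqrt_le_iff.2 ⟨by positivity, ?_⟩
  have h : ∀ i ∈ Finset.univ, ‖cgrad w x i‖ ^ 2 ≤ ‖fderiv ℝ w x‖ ^ 2 := fun i _ => by
    gcongr
    simpa [cgrad] using (fderiv ℝ w x).le_opNorm (EuclideanSpace.single i (1 : ℝ))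
  refine (Finset.sum_le_card_nsmul _ _ _ h).trans ?_
  rw [Finset.card_univ, Fintype.card_fin, nsmul_eq_mul, mul_pow]
  have : (d : ℝ) ≤ (d : ℝ) ^ 2 := by exact_mod_cast Nat.le_self_pow two_ne_zero d
  gcongr

theorem continuous_cgrad {w : E d → ℂ} (hw : ContDiff ℝ 1 w) : Continuous (cgrad w) := by
  refine (PiLp.continuous_toLp 2 _).comp (continuous_pi fun i => ?_)
  exact (hw.continuous_fderiv one_ne_zero).clm_apply continuous_const

theorem cgrad_congr {w w' : E d → ℂ} {x : E d} (h : w =ᶠ[𝓝 x] w') : cgrad w x = cgrad w' x := by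
  simp only [cgrad, h.fderiv_eq]

theorem cgrad_add {w w' : E d → ℂ} {x : E d} (h : DifferentiableAt ℝ w x)
    (h' : DifferentiableAt ℝ w' x) : cgrad (w + w') x = cgrad w x + cgrad w' x := by
  ext i; simp [cgrad, fderiv_add h h']

theorem cgrad_smul {w : E d → ℂ} {x : E d} (h : DifferentiableAt ℝ w x) (c : ℂ) :
    cgrad (c • w) x = c • cgrad w x := by
  ext i; simp [cgrad, fderiv_const_smul h]

/-- Entrywise complex conjugation. -/
noncomputable def conjVec (v : EuclideanSpace ℂ (Fin d)) : EuclideanSpace ℂ (Fin d) :=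
  WithLp.toLp 2 fun i => (starRingEnd ℂ) (v i)

@[simp] theorem conjVec_apply (v : EuclideanSpace ℂ (Fin d)) (i : Fin d) :
    conjVec v i = (starRingEnd ℂ) (v i) := rfl

@[simp] theorem norm_conjVec (v : EuclideanSpace ℂ (Fin d)) : ‖conjVec v‖ = ‖v‖ := by
  simp [EuclideanSpace.norm_eq]

theorem conjVec_sub (v w : EuclideanSpace ℂ (Fin d)) :
    conjVec (v - w) = conjVec v - conjVec w := by
  ext i; simp

theorem continuous_conjVec : Continuous (conjVec (d := d)) := by
  refine (PiLp.continuous_toLp 2 _).comp (continuous_pi fun i => ?_)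
  exact Complex.continuous_conj.comp (PiLp.continuous_apply 2 _ i)

theorem cgrad_conj {w : E d → ℂ} {x : E d} (h : DifferentiableAt ℝ w x) :
    cgrad (fun y => (starRingEnd ℂ) (w y)) x = conjVec (cgrad w x) := by
  ext i
  have := (Complex.conjCLE.toContinuousLinearMap.hasFDerivAt.comp x h.hasFDerivAt).fderiv
  have h2 : (⇑Complex.conjCLE.toContinuousLinearMap ∘ w) = fun y => (starRingEnd ℂ) (w y) := rfl
  rw [h2] at this
  simp [cgrad, this]

end Gradient

section Lp

variable {α : Type*} [MeasurableSpace α] {μ : Measure α}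

theorem eLpNorm_mul_one_le {u h : α → ℂ} (hu : AEStronglyMeasurable u μ)
    (hh : AEStronglyMeasurable h μ) :
    eLpNorm (fun x => u x * h x) 1 μ ≤ eLpNorm u 2 μ * eLpNorm h 2 μ := by
  have := eLpNorm_smul_le_mul_eLpNorm (p := 2) (q := 2) (r := 1) hh hu
  exact this

theorem integrable_mul_of_memLp_two {u h : α → ℂ} (hu : MemLp u 2 μ) (hh : MemLp h 2 μ) :
    Integrable (fun x => u x * h x) μ :=
  hu.integrable_mul hh

theorem tendsto_integral_mul_of_tendsto_eLpNorm {u h : α → ℂ} {w : ℕ → α → ℂ}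
    (hw : ∀ n, MemLp (w n) 2 μ) (hu : MemLp u 2 μ) (hh : MemLp h 2 μ)
    (H : Tendsto (fun n => eLpNorm (w n - u) 2 μ) atTop (𝓝 0)) :
    Tendsto (fun n => ∫ x, w n x * h x ∂μ) atTop (𝓝 (∫ x, u x * h x ∂μ)) := by
  refine tendsto_integral_of_L1' _ (hu.integrable_mul hh).1
    (Eventually.of_forall fun n => (hw n).integrable_mul hh) ?_
  refine tendsto_of_tendsto_of_tendsto_of_le_of_le tendsto_const_nhds
    (h := fun n => eLpNorm (w n - u) 2 μ * eLpNorm h 2 μ) ?_ (fun _ => zero_le) fun n => ?_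
  · simpa using ENNReal.Tendsto.mul_const H (Or.inr hh.2.ne)
  · refine le_trans (le_of_eq ?_) (eLpNorm_mul_one_le ((hw n).1.sub hu.1) hh.1)
    congr 1; ext x; simp [sub_mul]

end Lp

variable {d : ℕ} {D : Set (E d)}

theorem memLp_of_continuous (hD_open : IsOpen D) (hD_bdd : Bornology.IsBounded D) {F : Type*}
    [NormedAddCommGroup F] {w : E d → F} (hw : Continuous w) (p : ℝ≥0∞) :
    MemLp w p (volume.restrict D) := by
  have hc : IsCompact (closure D) := hD_bdd.isCompact_closure
  obtain ⟨C, hC⟩ := hc.exists_bound_of_continuousOn hw.continuousOn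
  have : IsFiniteMeasure (volume.restrict D) :=
    ⟨by rw [Measure.restrict_apply_univ]; exact hD_bdd.measure_lt_top⟩
  refine MemLp.of_bound hw.aestronglyMeasurable C ?_
  exact ae_restrict_of_forall_mem hD_open.measurableSet fun x hx => hC x (subset_closure hx)

theorem memLp_testFunction {F : Type*} [NormedAddCommGroup F] {ψ : E d → F} (hψ : Continuous ψ)
    (h : HasCompactSupport ψ) (p : ℝ≥0∞) : MemLp ψ p (volume.restrict D) :=
  (hψ.memLp_of_hasCompactSupport h).restrict D

theorem memLp_ofReal_testFunction {ψ : E d → ℝ} (hψ : ContDiff ℝ ∞ ψ) (h : HasCompactSupport ψ) :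
    MemLp (fun x => (ψ x : ℂ)) 2 (volume.restrict D) :=
  memLp_testFunction (Complex.continuous_ofReal.comp hψ.continuous)
    (h.comp_left (g := fun r : ℝ => (r : ℂ)) (by simp)) 2

theorem memLp_ofReal_fderiv_testFunction {ψ : E d → ℝ} (hψ : ContDiff ℝ ∞ ψ)
    (h : HasCompactSupport ψ) (v : E d) :
    MemLp (fun x => (fderiv ℝ ψ x v : ℂ)) 2 (volume.restrict D) :=
  memLp_testFunction (Complex.continuous_ofReal.comp
      ((hψ.continuous_fderiv (by simp)).clm_apply continuous_const))
    ((h.fderiv_apply (𝕜 := ℝ) v).comp_left (g := fun r : ℝ => (r : ℂ)) (by simp)) 2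

theorem memLp_apply {α : Type*} [MeasurableSpace α] {μ : Measure α}
    {g : α → EuclideanSpace ℂ (Fin d)} {p : ℝ≥0∞} (hg : MemLp g p μ) (i : Fin d) :
    MemLp (fun x => g x i) p μ := by
  refine hg.mono ((PiLp.continuous_apply 2 _ i).comp_aestronglyMeasurable hg.1) ?_
  exact ae_of_all _ fun x => PiLp.norm_apply_le (g x) i

theorem eLpNorm_apply_le {α : Type*} [MeasurableSpace α] {μ : Measure α}
    (g : α → EuclideanSpace ℂ (Fin d)) (p : ℝ≥0∞) (i : Fin d) :
    eLpNorm (fun x => g x i) p μ ≤ eLpNorm g p μ :=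
  eLpNorm_mono fun x => PiLp.norm_apply_le (g x) i

namespace H1

/-- The elements of `H¹(D)` that are limits of sequences of elements of `H¹(D)`. -/
def ofTendsto (v : ℕ → H1 D) (u : E d → ℂ) (g : E d → EuclideanSpace ℂ (Fin d))
    (hu : MemLp u 2 (volume.restrict D)) (hg : MemLp g 2 (volume.restrict D))
    (h1 : Tendsto (fun n => eLpNorm ((v n).toFun - u) 2 (volume.restrict D)) atTop (𝓝 0))
    (h2 : Tendsto (fun n => eLpNorm ((v n).grad - g) 2 (volume.restrict D)) atTop (𝓝 0)) :
    H1 D where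
  toFun := u
  grad := g
  memLp := hu
  memLp_grad := hg
  weak_grad ψ hψ hc hD i := by
    have e1 := tendsto_integral_mul_of_tendsto_eLpNorm (fun n => (v n).memLp) hu
      (memLp_ofReal_fderiv_testFunction (D := D) hψ hc (EuclideanSpace.single i (1 : ℝ))) h1
    have e2 := tendsto_integral_mul_of_tendsto_eLpNorm (fun n => memLp_apply (v n).memLp_grad i)
      (memLp_apply hg i) (memLp_ofReal_testFunction (D := D) hψ hc)
      (tendsto_of_tendsto_of_tendsto_of_le_of_le tendsto_const_nhds h2 (fun _ => zero_le)
        fun n => eLpNorm_apply_le ((v n).grad - g) 2 i)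
    refine tendsto_nhds_unique e1 (e2.neg.congr fun n => ?_)
    exact ((v n).weak_grad ψ hψ hc hD i).symm

/-- The linear combination `u + c v` in `H¹(D)`. -/
def addSMul (u : H1 D) (c : ℂ) (v : H1 D) : H1 D where
  toFun := u.toFun + c • v.toFun
  grad := u.grad + c • v.grad
  memLp := u.memLp.add (v.memLp.const_smul c)
  memLp_grad := u.memLp_grad.add (v.memLp_grad.const_smul c)
  weak_grad ψ hψ hc hD i := by
    have h1 := memLp_ofReal_fderiv_testFunction (D := D) hψ hc (EuclideanSpace.single i (1 : ℝ))
    have h2 := memLp_ofReal_testFunction (D := D) hψ hc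
    have e1 : ∀ x, (u.toFun + c • v.toFun) x * (fderiv ℝ ψ x (EuclideanSpace.single i (1 : ℝ)) : ℂ)
      = u.toFun x * (fderiv ℝ ψ x (EuclideanSpace.single i (1 : ℝ)) : ℂ)
        + c * (v.toFun x * (fderiv ℝ ψ x (EuclideanSpace.single i (1 : ℝ)) : ℂ)) := fun x => by
      simp; ring
    have e2 : ∀ x, (u.grad + c • v.grad) x i * (ψ x : ℂ)
      = u.grad x i * (ψ x : ℂ) + c * (v.grad x i * (ψ x : ℂ)) := fun x => by
      simp; ring
    simp only [e1, e2]
    rw [integral_add (integrable_mul_of_memLp_two u.memLp h1)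
        ((integrable_mul_of_memLp_two v.memLp h1).const_mul c),
      integral_add (integrable_mul_of_memLp_two (memLp_apply u.memLp_grad i) h2)
        ((integrable_mul_of_memLp_two (memLp_apply v.memLp_grad i) h2).const_mul c),
      integral_const_mul, integral_const_mul]
    rw [u.weak_grad ψ hψ hc hD i, v.weak_grad ψ hψ hc hD i]
    ring

/-- The complex conjugate of an element of `H¹(D)`. -/
noncomputable def conj (u : H1 D) : H1 D where
  toFun x := (starRingEnd ℂ) (u.toFun x)
  grad x := conjVec (u.grad x)
  memLp := u.memLp.star
  memLp_grad := u.memLp_grad.of_le (continuous_conjVec.comp_aestronglyMeasurable u.memLp_grad.1)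
    (ae_of_all _ fun x => (norm_conjVec _).le)
  weak_grad ψ hψ hc hD i := by
    have := congrArg (starRingEnd ℂ) (u.weak_grad ψ hψ hc hD i)
    rw [map_neg, ← integral_conj, ← integral_conj] at this
    simpa using this

/-- A smooth function, as an element of `H¹(D)`. -/
noncomputable def ofSmooth (w : E d → ℂ) (hw : ContDiff ℝ ∞ w)
    (h1 : MemLp w 2 (volume.restrict D)) (h2 : MemLp (cgrad w) 2 (volume.restrict D)) :
    H1 D where
  toFun := w
  grad := cgrad w
  memLp := h1
  memLp_grad := h2
  weak_grad ψ hψ hc hD i := by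
    have hψ' : ContDiff ℝ ∞ (fun x => (ψ x : ℂ)) := Complex.ofRealCLM.contDiff.comp hψ
    have hcψ' : HasCompactSupport (fun x => (ψ x : ℂ)) :=
      hc.comp_left (g := fun r : ℝ => (r : ℂ)) (by simp)
    have hd : ∀ x v, fderiv ℝ (fun x => (ψ x : ℂ)) x v = (fderiv ℝ ψ x v : ℂ) := fun x v => by
      have := (Complex.ofRealCLM.hasFDerivAt.comp x
        (hψ.differentiable (by simp) x).hasFDerivAt).fderiv
      have h2 : (⇑Complex.ofRealCLM ∘ ψ) = fun y => (ψ y : ℂ) := rfl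
      rw [h2] at this
      simp [this]
    -- Integration by parts takes place on all of `ℝ^d`, where compact support of the test function
    -- removes boundary terms; both integrands vanish off `D`.
    have key := integral_mul_fderiv_eq_neg_fderiv_mul_of_integrable (μ := (volume : Measure (E d)))
      (f := w) (g := fun x => (ψ x : ℂ)) (v := EuclideanSpace.single i (1 : ℝ))
      (((hw.continuous_fderiv (by simp)).clm_apply continuous_const).mul
        hψ'.continuous |>.integrable_of_hasCompactSupport hcψ'.mul_left)
      ((hw.continuous.mul ((hψ'.continuous_fderiv (by simp)).clm_apply
        continuous_const)).integrable_of_hasCompactSupport (hcψ'.fderiv_apply (𝕜 := ℝ) _).mul_left)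
      ((hw.continuous.mul hψ'.continuous).integrable_of_hasCompactSupport hcψ'.mul_left)
      (fun x _ => hw.differentiable (by simp) x) (fun x _ => hψ'.differentiable (by simp) x)
    simp only [hd] at key
    have z : ∀ x, x ∉ D → fderiv ℝ ψ x = 0 := fun x hx => by
      have : x ∉ tsupport (fderiv ℝ ψ) := fun h => hx (hD (tsupport_fderiv_subset ℝ h))
      exact image_eq_zero_of_notMem_tsupport this
    rw [setIntegral_eq_integral_of_forall_compl_eq_zero, key,
      setIntegral_eq_integral_of_forall_compl_eq_zero]
    · rfl
    · intro x hx
      have : ψ x = 0 := image_eq_zero_of_notMem_tsupport fun h => hx (hD h)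
      simp [this]
    · intro x hx
      simp [z x hx]

/-- The `ε` form suits diagonal arguments. Compact support costs nothing: a bump equal to one near
`closure D` changes neither the function nor its gradient there. -/
theorem hasTrace_iff (hD_open : IsOpen D) (hD_bdd : Bornology.IsBounded D) (u : H1 D)
    (f : L2Boundary D) : u.HasTrace f ↔ ∀ ε : ℝ≥0∞, 0 < ε → ∃ w : E d → ℂ, ContDiff ℝ ∞ w ∧
      HasCompactSupport w ∧ eLpNorm (w - u.toFun) 2 (volume.restrict D) ≤ ε ∧
      eLpNorm (cgrad w - u.grad) 2 (volume.restrict D) ≤ ε ∧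
      eLpNorm (w - ⇑f) 2 (surfaceMeasure D) ≤ ε := by
  constructor
  · rintro ⟨w, hw, h1, h2, h3⟩ ε hε
    obtain ⟨n, e1, e2, e3⟩ := (((ENNReal.tendsto_nhds_zero.1 h1 ε hε).and
      ((ENNReal.tendsto_nhds_zero.1 h2 ε hε).and (ENNReal.tendsto_nhds_zero.1 h3 ε hε)))).exists
    obtain ⟨R, hR0, hR⟩ := hD_bdd.closure.subset_ball_lt 0 0
    let χ : ContDiffBump (0 : E d) := ⟨R, R + 1, hR0, by linarith⟩
    have hχ : ∀ x ∈ closure D, (fun y => (χ y : ℂ) * w n y) =ᶠ[𝓝 x] w n := fun x hx => by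
      filter_upwards [Metric.isOpen_ball.mem_nhds (hR hx)] with y hy
      simp [χ.one_of_mem_closedBall (Metric.ball_subset_closedBall hy)]
    refine ⟨fun y => (χ y : ℂ) * w n y, (Complex.ofRealCLM.contDiff.comp χ.contDiff).mul (hw n),
      ((χ.hasCompactSupport.comp_left (g := fun r : ℝ => (r : ℂ)) (by simp))).mul_right, ?_, ?_, ?_⟩
    · refine le_of_eq_of_le (eLpNorm_congr_ae ?_) e1
      refine ae_restrict_of_forall_mem hD_open.measurableSet fun x hx => ?_
      simpa using (hχ x (subset_closure hx)).eq_of_nhds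
    · refine le_of_eq_of_le (eLpNorm_congr_ae ?_) e2
      refine ae_restrict_of_forall_mem hD_open.measurableSet fun x hx => ?_
      simpa using cgrad_congr (hχ x (subset_closure hx))
    · refine le_of_eq_of_le (eLpNorm_congr_ae ?_) e3
      refine ae_restrict_of_forall_mem isClosed_frontier.measurableSet fun x hx => ?_
      simpa using (hχ x (frontier_subset_closure hx)).eq_of_nhds
  · intro h
    choose w hw _ h1 h2 h3 using fun n : ℕ => h ((n : ℝ≥0∞) + 1)⁻¹ (by simp)
    have hlim : Tendsto (fun n : ℕ => ((n : ℝ≥0∞) + 1)⁻¹) atTop (𝓝 0) := by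
      have := (tendsto_add_atTop_iff_nat 1).2 ENNReal.tendsto_inv_nat_nhds_zero
      simpa using this
    exact ⟨w, hw, tendsto_of_tendsto_of_tendsto_of_le_of_le tendsto_const_nhds hlim
        (fun _ => zero_le) h1,
      tendsto_of_tendsto_of_tendsto_of_le_of_le tendsto_const_nhds hlim (fun _ => zero_le) h2,
      tendsto_of_tendsto_of_tendsto_of_le_of_le tendsto_const_nhds hlim (fun _ => zero_le) h3⟩

end H1

end Calderon

/-! ### A Friedrichs inequality along rays leaving the domain -/

namespace Calderon

theorem ennreal_add_sq_le (a b : ℝ≥0∞) : (a + b) ^ 2 ≤ 2 * (a ^ 2 + b ^ 2) := by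
  rcases eq_or_ne a ⊤ with rfl | ha
  · simp
  rcases eq_or_ne b ⊤ with rfl | hb
  · simp
  lift a to ℝ≥0 using ha
  lift b to ℝ≥0 using hb
  exact_mod_cast (add_sq_le : (a + b) ^ 2 ≤ 2 * (a ^ 2 + b ^ 2))

section Lp

variable {α : Type*} [MeasurableSpace α] {μ : Measure α}

theorem eLpNorm_two_sq {F : Type*} [NormedAddCommGroup F] (f : α → F) :
    eLpNorm f 2 μ ^ 2 = ∫⁻ x, ‖f x‖ₑ ^ 2 ∂μ := by
  rw [eLpNorm_eq_lintegral_rpow_enorm_toReal two_ne_zero ENNReal.ofNat_ne_top,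
    ← ENNReal.rpow_natCast, ← ENNReal.rpow_mul]
  simp

theorem sq_lintegral_mul_le {f g : α → ℝ≥0∞} (hf : AEMeasurable f μ) (hg : AEMeasurable g μ) :
    (∫⁻ x, f x * g x ∂μ) ^ 2 ≤ (∫⁻ x, f x ^ 2 ∂μ) * ∫⁻ x, g x ^ 2 ∂μ := by
  have := ENNReal.lintegral_mul_le_Lp_mul_Lq μ Real.HolderConjugate.two_two hf hg
  simp only [Pi.mul_apply, ENNReal.rpow_ofNat] at this
  refine (pow_le_pow_left₀ zero_le this 2).trans (le_of_eq ?_)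
  rw [mul_pow, ← ENNReal.rpow_natCast, ← ENNReal.rpow_natCast, ← ENNReal.rpow_mul,
    ← ENNReal.rpow_mul]
  simp

theorem sq_lintegral_le {f : α → ℝ≥0∞} (hf : AEMeasurable f μ) :
    (∫⁻ x, f x ∂μ) ^ 2 ≤ μ Set.univ * ∫⁻ x, f x ^ 2 ∂μ := by
  simpa using sq_lintegral_mul_le (μ := μ) (f := fun _ => 1) aemeasurable_const hf

end Lp

section Exit

variable {d : ℕ} (D : Set (E d)) (v : E d)

/-- The time at which the half-line from `x` in the direction `v` leaves `D`. -/
noncomputable def exitTime (x : E d) : ℝ := sInf {t : ℝ | 0 ≤ t ∧ x + t • v ∉ D}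

/-- The point at which the half-line from `x` in the direction `v` leaves `D`. -/
noncomputable def exitPoint (x : E d) : E d := x + exitTime D v x • v

variable {D v}

theorem exitTime_nonempty {R : ℝ} (hR : D ⊆ Metric.ball 0 R) (hv : ‖v‖ = 1) (x : E d) :
    ({t : ℝ | 0 ≤ t ∧ x + t • v ∉ D}).Nonempty := by
  refine ⟨|R| + ‖x‖, by positivity, fun h => ?_⟩
  have h1 := hR h
  rw [mem_ball_zero_iff] at h1
  have h2 := norm_sub_norm_le ((|R| + ‖x‖) • v) (-x)
  rw [norm_smul, hv, mul_one, norm_neg, Real.norm_of_nonneg (by positivity), sub_neg_eq_add,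
    add_comm _ x] at h2
  linarith [le_abs_self R]

theorem bddBelow_exitTime (x : E d) : BddBelow {t : ℝ | 0 ≤ t ∧ x + t • v ∉ D} :=
  ⟨0, fun _ ht => ht.1⟩

theorem exitTime_mem (hD_open : IsOpen D) {R : ℝ} (hR : D ⊆ Metric.ball 0 R) (hv : ‖v‖ = 1)
    (x : E d) : 0 ≤ exitTime D v x ∧ exitPoint D v x ∉ D := by
  refine IsClosed.csInf_mem ?_ (exitTime_nonempty hR hv x) (bddBelow_exitTime x)
  refine isClosed_Ici.inter ?_
  exact hD_open.isClosed_compl.preimage (f := fun t : ℝ => x + t • v) (by fun_prop)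

theorem mem_of_lt_exitTime {x : E d} {t : ℝ} (h0 : 0 ≤ t) (ht : t < exitTime D v x) :
    x + t • v ∈ D := by
  by_contra h
  exact (csInf_le (bddBelow_exitTime x) ⟨h0, h⟩).not_gt ht

theorem exitTime_le {R : ℝ} (hR : D ⊆ Metric.ball 0 R) (hv : ‖v‖ = 1) {x : E d} (hx : x ∈ D) :
    exitTime D v x ≤ 2 * R := by
  have hx' := mem_ball_zero_iff.1 (hR hx)
  refine csInf_le (bddBelow_exitTime x) ⟨by linarith [norm_nonneg x], fun h => ?_⟩
  have h1 := mem_ball_zero_iff.1 (hR h)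
  have h2 := norm_sub_norm_le ((2 * R) • v) (-x)
  rw [norm_smul, hv, mul_one, norm_neg, Real.norm_of_nonneg (by linarith [norm_nonneg x]),
    sub_neg_eq_add, add_comm _ x] at h2
  linarith

theorem exitPoint_mem_frontier (hD_open : IsOpen D) {R : ℝ} (hR : D ⊆ Metric.ball 0 R)
    (hv : ‖v‖ = 1) {x : E d} (hx : x ∈ D) : exitPoint D v x ∈ frontier D := by
  obtain ⟨h0, h1⟩ := exitTime_mem hD_open hR hv x
  rw [hD_open.frontier_eq]
  refine ⟨?_, h1⟩
  have hpos : 0 < exitTime D v x := by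
    refine lt_of_le_of_ne h0 fun h => h1 ?_
    rw [exitPoint, ← h]; simpa using hx
  have hc : Continuous fun t : ℝ => x + t • v := by fun_prop
  have : exitTime D v x ∈ closure (Set.Ico 0 (exitTime D v x)) := by
    rw [closure_Ico hpos.ne]; exact ⟨h0, le_rfl⟩
  have h2 := image_closure_subset_closure_image hc ⟨_, this, rfl⟩
  refine closure_mono ?_ h2
  rintro _ ⟨t, ht, rfl⟩
  exact mem_of_lt_exitTime ht.1 ht.2

/-- For `a ≥ 0` the exit time exceeds `a` exactly when the segment of length `a` stays in `D`. This
is an open condition on the starting point, since the segment is compact and `D` is open. -/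
theorem measurable_exitTime (hD_open : IsOpen D) {R : ℝ} (hR : D ⊆ Metric.ball 0 R)
    (hv : ‖v‖ = 1) : Measurable (exitTime D v) := by
  refine measurable_of_Ioi fun a => ?_
  rcases lt_or_ge a 0 with ha | ha
  · convert MeasurableSet.univ
    refine Set.eq_univ_of_forall fun x => ha.trans_le (exitTime_mem hD_open hR hv x).1
  · have : exitTime D v ⁻¹' Set.Ioi a = {x | ∀ t ∈ Set.Icc 0 a, x + t • v ∈ D} := by
      ext x
      constructor
      · exact fun h t ht => mem_of_lt_exitTime ht.1 (ht.2.trans_lt h)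
      · intro h
        obtain ⟨h0, h1⟩ := exitTime_mem hD_open hR hv x
        by_contra h'
        exact h1 (h _ ⟨h0, not_lt.1 h'⟩)
    rw [this]
    refine IsOpen.measurableSet (isOpen_iff_mem_nhds.2 fun x hx => ?_)
    refine isCompact_Icc.eventually_forall_of_forall_eventually fun t ht => ?_
    exact (hD_open.preimage (f := fun z : E d × ℝ => z.1 + z.2 • v) (by fun_prop)).mem_nhds
      (hx t ht)

theorem measurable_exitPoint (hD_open : IsOpen D) {R : ℝ} (hR : D ⊆ Metric.ball 0 R)
    (hv : ‖v‖ = 1) : Measurable (exitPoint D v) :=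
  measurable_id.add ((measurable_exitTime hD_open hR hv).smul_const v)

end Exit

namespace BoundaryChart

variable {d : ℕ} {D : Set (E d)} {P : E d} (c : BoundaryChart D P)

/-- The last vector of the coordinate system. -/
noncomputable def vert : E d := c.coord.symm (WithLp.toLp 2 (0, 1))

theorem norm_vert : ‖c.vert‖ = 1 := by
  rw [vert, LinearIsometryEquiv.norm_map, WithLp.prod_norm_eq_of_L2]; simp

theorem proj_add_smul_vert (x : E d) (t : ℝ) : c.proj (x + t • c.vert) = c.proj x := by
  simp [proj, vert]

/-- Moving along `vert` does not change the projection. Points of `D` that exit through `T`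
therefore lie over the projection of `T ∩ ∂D`, at heights in `[-R, R]`, and projecting does not
increase `(d-1)`-dimensional measure. -/
theorem map_exitPoint_le (hD_open : IsOpen D) {R : ℝ} (hR : D ⊆ Metric.ball 0 R) :
    (volume.restrict D).map (exitPoint D c.vert) ≤ ENNReal.ofReal (2 * R) • surfaceMeasure D := by
  have hm := measurable_exitPoint hD_open hR c.norm_vert
  refine Measure.le_iff.2 fun T hT => ?_
  rw [Measure.map_apply hm hT, Measure.restrict_apply (hm hT), Measure.smul_apply, smul_eq_mul,
    surfaceMeasure, Measure.restrict_apply hT]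
  -- The projection of a measurable set need not be Borel, so a measurable hull of the same measure
  -- is used.
  set A := toMeasurable volume (c.proj '' (T ∩ frontier D))
  have hq : MeasurePreserving (fun y => WithLp.ofLp (c.coord y)) volume volume :=
    (WithLp.volume_preserving_ofLp (E (d - 1)) ℝ).comp c.coord.measurePreserving
  have hsub : exitPoint D c.vert ⁻¹' T ∩ D ⊆
      (fun y => WithLp.ofLp (c.coord y)) ⁻¹' (A ×ˢ Set.Icc (-R) R) := by
    rintro x ⟨hxT, hxD⟩
    refine ⟨subset_toMeasurable _ _ ⟨exitPoint D c.vert x,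
      ⟨hxT, exitPoint_mem_frontier hD_open hR c.norm_vert hxD⟩, ?_⟩, ?_⟩
    · rw [exitPoint, proj_add_smul_vert]; rfl
    · have h1 := norm_snd_le (c.coord x)
      rw [c.coord.norm_map] at h1
      have h2 := mem_ball_zero_iff.1 (hR hxD)
      exact abs_le.1 (h1.trans h2.le)
  refine (measure_mono hsub).trans ?_
  rw [hq.measure_preimage ((measurableSet_toMeasurable _ _).prod
    measurableSet_Icc).nullMeasurableSet, Measure.volume_eq_prod, Measure.prod_prod,
    measure_toMeasurable, Real.volume_Icc, mul_comm]
  gcongr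
  · exact le_of_eq (by ring)
  · exact c.volume_proj_image_le _

end BoundaryChart

section Friedrichs

variable {d : ℕ} {D : Set (E d)}

theorem enorm_sub_exitPoint_le (hD_open : IsOpen D) {R : ℝ} (hR : D ⊆ Metric.ball 0 R) {v : E d}
    (hv : ‖v‖ = 1) {w : E d → ℂ} (hw : ContDiff ℝ 1 w) {x : E d} (hx : x ∈ D) :
    ‖w (exitPoint D v x) - w x‖ₑ ≤
      ∫⁻ t in Set.Ioc 0 (2 * R), D.indicator (fun y => ‖cgrad w y‖ₑ) (x + t • v) := by
  obtain ⟨h0, -⟩ := exitTime_mem hD_open hR hv x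
  have hle := exitTime_le hR hv hx
  have hder : ∀ t : ℝ, HasDerivAt (fun t : ℝ => w (x + t • v)) (fderiv ℝ w (x + t • v) v) t := by
    intro t
    have h1 : HasDerivAt (fun t : ℝ => x + t • v) v t := by
      simpa using ((hasDerivAt_id t).smul_const v).const_add x
    exact ((hw.differentiable one_ne_zero _).hasFDerivAt).comp_hasDerivAt t h1
  have hcont : Continuous fun t : ℝ => fderiv ℝ w (x + t • v) v :=
    ((hw.continuous_fderiv one_ne_zero).comp (by fun_prop)).clm_apply continuous_const
  have key := intervalIntegral.integral_eq_sub_of_hasDerivAt (a := 0) (b := exitTime D v x)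
    (fun t _ => hder t) (hcont.intervalIntegrable _ _)
  simp only [zero_smul, add_zero] at key
  rw [exitPoint, ← key, intervalIntegral.integral_of_le h0]
  refine (enorm_integral_le_lintegral_enorm _).trans ?_
  -- The exit point itself lies outside `D`, where the indicator vanishes; the endpoint is dropped
  -- as a null set.
  calc ∫⁻ t in Set.Ioc 0 (exitTime D v x), ‖fderiv ℝ w (x + t • v) v‖ₑ
      = ∫⁻ t in Set.Ioo 0 (exitTime D v x), ‖fderiv ℝ w (x + t • v) v‖ₑ := by
        rw [Measure.restrict_congr_set Ioo_ae_eq_Ioc.symm]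
    _ ≤ ∫⁻ t in Set.Ioo 0 (exitTime D v x),
          D.indicator (fun y => ‖cgrad w y‖ₑ) (x + t • v) := by
        refine setLIntegral_mono' measurableSet_Ioo fun t ht => ?_
        rw [Set.indicator_of_mem (mem_of_lt_exitTime ht.1.le ht.2), enorm_le_iff_norm_le]
        simpa [hv] using norm_fderiv_apply_le w (x + t • v) v
    _ ≤ _ := lintegral_mono_set (Set.Ioo_subset_Ioc_self.trans (Set.Ioc_subset_Ioc_right hle))

/-- A Friedrichs inequality for smooth functions. -/
theorem lintegral_enorm_sq_le (hD_open : IsOpen D) {P : E d} (c : BoundaryChart D P) {R : ℝ}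
    (hR : D ⊆ Metric.ball 0 R) {w : E d → ℂ} (hw : ContDiff ℝ 1 w) :
    ∫⁻ x in D, ‖w x‖ₑ ^ 2 ≤ 2 * (ENNReal.ofReal (2 * R) * ∫⁻ x, ‖w x‖ₑ ^ 2 ∂surfaceMeasure D
      + ENNReal.ofReal (2 * R) ^ 2 * ∫⁻ x in D, ‖cgrad w x‖ₑ ^ 2) := by
  have hv := c.norm_vert
  set v := c.vert
  have hm := measurable_exitPoint hD_open hR hv
  have hwm : Measurable fun x => ‖w x‖ₑ ^ 2 := hw.continuous.measurable.enorm.pow_const 2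
  have hg : Measurable (D.indicator fun y => ‖cgrad w y‖ₑ) :=
    ((continuous_cgrad hw).measurable.enorm).indicator hD_open.measurableSet
  have hg2 : ∀ y, D.indicator (fun y => ‖cgrad w y‖ₑ) y ^ 2
      = D.indicator (fun y => ‖cgrad w y‖ₑ ^ 2) y := fun y => by
    by_cases h : y ∈ D <;> simp [h]
  have hshift : ∀ x : E d, Measurable fun t : ℝ => x + t • v := fun x => by fun_prop
  have hpt : ∀ x ∈ D, ‖w x‖ₑ ^ 2 ≤ 2 * (‖w (exitPoint D v x)‖ₑ ^ 2 + ENNReal.ofReal (2 * R) *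
      ∫⁻ t in Set.Ioc 0 (2 * R), D.indicator (fun y => ‖cgrad w y‖ₑ ^ 2) (x + t • v)) := by
    intro x hx
    have h1 : ‖w x‖ₑ ≤ ‖w (exitPoint D v x)‖ₑ + ‖w (exitPoint D v x) - w x‖ₑ := by
      have := enorm_sub_le (E := ℂ) (a := w (exitPoint D v x)) (b := w (exitPoint D v x) - w x)
      simpa using this
    refine (pow_le_pow_left₀ zero_le h1 2).trans ((ennreal_add_sq_le _ _).trans ?_)
    gcongr
    refine (pow_le_pow_left₀ zero_le (enorm_sub_exitPoint_le hD_open hR hv hw hx) 2).trans ?_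
    refine (sq_lintegral_le (hg.comp (hshift x)).aemeasurable).trans (le_of_eq ?_)
    simp only [Function.comp_apply, hg2]
    simp
  calc ∫⁻ x in D, ‖w x‖ₑ ^ 2
      ≤ ∫⁻ x in D, 2 * (‖w (exitPoint D v x)‖ₑ ^ 2 + ENNReal.ofReal (2 * R) *
      ∫⁻ t in Set.Ioc 0 (2 * R), D.indicator (fun y => ‖cgrad w y‖ₑ ^ 2) (x + t • v)) :=
        setLIntegral_mono' hD_open.measurableSet hpt
    _ = 2 * ((∫⁻ x in D, ‖w (exitPoint D v x)‖ₑ ^ 2) + ENNReal.ofReal (2 * R) *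
      ∫⁻ x in D, ∫⁻ t in Set.Ioc 0 (2 * R),
        D.indicator (fun y => ‖cgrad w y‖ₑ ^ 2) (x + t • v)) := by
        rw [lintegral_const_mul' _ _ (by simp), lintegral_add_left (show Measurable fun x => ‖w (exitPoint D v x)‖ₑ ^ 2 from hwm.comp hm),
          lintegral_const_mul' _ _ ENNReal.ofReal_ne_top]
    _ ≤ _ := by
        rw [sq (ENNReal.ofReal (2 * R)), mul_assoc (ENNReal.ofReal (2 * R))]
        refine mul_le_mul_right (add_le_add ?_ (mul_le_mul_right ?_ _)) _
        · have := lintegral_mono' (c.map_exitPoint_le hD_open hR) (le_refl fun x => ‖w x‖ₑ ^ 2)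
          rw [lintegral_map hwm hm, lintegral_smul_measure] at this
          exact this
        · have hgm : Measurable (D.indicator fun y => ‖cgrad w y‖ₑ ^ 2) :=
            ((continuous_cgrad hw).measurable.enorm.pow_const 2).indicator hD_open.measurableSet
          -- After Tonelli, translation invariance bounds the inner integral for each `t` by `∫_D
          -- |∇w|²`, and the `t`-interval contributes a second factor `2R`.
          rw [lintegral_lintegral_swap]
          · calc ∫⁻ t in Set.Ioc 0 (2 * R), ∫⁻ x in D,
                  D.indicator (fun y => ‖cgrad w y‖ₑ ^ 2) (x + t • v)
                ≤ ∫⁻ t in Set.Ioc 0 (2 * R), ∫⁻ x in D, ‖cgrad w x‖ₑ ^ 2 := by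
                  refine lintegral_mono fun t => ?_
                  refine (setLIntegral_le_lintegral _ _).trans (le_of_eq ?_)
                  rw [lintegral_add_right_eq_self (D.indicator fun y => ‖cgrad w y‖ₑ ^ 2),
                    lintegral_indicator hD_open.measurableSet]
              _ = _ := by simp [mul_comm]
          · exact (hgm.comp (by fun_prop : Measurable fun z : E d × ℝ =>
              z.1 + z.2 • v)).aemeasurable

end Friedrichs

end Calderon

/-! ### Stability of traces and the `γ`-weighted space of gradients -/

namespace Calderon

variable {d : ℕ} {D : Set (E d)}

theorem tendsto_eLpNorm_addSMul {α F : Type*} [MeasurableSpace α] {μ : Measure α}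
    [NormedAddCommGroup F] [NormedSpace ℂ F] {a b : ℕ → α → F} {a' b' : α → F} {p : ℝ≥0∞}
    (hp : 1 ≤ p) (c : ℂ)
    (ha : ∀ n, AEStronglyMeasurable (a n) μ) (hb : ∀ n, AEStronglyMeasurable (b n) μ)
    (ha' : AEStronglyMeasurable a' μ) (hb' : AEStronglyMeasurable b' μ)
    (h1 : Tendsto (fun n => eLpNorm (a n - a') p μ) atTop (𝓝 0))
    (h2 : Tendsto (fun n => eLpNorm (b n - b') p μ) atTop (𝓝 0)) :
    Tendsto (fun n => eLpNorm (a n + c • b n - (a' + c • b')) p μ) atTop (𝓝 0) := by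
  have h3 := h1.add (ENNReal.Tendsto.const_mul h2 (a := ‖c‖ₑ) (Or.inr enorm_ne_top))
  simp only [mul_zero, add_zero] at h3
  refine tendsto_of_tendsto_of_tendsto_of_le_of_le tendsto_const_nhds h3 (fun _ => zero_le)
    fun n => ?_
  have e : a n + c • b n - (a' + c • b') = (a n - a') + c • (b n - b') := by
    rw [smul_sub]; abel
  rw [e]
  refine (eLpNorm_add_le ((ha n).sub ha') (((hb n).sub hb').const_smul c) hp).trans ?_
  rw [eLpNorm_const_smul]

namespace H1

theorem HasTrace.addSMul {u v : H1 D} {f g : L2Boundary D} (hu : u.HasTrace f)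
    (hv : v.HasTrace g) (c : ℂ) : (u.addSMul c v).HasTrace (f + c • g) := by
  obtain ⟨w, hw, h1, h2, h3⟩ := hu
  obtain ⟨w', hw', h1', h2', h3'⟩ := hv
  have m (F : E d → ℂ) (hF : ContDiff ℝ ∞ F) (μ : Measure (E d)) : AEStronglyMeasurable F μ :=
    hF.continuous.aestronglyMeasurable
  have m' (F : E d → ℂ) (hF : ContDiff ℝ ∞ F) (μ : Measure (E d)) :
      AEStronglyMeasurable (cgrad F) μ :=
    (continuous_cgrad (hF.of_le (by simp))).aestronglyMeasurable
  refine ⟨fun n => w n + c • w' n, fun n => (hw n).add (contDiff_const.smul (hw' n)),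
    tendsto_eLpNorm_addSMul one_le_two c (fun n => m _ (hw n) _) (fun n => m _ (hw' n) _)
      u.memLp.1 v.memLp.1 h1 h1', ?_, ?_⟩
  · have : ∀ n, cgrad (w n + c • w' n) = cgrad (w n) + c • cgrad (w' n) := fun n => by
      funext x
      have d1 := (hw n).differentiable (by simp) x
      have d2 := (hw' n).differentiable (by simp) x
      rw [cgrad_add d1 (d2.const_smul c), cgrad_smul d2]; rfl
    simp only [this]
    exact tendsto_eLpNorm_addSMul one_le_two c (fun n => m' _ (hw n) _) (fun n => m' _ (hw' n) _)
      u.memLp_grad.1 v.memLp_grad.1 h2 h2'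
  · refine (tendsto_eLpNorm_addSMul one_le_two c (fun n => m _ (hw n) _) (fun n => m _ (hw' n) _)
      (Lp.aestronglyMeasurable f) (Lp.aestronglyMeasurable g) h3 h3').congr fun n => ?_
    refine eLpNorm_congr_ae ?_
    filter_upwards [Lp.coeFn_add f (c • g), Lp.coeFn_smul c g] with x e1 e2
    simp only [Pi.sub_apply, Pi.add_apply, Pi.smul_apply, e1, e2]

theorem HasTrace.conj {u : H1 D} {f : L2Boundary D} (hu : u.HasTrace f) :
    u.conj.HasTrace (star f) := by
  obtain ⟨w, hw, h1, h2, h3⟩ := hu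
  refine ⟨fun n x => (starRingEnd ℂ) (w n x),
    fun n => Complex.conjCLE.toContinuousLinearMap.contDiff.comp (hw n), ?_, ?_, ?_⟩
  · refine h1.congr fun n => eLpNorm_congr_norm_ae (ae_of_all _ fun x => ?_)
    simp only [H1.conj, Pi.sub_apply]
    rw [← map_sub, RCLike.norm_conj]
  · refine h2.congr fun n => eLpNorm_congr_norm_ae (ae_of_all _ fun x => ?_)
    simp only [H1.conj, Pi.sub_apply]
    rw [cgrad_conj ((hw n).differentiable (by simp) x), ← conjVec_sub, norm_conjVec]
  · refine h3.congr fun n => eLpNorm_congr_norm_ae ?_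
    filter_upwards [Lp.coeFn_star f] with x hx
    simp only [Pi.sub_apply, hx, Pi.star_apply]
    rw [← RCLike.norm_conj, map_sub]; rfl

theorem HasTrace.of_tendsto (hD_open : IsOpen D) (hD_bdd : Bornology.IsBounded D) {v : ℕ → H1 D}
    {f : L2Boundary D} (hv : ∀ n, (v n).HasTrace f) {u : H1 D}
    (h1 : Tendsto (fun n => eLpNorm ((v n).toFun - u.toFun) 2 (volume.restrict D)) atTop (𝓝 0))
    (h2 : Tendsto (fun n => eLpNorm ((v n).grad - u.grad) 2 (volume.restrict D)) atTop (𝓝 0)) :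
    u.HasTrace f := by
  rw [hasTrace_iff hD_open hD_bdd]
  intro ε hε
  have hε2 : 0 < ε / 2 := ENNReal.half_pos hε.ne'
  obtain ⟨n, e1, e2⟩ :=
    ((ENNReal.tendsto_nhds_zero.1 h1 _ hε2).and (ENNReal.tendsto_nhds_zero.1 h2 _ hε2)).exists
  obtain ⟨w, hw, hc, a1, a2, a3⟩ := (hasTrace_iff hD_open hD_bdd _ _).1 (hv n) _ hε2
  refine ⟨w, hw, hc, ?_, ?_, a3.trans ENNReal.half_le_self⟩
  · rw [← sub_add_sub_cancel w (v n).toFun u.toFun, ← ENNReal.add_halves ε]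
    exact (eLpNorm_add_le (hw.continuous.aestronglyMeasurable.sub (v n).memLp.1)
      ((v n).memLp.1.sub u.memLp.1) one_le_two).trans (add_le_add a1 e1)
  · rw [← sub_add_sub_cancel (cgrad w) (v n).grad u.grad, ← ENNReal.add_halves ε]
    exact (eLpNorm_add_le ((continuous_cgrad (hw.of_le (by simp))).aestronglyMeasurable.sub
      (v n).memLp_grad.1) ((v n).memLp_grad.1.sub u.memLp_grad.1) one_le_two).trans
      (add_le_add a2 e2)

/-- The Friedrichs inequality for functions with vanishing trace. -/
theorem exists_eLpNorm_le_of_hasTrace_zero (hD_open : IsOpen D) (hD_bdd : Bornology.IsBounded D)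
    {P : E d} (c : BoundaryChart D P) : ∃ C : ℝ≥0∞, C ≠ ⊤ ∧ ∀ u : H1 D, u.HasTrace 0 →
      eLpNorm u.toFun 2 (volume.restrict D) ≤ C * eLpNorm u.grad 2 (volume.restrict D) := by
  obtain ⟨R, hR0, hR⟩ := hD_bdd.subset_ball_lt 0 0
  set A := ENNReal.ofReal (2 * R) with hA
  have hC : 2 * (1 + A) ≠ ⊤ := by
    rw [hA]; exact ENNReal.mul_ne_top ENNReal.ofNat_ne_top
      (ENNReal.add_ne_top.2 ⟨ENNReal.one_ne_top, ENNReal.ofReal_ne_top⟩)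
  refine ⟨2 * (1 + A), hC, fun u ⟨w, hw, h1, h2, h3⟩ => ?_⟩
  have hw1 : ∀ n, ContDiff ℝ 1 (w n) := fun n => (hw n).of_le (by simp)
  have key : ∀ n, eLpNorm (w n) 2 (volume.restrict D) ≤ 2 * (1 + A) *
      (eLpNorm (w n) 2 (surfaceMeasure D) + eLpNorm (cgrad (w n)) 2 (volume.restrict D)) := by
    intro n
    rw [← ENNReal.pow_le_pow_left_iff two_ne_zero, eLpNorm_two_sq]
    refine (lintegral_enorm_sq_le hD_open c hR (hw1 n)).trans ?_
    rw [← eLpNorm_two_sq, ← eLpNorm_two_sq]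
    generalize eLpNorm (w n) 2 (surfaceMeasure D) = a
    generalize eLpNorm (cgrad (w n)) 2 (volume.restrict D) = b
    calc 2 * (A * a ^ 2 + A ^ 2 * b ^ 2)
        ≤ 4 * ((1 + A) ^ 2 * (a + b) ^ 2) := by
          have e1 : A * a ^ 2 ≤ (1 + A) ^ 2 * (a + b) ^ 2 := by
            gcongr
            · calc A ≤ 1 + A := le_add_self
                _ ≤ (1 + A) ^ 2 := le_self_pow₀ le_self_add two_ne_zero
            · exact le_self_add
          have e2 : A ^ 2 * b ^ 2 ≤ (1 + A) ^ 2 * (a + b) ^ 2 := by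
            gcongr <;> exact le_add_self
          refine (mul_le_mul_right (add_le_add e1 e2) 2).trans (le_of_eq (by ring))
      _ = (2 * (1 + A) * (a + b)) ^ 2 := by ring
  -- The smooth approximants satisfy the inequality with a boundary term; that term disappears in
  -- the limit because the trace is zero.
  have hlim : Tendsto (fun n => eLpNorm (w n - u.toFun) 2 (volume.restrict D) + 2 * (1 + A) *
      (eLpNorm (w n - ⇑(0 : L2Boundary D)) 2 (surfaceMeasure D) +
        (eLpNorm (cgrad (w n) - u.grad) 2 (volume.restrict D)
          + eLpNorm u.grad 2 (volume.restrict D)))) atTop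
      (𝓝 (0 + 2 * (1 + A) * (0 + (0 + eLpNorm u.grad 2 (volume.restrict D))))) :=
    h1.add (ENNReal.Tendsto.const_mul (h3.add (h2.add tendsto_const_nhds)) (Or.inr hC))
  simp only [zero_add] at hlim
  refine ge_of_tendsto' hlim fun n => ?_
  have e1 : eLpNorm u.toFun 2 (volume.restrict D) ≤
      eLpNorm (w n - u.toFun) 2 (volume.restrict D) + eLpNorm (w n) 2 (volume.restrict D) := by
    have := eLpNorm_sub_le (μ := volume.restrict D) (p := 2) (f := w n) (g := w n - u.toFun)
      (hw n).continuous.aestronglyMeasurable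
      ((hw n).continuous.aestronglyMeasurable.sub u.memLp.1) one_le_two
    rwa [sub_sub_cancel, add_comm] at this
  have e2 : eLpNorm (cgrad (w n)) 2 (volume.restrict D) ≤
      eLpNorm (cgrad (w n) - u.grad) 2 (volume.restrict D)
        + eLpNorm u.grad 2 (volume.restrict D) := by
    have := eLpNorm_add_le (μ := volume.restrict D) (p := 2) (f := cgrad (w n) - u.grad)
      (g := u.grad) ((continuous_cgrad (hw1 n)).aestronglyMeasurable.sub u.memLp_grad.1)
      u.memLp_grad.1 one_le_two
    rwa [sub_add_cancel] at this
  have e3 : eLpNorm (w n) 2 (surfaceMeasure D)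
      = eLpNorm (w n - ⇑(0 : L2Boundary D)) 2 (surfaceMeasure D) := by
    refine eLpNorm_congr_ae ?_
    filter_upwards [Lp.coeFn_zero ℂ 2 (surfaceMeasure D)] with x hx
    simp only [Pi.sub_apply, hx, Pi.zero_apply, sub_zero]
  refine e1.trans (add_le_add le_rfl ((key n).trans ?_))
  rw [e3]
  gcongr

end H1

/-- `γ` is a measurable coefficient on `D` with values in `[m, m']`, `m > 0`. -/
structure IsElliptic (D : Set (E d)) (γ : E d → ℝ) (m m' : ℝ) : Prop where
  meas : AEMeasurable γ (volume.restrict D)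
  pos : 0 < m
  lower : ∀ᵐ x ∂(volume.restrict D), m ≤ γ x
  upper : ∀ᵐ x ∂(volume.restrict D), γ x ≤ m'

/-- The measure `γ dx` on `D`. -/
noncomputable def weighted (D : Set (E d)) (γ : E d → ℝ) : Measure (E d) :=
  (volume.restrict D).withDensity fun x => ENNReal.ofReal (γ x)

namespace IsElliptic

variable {γ : E d → ℝ} {m m' : ℝ} (h : IsElliptic D γ m m')

include h

theorem weighted_le : weighted D γ ≤ ENNReal.ofReal m' • volume.restrict D := by
  rw [weighted, ← withDensity_const]
  exact withDensity_mono (h.upper.mono fun x hx => ENNReal.ofReal_le_ofReal hx)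

theorem le_weighted : volume.restrict D ≤ (ENNReal.ofReal m)⁻¹ • weighted D γ := by
  have h1 : ENNReal.ofReal m • volume.restrict D ≤ weighted D γ := by
    rw [weighted, ← withDensity_const]
    exact withDensity_mono (h.lower.mono fun x hx => ENNReal.ofReal_le_ofReal hx)
  refine Measure.le_iff.2 fun s hs => ?_
  have h2 := Measure.le_iff.1 h1 s hs
  rw [Measure.smul_apply, smul_eq_mul] at h2 ⊢
  have h0 : ENNReal.ofReal m ≠ 0 := by simpa using h.pos
  calc (volume.restrict D) s
      = (ENNReal.ofReal m)⁻¹ * (ENNReal.ofReal m * (volume.restrict D) s) := by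
        rw [← mul_assoc, ENNReal.inv_mul_cancel h0 ENNReal.ofReal_ne_top, one_mul]
    _ ≤ _ := by gcongr

theorem memLp {F : Type*} [NormedAddCommGroup F] {g : E d → F}
    (hg : MemLp g 2 (volume.restrict D)) : MemLp g 2 (weighted D γ) :=
  hg.of_measure_le_smul ENNReal.ofReal_ne_top h.weighted_le

/-- The gradient of an element of `H¹(D)`, in the weighted `L²` space. -/
noncomputable def gradLp (u : H1 D) : Lp (EuclideanSpace ℂ (Fin d)) 2 (weighted D γ) :=
  (h.memLp u.memLp_grad).toLp u.grad

theorem gradLp_addSMul (u v : H1 D) (c : ℂ) :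
    h.gradLp (u.addSMul c v) = h.gradLp u + c • h.gradLp v := rfl

/-- The form is bilinear while the inner product is sesquilinear, which accounts for the conjugate.
With this identity the boundary value problem becomes geometry in the Hilbert space `L²(γ dx)`. -/
theorem dirichletForm_eq_inner (u v : H1 D) :
    dirichletForm γ u v = inner ℂ (h.gradLp v.conj) (h.gradLp u) := by
  rw [L2.inner_def, dirichletForm]
  have e : ∫ x, inner ℂ (v.conj.grad x) (u.grad x) ∂(weighted D γ)
      = ∫ x in D, (γ x : ℂ) * ∑ i : Fin d, u.grad x i * v.grad x i := by
    rw [weighted, integral_withDensity_eq_integral_toReal_smul₀ h.meas.ennreal_ofReal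
      (ae_of_all _ fun x => ENNReal.ofReal_lt_top)]
    refine integral_congr_ae (h.lower.mono fun x hx => ?_)
    simp only [ENNReal.toReal_ofReal (h.pos.le.trans hx), PiLp.inner_apply, H1.conj,
      conjVec_apply, RCLike.inner_apply, RingHomCompTriple.comp_apply, RingHom.id_apply]
    simp [Complex.real_smul]
  rw [← e]
  refine integral_congr_ae ?_
  filter_upwards [(h.memLp u.memLp_grad).coeFn_toLp, (h.memLp v.conj.memLp_grad).coeFn_toLp]
    with x h1 h2
  rw [gradLp, gradLp, h1, h2]

theorem enorm_gradLp_le (u : H1 D) : ‖h.gradLp u‖ₑ ≤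
    ENNReal.ofReal m' ^ (1 / 2 : ℝ) * eLpNorm u.grad 2 (volume.restrict D) := by
  rw [gradLp, Lp.enorm_toLp]
  simpa [ENNReal.toReal_ofNat, -one_div] using eLpNorm_le_of_measure_le_smul (f := u.grad) (p := 2) h.weighted_le

theorem eLpNorm_grad_le (u : H1 D) : eLpNorm u.grad 2 (volume.restrict D) ≤
    (ENNReal.ofReal m)⁻¹ ^ (1 / 2 : ℝ) * ‖h.gradLp u‖ₑ := by
  rw [gradLp, Lp.enorm_toLp]
  simpa using eLpNorm_le_of_measure_le_smul (f := u.grad) (p := 2) h.le_weighted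

end IsElliptic

end Calderon

/-! ### The Dirichlet principle and the Dirichlet-to-Neumann value -/

namespace Calderon

variable {d : ℕ} {D : Set (E d)}

theorem H1.HasTrace.conj_zero {u : H1 D} (hu : u.HasTrace 0) : u.conj.HasTrace 0 := by
  have : star (0 : L2Boundary D) = 0 := by
    refine Lp.ext ?_
    filter_upwards [Lp.coeFn_star (0 : L2Boundary D), Lp.coeFn_zero ℂ 2 (surfaceMeasure D)]
      with x h1 h2
    simp only [h1, Pi.star_apply, h2, Pi.zero_apply, star_zero]
  simpa only [this] using hu.conj

namespace IsElliptic

variable {γ : E d → ℝ} {m m' : ℝ} (h : IsElliptic D γ m m')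

theorem gradLp_sub (u v : H1 D) :
    h.gradLp (u.addSMul (-1) v) = h.gradLp u - h.gradLp v := by
  rw [gradLp_addSMul, neg_one_smul, sub_eq_add_neg]

theorem _root_.Calderon.H1.HasTrace.sub {u v : H1 D} {f g : L2Boundary D} (hu : u.HasTrace f)
    (hv : v.HasTrace g) : (u.addSMul (-1) v).HasTrace (f - g) := by
  have := hu.addSMul hv (-1)
  rwa [neg_one_smul, ← sub_eq_add_neg] at this

theorem exists_norm_toLp_le (hD_open : IsOpen D) (hD_bdd : Bornology.IsBounded D) {P : E d}
    (c : BoundaryChart D P) : ∃ K : ℝ, ∀ u : H1 D, u.HasTrace 0 →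
      ‖u.memLp.toLp u.toFun‖ ≤ K * ‖h.gradLp u‖ := by
  obtain ⟨C, hC, H⟩ := H1.exists_eLpNorm_le_of_hasTrace_zero hD_open hD_bdd c
  have hfin : C * (ENNReal.ofReal m)⁻¹ ^ (1 / 2 : ℝ) ≠ ⊤ := by
    refine ENNReal.mul_ne_top hC (ENNReal.rpow_ne_top_of_nonneg (by norm_num) ?_)
    exact ENNReal.inv_ne_top.2 (by simpa using h.pos)
  refine ⟨(C * (ENNReal.ofReal m)⁻¹ ^ (1 / 2 : ℝ)).toReal, fun u hu => ?_⟩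
  have h1 : ‖u.memLp.toLp u.toFun‖ₑ ≤ C * (ENNReal.ofReal m)⁻¹ ^ (1 / 2 : ℝ) * ‖h.gradLp u‖ₑ := by
    rw [Lp.enorm_toLp, mul_assoc]
    exact (H u hu).trans (mul_le_mul_right (h.eLpNorm_grad_le u) C)
  have h2 := ENNReal.toReal_mono (ENNReal.mul_ne_top hfin enorm_ne_top) h1
  rwa [ENNReal.toReal_mul, toReal_enorm, toReal_enorm] at h2

/-- The gradients of the functions in `H¹(D)` with vanishing trace. -/
noncomputable def gradZero : Submodule ℂ (Lp (EuclideanSpace ℂ (Fin d)) 2 (weighted D γ)) where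
  carrier := {G | ∃ v : H1 D, v.HasTrace 0 ∧ h.gradLp v = G}
  add_mem' := by
    rintro _ _ ⟨u, hu, rfl⟩ ⟨v, hv, rfl⟩
    refine ⟨u.addSMul 1 v, by simpa using hu.addSMul hv 1, ?_⟩
    rw [gradLp_addSMul, one_smul]
  zero_mem' := by
    have hg0 : cgrad (fun _ : E d => (0 : ℂ)) = 0 := by
      funext x; ext i; simp [cgrad]
    let z : H1 D := H1.ofSmooth (fun _ => 0) contDiff_const MemLp.zero (by rw [hg0]; exact .zero)
    have hg : z.grad = 0 := hg0
    refine ⟨z, ⟨fun _ _ => 0, fun _ => contDiff_const, ?_, ?_, ?_⟩, ?_⟩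
    · have : (fun _ : E d => (0 : ℂ)) - z.toFun = 0 := by funext x; simp [z, H1.ofSmooth]
      simp [this]
    · have : cgrad (fun _ : E d => (0 : ℂ)) - z.grad = 0 := by
        rw [hg]; funext x; ext i; simp [cgrad]
      simp [this]
    · refine tendsto_const_nhds.congr fun _ => Eq.symm ?_
      rw [← eLpNorm_zero (ε := ℂ) (p := 2) (μ := surfaceMeasure D)]
      refine eLpNorm_congr_ae ?_
      filter_upwards [Lp.coeFn_zero ℂ 2 (surfaceMeasure D)] with x hx
      simp only [Pi.sub_apply, hx, Pi.zero_apply, sub_zero]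
    · rw [gradLp]
      simp only [hg]
      exact MemLp.toLp_zero _
  smul_mem' := by
    rintro c _ ⟨u, hu, rfl⟩
    refine ⟨u.addSMul (c - 1) u, by simpa using hu.addSMul hu (c - 1), ?_⟩
    rw [gradLp_addSMul, sub_smul, one_smul, add_sub_cancel]

/-- The Friedrichs inequality turns a Cauchy sequence of gradients into a Cauchy sequence of
functions, whose limit is in `H¹(D)` and still has zero trace. Closedness is what makes the
orthogonal projection available. -/
theorem isClosed_gradZero (hD_open : IsOpen D) (hD_bdd : Bornology.IsBounded D) {P : E d}
    (c : BoundaryChart D P) :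
    IsClosed (h.gradZero : Set (Lp (EuclideanSpace ℂ (Fin d)) 2 (weighted D γ))) := by
  obtain ⟨K, hK⟩ := h.exists_norm_toLp_le hD_open hD_bdd c
  refine IsSeqClosed.isClosed fun G g hG hlim => ?_
  choose v hv hvG using hG
  have hcau : CauchySeq fun n => (v n).memLp.toLp (v n).toFun := by
    rw [cauchySeq_iff_tendsto_dist_atTop_0]
    have h1 := (cauchySeq_iff_tendsto_dist_atTop_0.1 hlim.cauchySeq).const_mul K
    rw [mul_zero] at h1
    refine squeeze_zero (fun _ => dist_nonneg) (fun p => ?_) h1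
    have h2 := hK ((v p.1).addSMul (-1) (v p.2)) (by simpa using (hv p.1).sub (hv p.2))
    rw [gradLp_sub, hvG, hvG, ← dist_eq_norm] at h2
    refine le_trans (le_of_eq ?_) h2
    rw [dist_eq_norm, ← MemLp.toLp_sub]
    congr 2
    simp [H1.addSMul, sub_eq_add_neg]
  obtain ⟨u, hu⟩ := cauchySeq_tendsto_of_complete hcau
  have hgL : MemLp g 2 (volume.restrict D) :=
    (Lp.memLp g).of_measure_le_smul (ENNReal.inv_ne_top.2 (by simpa using h.pos)) h.le_weighted
  have e1 : Tendsto (fun n => eLpNorm ((v n).toFun - ⇑u) 2 (volume.restrict D)) atTop (𝓝 0) := by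
    have h1 := (tendsto_iff_edist_tendsto_0.1 hu)
    refine h1.congr fun n => ?_
    rw [Lp.edist_def]
    exact eLpNorm_congr_ae ((v n).memLp.coeFn_toLp.sub ae_eq_rfl)
  have e2 : Tendsto (fun n => eLpNorm ((v n).grad - ⇑g) 2 (volume.restrict D)) atTop (𝓝 0) := by
    have h1 := (tendsto_iff_edist_tendsto_0.1 hlim)
    have hfin : (ENNReal.ofReal m)⁻¹ ^ (1 / (2 : ℝ≥0∞)).toReal ≠ ⊤ :=
      ENNReal.rpow_ne_top_of_nonneg ENNReal.toReal_nonneg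
        (ENNReal.inv_ne_top.2 (by simpa using h.pos))
    have h2 := ENNReal.Tendsto.const_mul h1 (Or.inr hfin)
    rw [mul_zero] at h2
    refine tendsto_of_tendsto_of_tendsto_of_le_of_le tendsto_const_nhds h2 (fun _ => zero_le)
      fun n => (eLpNorm_le_of_measure_le_smul h.le_weighted).trans (le_of_eq ?_)
    rw [smul_eq_mul, ← hvG n, Lp.edist_def]
    congr 1
    exact eLpNorm_congr_ae ((h.memLp (v n).memLp_grad).coeFn_toLp.symm.sub ae_eq_rfl)
  refine ⟨H1.ofTendsto v u g (Lp.memLp u) hgL e1 e2,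
    H1.HasTrace.of_tendsto hD_open hD_bdd hv e1 e2, ?_⟩
  exact Lp.toLp_coeFn g _

/-- The weak Dirichlet principle: the orthogonal projection of `∇u` on the gradients with vanishing
trace. -/
theorem exists_projection (hD_open : IsOpen D) (hD_bdd : Bornology.IsBounded D) {P : E d}
    (c : BoundaryChart D P) (u : H1 D) : ∃ r : H1 D, r.HasTrace 0 ∧
      ∀ v : H1 D, v.HasTrace 0 → inner ℂ (h.gradLp v) (h.gradLp u - h.gradLp r) = 0 := by
  have : CompleteSpace h.gradZero := (h.isClosed_gradZero hD_open hD_bdd c).completeSpace_coe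
  obtain ⟨r, hr, hrp⟩ := (h.gradZero.starProjection_apply_mem (h.gradLp u))
  refine ⟨r, hr, fun v hv => ?_⟩
  rw [hrp]
  exact h.gradZero.mem_orthogonal _ |>.1 (h.gradZero.sub_starProjection_mem_orthogonal _) _
    ⟨v, hv, rfl⟩

include h in
-- Needed because `dnPairing` is defined by choice. Two solutions with the same trace differ by an
-- admissible test function, and testing with its conjugate shows that the gradients agree; a change
-- of `v` is again an admissible test function.
theorem isDNValue_unique {f g : L2Boundary D} {z z' : ℂ} (hz : IsDNValue D γ f g z)
    (hz' : IsDNValue D γ f g z') : z = z' := by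
  obtain ⟨u, v, hu, hus, hv, rfl⟩ := hz
  obtain ⟨u', v', hu', hus', hv', rfl⟩ := hz'
  have hw : (u.addSMul (-1) u').HasTrace 0 := by simpa using hu.sub hu'
  have hwc : (u.addSMul (-1) u').conj.HasTrace 0 := hw.conj_zero
  have hcc : h.gradLp (u.addSMul (-1) u').conj.conj = h.gradLp (u.addSMul (-1) u') := by
    rw [gradLp, gradLp]
    congr 1
    funext x; ext i; simp [H1.conj]
  have h0 : h.gradLp u - h.gradLp u' = 0 := by
    have h1 := hus _ hwc
    have h2 := hus' _ hwc
    rw [h.dirichletForm_eq_inner, hcc, gradLp_sub] at h1 h2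
    rw [← inner_self_eq_zero (𝕜 := ℂ), inner_sub_right, h1, h2, sub_zero]
  have h3 : dirichletForm γ u' v' = dirichletForm γ u v' := by
    rw [h.dirichletForm_eq_inner, h.dirichletForm_eq_inner, sub_eq_zero.1 h0]
  have hvv : (v.addSMul (-1) v').HasTrace 0 := by simpa using hv.sub hv'
  have h4 := hus _ hvv
  have hc : h.gradLp (v.addSMul (-1) v').conj = h.gradLp v.conj - h.gradLp v'.conj := by
    rw [← gradLp_sub, gradLp, gradLp]
    congr 1
    funext x; ext i; simp [H1.conj, H1.addSMul]
  rw [h.dirichletForm_eq_inner, hc, inner_sub_left, ← h.dirichletForm_eq_inner,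
    ← h.dirichletForm_eq_inner, sub_eq_zero] at h4
  rw [h3, h4]

include h in
theorem dnPairing_eq {f g : L2Boundary D} {z : ℂ} (hz : IsDNValue D γ f g z) :
    dnPairing D γ f g = z := by
  have hex : ∃ z, IsDNValue D γ f g z := ⟨z, hz⟩
  rw [dnPairing, dif_pos hex]
  exact h.isDNValue_unique hex.choose_spec hz

theorem gradLp_conj_conj (u : H1 D) : h.gradLp u.conj.conj = h.gradLp u := by
  rw [gradLp, gradLp]
  congr 1
  funext x; ext i; simp [H1.conj]

/-- An approximate solution of the conductivity equation computes the diagonal of the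
Dirichlet-to-Neumann map up to the square of its residual. -/
theorem norm_dnPairing_sub_le (hD_open : IsOpen D) (hD_bdd : Bornology.IsBounded D) {P : E d}
    (c : BoundaryChart D P) {f : L2Boundary D} {u : H1 D} (hu : u.HasTrace f) {ε : ℝ} (hε0 : 0 ≤ ε)
    (hε : ∀ v : H1 D, v.HasTrace 0 → ‖inner ℂ (h.gradLp v) (h.gradLp u)‖ ≤ ε * ‖h.gradLp v‖) :
    ‖dnPairing D γ f (star f) - (‖h.gradLp u‖ : ℂ) ^ 2‖ ≤ ε ^ 2 := by
  obtain ⟨r, hr, hp⟩ := h.exists_projection hD_open hD_bdd c u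
  -- Subtracting the projection `r` keeps the trace and makes the gradient orthogonal to all
  -- zero-trace gradients, so `u - r` is the solution. The pairing becomes `⟨∇u, ∇u - ∇r⟩`, which is
  -- `‖∇u‖² - ‖∇r‖²`.
  have hval : IsDNValue D γ f (star f) (dirichletForm γ (u.addSMul (-1) r) u.conj) := by
    refine ⟨u.addSMul (-1) r, u.conj, by simpa using hu.sub hr, fun v hv => ?_, hu.conj, rfl⟩
    rw [h.dirichletForm_eq_inner, gradLp_sub]
    exact hp _ hv.conj_zero
  have h1 := hp r hr
  rw [inner_sub_right, sub_eq_zero] at h1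
  have h2 : inner ℂ (h.gradLp u) (h.gradLp r) = (‖h.gradLp r‖ : ℂ) ^ 2 := by
    rw [← inner_conj_symm, h1, inner_self_eq_norm_sq_to_K]
    simp
  rw [h.dnPairing_eq hval, h.dirichletForm_eq_inner, gradLp_conj_conj, gradLp_sub,
    inner_sub_right, inner_self_eq_norm_sq_to_K, h2]
  have h3 := hε r hr
  rw [h1, inner_self_eq_norm_sq_to_K] at h3
  simp only [norm_pow, RCLike.norm_ofReal, abs_norm] at h3
  -- Orthogonality gives `‖∇r‖² = ⟨∇r, ∇u⟩ ≤ ε ‖∇r‖`; divide unless the norm is zero.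
  have h4 : ‖h.gradLp r‖ ≤ ε := by
    rcases (norm_nonneg (h.gradLp r)).eq_or_lt with h0 | h0
    · rwa [← h0]
    · nlinarith
  simp
  gcongr

end IsElliptic

end Calderon

/-! ### Residual bounds from smooth test functions, and Lipschitz functions in `H¹(D)` -/

namespace Calderon

theorem ENNReal.le_of_forall_le_add_mul {a b K : ℝ≥0∞} (hK : K ≠ ⊤)
    (h : ∀ δ : ℝ≥0∞, 0 < δ → a ≤ b + K * δ) : a ≤ b := by
  have hlim : Tendsto (fun n : ℕ => b + K * (n : ℝ≥0∞)⁻¹) atTop (𝓝 (b + K * 0)) :=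
    tendsto_const_nhds.add
      (ENNReal.Tendsto.const_mul ENNReal.tendsto_inv_nat_nhds_zero (Or.inr hK))
  rw [mul_zero, add_zero] at hlim
  exact ge_of_tendsto' hlim fun n => h _ (by simp)

theorem tendsto_eLpNorm_two_of_bounded {α F : Type*} [MeasurableSpace α] {μ : Measure α}
    [IsFiniteMeasure μ] [NormedAddCommGroup F] {f : ℕ → α → F} {g : α → F} {C : ℝ}
    (hf : ∀ n, AEStronglyMeasurable (f n) μ) (hg : AEStronglyMeasurable g μ)
    (hb : ∀ n, ∀ᵐ x ∂μ, ‖f n x - g x‖ ≤ C)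
    (hlim : ∀ᵐ x ∂μ, Tendsto (fun n => f n x) atTop (𝓝 (g x))) :
    Tendsto (fun n => eLpNorm (f n - g) 2 μ) atTop (𝓝 0) := by
  have h1 : Tendsto (fun n => ∫⁻ x, ‖(f n - g) x‖ₑ ^ 2 ∂μ) atTop (𝓝 (∫⁻ _, 0 ∂μ)) := by
    refine tendsto_lintegral_of_dominated_convergence' (fun _ => ENNReal.ofReal C ^ 2)
      (fun n => ((hf n).sub hg).enorm.pow_const 2) (fun n => ?_) ?_ ?_
    · filter_upwards [hb n] with x hx
      gcongr
      rw [← ofReal_norm]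
      exact ENNReal.ofReal_le_ofReal hx
    · rw [lintegral_const]
      exact ENNReal.mul_ne_top (by simp) (measure_ne_top _ _)
    · filter_upwards [hlim] with x hx
      have h2 := ENNReal.Tendsto.pow (n := 2) (tendsto_iff_edist_tendsto_0.1 hx)
      simpa [edist_eq_enorm_sub] using h2
  simp only [← eLpNorm_two_sq, lintegral_zero] at h1
  have e : ∀ x : ℝ≥0∞, (x ^ 2) ^ (1 / 2 : ℝ) = x := fun x => by
    rw [← ENNReal.rpow_natCast, ← ENNReal.rpow_mul]; norm_num
  have h2 := h1.ennrpow_const (1 / 2)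
  simp only [e] at h2
  rwa [ENNReal.zero_rpow_of_pos (by norm_num)] at h2

variable {d : ℕ} {D : Set (E d)}

namespace IsElliptic

variable {γ : E d → ℝ} {m m' : ℝ} (h : IsElliptic D γ m m')

/-- Smooth approximants of a zero-trace function need not vanish on `∂D`, but their boundary norms
tend to zero. Any finite boundary constant `B`, however large, is therefore allowed in the
hypothesis and is absent from the conclusion. -/
theorem norm_inner_gradLp_le (hD_open : IsOpen D) (hD_bdd : Bornology.IsBounded D) {u : H1 D}
    {ε B : ℝ≥0∞} (hε : ε ≠ ⊤) (hB : B ≠ ⊤)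
    (H : ∀ w : E d → ℂ, ContDiff ℝ ∞ w → HasCompactSupport w →
      ‖∫ x in D, (γ x : ℂ) * ∑ i : Fin d, u.grad x i * cgrad w x i‖ₑ ≤
        ε * eLpNorm (cgrad w) 2 (volume.restrict D) + B * eLpNorm w 2 (surfaceMeasure D))
    {v : H1 D} (hv : v.HasTrace 0) :
    ‖inner ℂ (h.gradLp v) (h.gradLp u)‖ ≤
      (ε * (ENNReal.ofReal m)⁻¹ ^ (1 / 2 : ℝ)).toReal * ‖h.gradLp v‖ := by
  have hmfin : (ENNReal.ofReal m)⁻¹ ^ (1 / 2 : ℝ) ≠ ⊤ :=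
    ENNReal.rpow_ne_top_of_nonneg (by norm_num) (ENNReal.inv_ne_top.2 (by simpa using h.pos))
  have hMfin : ENNReal.ofReal m' ^ (1 / 2 : ℝ) ≠ ⊤ :=
    ENNReal.rpow_ne_top_of_nonneg (by norm_num) ENNReal.ofReal_ne_top
  have hform : ∀ x : H1 D, ‖dirichletForm γ u x‖ₑ ≤ ‖h.gradLp u‖ₑ *
      (ENNReal.ofReal m' ^ (1 / 2 : ℝ) * eLpNorm x.grad 2 (volume.restrict D)) := by
    intro x
    have h1 : ‖dirichletForm γ u x‖ₑ ≤ ‖h.gradLp x.conj‖ₑ * ‖h.gradLp u‖ₑ := by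
      rw [h.dirichletForm_eq_inner, ← ofReal_norm, ← ofReal_norm,
        ← ofReal_norm, ← ENNReal.ofReal_mul (norm_nonneg _)]
      exact ENNReal.ofReal_le_ofReal (norm_inner_le_norm _ _)
    refine h1.trans ?_
    rw [mul_comm]
    refine mul_le_mul_right ((h.enorm_gradLp_le x.conj).trans (le_of_eq ?_)) _
    congr 1
    exact eLpNorm_congr_norm_ae (ae_of_all _ fun y => norm_conjVec _)
  have key : ‖inner ℂ (h.gradLp v) (h.gradLp u)‖ₑ ≤
      ε * eLpNorm v.conj.grad 2 (volume.restrict D) := by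
    rw [← gradLp_conj_conj h v, ← h.dirichletForm_eq_inner]
    refine ENNReal.le_of_forall_le_add_mul
      (K := ε + B + ‖h.gradLp u‖ₑ * ENNReal.ofReal m' ^ (1 / 2 : ℝ))
      (ENNReal.add_ne_top.2 ⟨ENNReal.add_ne_top.2 ⟨hε, hB⟩,
        ENNReal.mul_ne_top enorm_ne_top hMfin⟩) fun δ hδ => ?_
    obtain ⟨w, hw, hc, -, a2, a3⟩ := (H1.hasTrace_iff hD_open hD_bdd _ _).1 hv.conj_zero δ hδ
    have hw1 : Continuous (cgrad w) := continuous_cgrad (hw.of_le (by simp))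
    let W : H1 D := H1.ofSmooth w hw (memLp_of_continuous hD_open hD_bdd hw.continuous 2)
      (memLp_of_continuous hD_open hD_bdd hw1 2)
    have e0 : dirichletForm γ u v.conj =
        dirichletForm γ u W - dirichletForm γ u (W.addSMul (-1) v.conj) := by
      have hc' : h.gradLp (W.addSMul (-1) v.conj).conj
          = h.gradLp W.conj - h.gradLp v.conj.conj := by
        rw [← gradLp_sub, gradLp, gradLp]
        congr 1
        funext x; ext i; simp [H1.conj, H1.addSMul]
      rw [h.dirichletForm_eq_inner, h.dirichletForm_eq_inner, h.dirichletForm_eq_inner, hc',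
        inner_sub_left]
      ring
    have e1 : eLpNorm (cgrad w) 2 (volume.restrict D) ≤
        δ + eLpNorm v.conj.grad 2 (volume.restrict D) := by
      have := eLpNorm_add_le (μ := volume.restrict D) (p := 2) (f := cgrad w - v.conj.grad)
        (g := v.conj.grad) (hw1.aestronglyMeasurable.sub v.conj.memLp_grad.1)
        v.conj.memLp_grad.1 one_le_two
      rw [sub_add_cancel] at this
      exact this.trans (add_le_add a2 le_rfl)
    have e2 : eLpNorm (W.addSMul (-1) v.conj).grad 2 (volume.restrict D) ≤ δ := by
      refine le_of_eq_of_le (congrArg (fun F => eLpNorm F 2 (volume.restrict D)) ?_) a2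
      simp [W, H1.addSMul, H1.ofSmooth, sub_eq_add_neg]
    have e3 : eLpNorm w 2 (surfaceMeasure D) ≤ δ := by
      refine le_of_eq_of_le (eLpNorm_congr_ae ?_) a3
      filter_upwards [Lp.coeFn_zero ℂ 2 (surfaceMeasure D)] with x hx
      simp only [Pi.sub_apply, hx, Pi.zero_apply, sub_zero]
    rw [e0]
    refine enorm_sub_le.trans ((add_le_add (H w hw hc) (hform _)).trans ?_)
    calc _ ≤ ε * (δ + eLpNorm v.conj.grad 2 (volume.restrict D)) + B * δ +
          ‖h.gradLp u‖ₑ * (ENNReal.ofReal m' ^ (1 / 2 : ℝ) * δ) := by gcongr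
      _ = _ := by ring
  have hn : eLpNorm v.conj.grad 2 (volume.restrict D) = eLpNorm v.grad 2 (volume.restrict D) :=
    eLpNorm_congr_norm_ae (ae_of_all _ fun y => norm_conjVec _)
  rw [hn] at key
  have h3 := key.trans (mul_le_mul_right (h.eLpNorm_grad_le v) ε)
  rw [← mul_assoc] at h3
  have h4 := ENNReal.toReal_mono
    (ENNReal.mul_ne_top (ENNReal.mul_ne_top hε hmfin) enorm_ne_top) h3
  rwa [ENNReal.toReal_mul, toReal_enorm, toReal_enorm] at h4

end IsElliptic

section Mollification

open scoped Convolution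

open ContinuousLinearMap (lsmul)

/-- The derivative falls on `U`: the difference quotients are dominated by the Lipschitz constant
times the kernel, and `U` is differentiable almost everywhere by Rademacher's theorem. -/
theorem hasFDerivAt_normed_convolution {U : E d → ℂ} {K : ℝ≥0} (hU : LipschitzWith K U)
    (φ : ContDiffBump (0 : E d)) (x : E d) :
    HasFDerivAt (φ.normed volume ⋆[lsmul ℝ ℝ, volume] U)
      ((φ.normed volume ⋆[lsmul ℝ ℝ, volume] (fderiv ℝ U)) x) x := by
  have hφ : Integrable (φ.normed (volume : Measure (E d))) volume := φ.integrable_normed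
  have hφc : Continuous (φ.normed (volume : Measure (E d))) :=
    (φ.contDiff_normed (n := 0)).continuous
  have hUx : ∀ x : E d, Continuous fun t => U (x - t) := fun x =>
    hU.continuous.comp (by fun_prop)
  refine (hasFDerivAt_integral_of_dominated_loc_of_lip (μ := (volume : Measure (E d)))
    (F := fun x t => φ.normed volume t • U (x - t))
    (F' := fun t => φ.normed volume t • fderiv ℝ U (x - t))
    (bound := fun t => φ.normed volume t * K) (s := Set.univ) univ_mem ?_ ?_ ?_ ?_ ?_ ?_).2
  · exact Eventually.of_forall fun y => (hφc.smul (hUx y)).aestronglyMeasurable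
  · exact (hφc.smul (hUx x)).integrable_of_hasCompactSupport φ.hasCompactSupport_normed.smul_right
  · exact hφc.aestronglyMeasurable.smul
      ((measurable_fderiv ℝ U).comp (measurable_const.sub measurable_id)).aestronglyMeasurable
  · refine ae_of_all _ fun t => LipschitzOnWith.of_dist_le_mul fun y _ z _ => ?_
    have h1 := hU.dist_le_mul (y - t) (z - t)
    rw [dist_sub_right] at h1
    rw [dist_smul₀, Real.coe_nnabs, abs_mul, Real.norm_eq_abs, NNReal.abs_eq, mul_assoc]
    gcongr
  · exact hφ.mul_const _
  · have hd : ∀ᵐ t ∂(volume : Measure (E d)), DifferentiableAt ℝ U (x - t) :=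
      (Measure.measurePreserving_sub_left volume x).quasiMeasurePreserving.ae
        hU.ae_differentiableAt
    filter_upwards [hd] with t ht
    have h2 : HasFDerivAt (fun y : E d => y - t) (ContinuousLinearMap.id ℝ (E d)) x :=
      (hasFDerivAt_id x).sub_const t
    have := (ht.hasFDerivAt.comp x h2).const_smul (φ.normed volume t)
    rw [ContinuousLinearMap.comp_id] at this
    exact this

/-- A bounded Lipschitz function is an element of `H¹(D)`, with trace its restriction. -/
theorem exists_H1_of_lipschitzWith (hD_open : IsOpen D) (hD_bdd : Bornology.IsBounded D)
    [IsFiniteMeasure (surfaceMeasure D)] {U : E d → ℂ} {K : ℝ≥0} (hU : LipschitzWith K U)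
    {C : ℝ} (hC : ∀ x, ‖U x‖ ≤ C) :
    ∃ u : H1 D, u.toFun = U ∧ u.grad = cgrad U ∧
      ∀ f : L2Boundary D, ⇑f =ᵐ[surfaceMeasure D] U → u.HasTrace f := by
  have hfin : IsFiniteMeasure (volume.restrict D) :=
    ⟨by rw [Measure.restrict_apply_univ]; exact hD_bdd.measure_lt_top⟩
  -- The outer radius is always twice the inner one. This fixed ratio is what the convergence of
  -- mollifications at Lebesgue points of `fderiv ℝ U` requires below.
  let φ : ℕ → ContDiffBump (0 : E d) := fun n =>
    ⟨1 / (n + 1), 2 / (n + 1), by positivity, by gcongr; norm_num⟩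
  have hφ : Tendsto (fun n => (φ n).rOut) atTop (𝓝 0) := by
    have := (tendsto_one_div_add_atTop_nhds_zero_nat (𝕜 := ℝ)).const_mul 2
    simpa [φ, div_eq_mul_inv] using this
  have hφ2 : ∀ n, (φ n).rOut ≤ 2 := fun n => by
    simp only [φ]
    rw [div_le_iff₀ (by positivity)]
    have : (0 : ℝ) ≤ n := Nat.cast_nonneg n
    linarith
  let w : ℕ → E d → ℂ := fun n => (φ n).normed volume ⋆[lsmul ℝ ℝ, volume] U
  have hUl : LocallyIntegrable U volume := hU.continuous.locallyIntegrable
  have hdb : ∀ x, ‖fderiv ℝ U x‖ ≤ K := fun x => norm_fderiv_le_of_lipschitz ℝ hU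
  have hDl : LocallyIntegrable (fderiv ℝ U) volume := by
    have : MemLp (fderiv ℝ U) ⊤ volume :=
      memLp_top_of_bound (measurable_fderiv ℝ U).aestronglyMeasurable K (ae_of_all _ hdb)
    exact this.locallyIntegrable le_top
  have hw : ∀ n, ContDiff ℝ ∞ (w n) := fun n =>
    (φ n).hasCompactSupport_normed.contDiff_convolution_left _ (φ n).contDiff_normed hUl
  have hder : ∀ n x, fderiv ℝ (w n) x =
      ((φ n).normed volume ⋆[lsmul ℝ ℝ, volume] (fderiv ℝ U)) x := fun n x =>
    (hasFDerivAt_normed_convolution hU (φ n) x).fderiv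
  have hwU : ∀ n x, ‖w n x - U x‖ ≤ K * 2 := fun n x => by
    rw [← dist_eq_norm]
    refine ContDiffBump.dist_normed_convolution_le hU.continuous.aestronglyMeasurable
      fun y hy => (hU.dist_le_mul y x).trans ?_
    gcongr
    exact (Metric.mem_ball.1 hy).le.trans (hφ2 n)
  have hwlim : ∀ x, Tendsto (fun n => w n x) atTop (𝓝 (U x)) := fun x =>
    ContDiffBump.convolution_tendsto_right_of_continuous hφ hU.continuous x
  have hDlim : ∀ᵐ x ∂(volume : Measure (E d)),
      Tendsto (fun n => fderiv ℝ (w n) x) atTop (𝓝 (fderiv ℝ U x)) := by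
    simp only [hder]
    refine ContDiffBump.ae_convolution_tendsto_right_of_locallyIntegrable (K := 2) hφ
      (Eventually.of_forall fun n => ?_) hDl
    simp only [φ]
    exact le_of_eq (by ring)
  have hDb : ∀ n x, ‖fderiv ℝ (w n) x‖ ≤ K := fun n x => by
    refine norm_fderiv_le_of_lipschitz ℝ (LipschitzWith.of_dist_le_mul fun y z => ?_)
    have hy : ∀ y, Integrable (fun t => (φ n).normed volume t • U (y - t)) volume := fun y => by
      refine ((((φ n).contDiff_normed (n := 0)).continuous).smul (hU.continuous.comp
        (by fun_prop))).integrable_of_hasCompactSupport (φ n).hasCompactSupport_normed.smul_right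
    have e : w n y - w n z =
        ∫ t, (φ n).normed volume t • U (y - t) - (φ n).normed volume t • U (z - t) := by
      rw [integral_sub (hy y) (hy z)]; rfl
    rw [dist_eq_norm, e]
    refine (norm_integral_le_of_norm_le ((φ n).integrable_normed.mul_const (K * dist y z))
      (ae_of_all _ fun t => ?_)).trans (le_of_eq ?_)
    · rw [← smul_sub, norm_smul, Real.norm_of_nonneg ((φ n).nonneg_normed t), ← dist_eq_norm]
      have := hU.dist_le_mul (y - t) (z - t)
      rw [dist_sub_right] at this
      exact mul_le_mul_of_nonneg_left this ((φ n).nonneg_normed t)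
    · rw [integral_mul_const, (φ n).integral_normed, one_mul]
  have hcgm : AEStronglyMeasurable (cgrad U) (volume : Measure (E d)) := by
    refine Measurable.aestronglyMeasurable ?_
    refine (PiLp.continuous_toLp 2 _).measurable.comp (measurable_pi_lambda _ fun i => ?_)
    exact measurable_fderiv_apply_const ℝ U _
  have hcglim : ∀ᵐ x ∂(volume : Measure (E d)),
      Tendsto (fun n => cgrad (w n) x) atTop (𝓝 (cgrad U x)) := by
    filter_upwards [hDlim] with x hx
    refine ((PiLp.continuous_toLp 2 _).tendsto _).comp (tendsto_pi_nhds.2 fun i => ?_)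
    exact ((ContinuousLinearMap.apply ℝ ℂ
      (EuclideanSpace.single i (1 : ℝ))).continuous.tendsto _).comp hx
  have hcgb : ∀ V : E d → ℂ, (∀ x, ‖fderiv ℝ V x‖ ≤ K) → ∀ x, ‖cgrad V x‖ ≤ d * K :=
    fun V hV x => (norm_cgrad_le V x).trans (by gcongr; exact hV x)
  have t1 : Tendsto (fun n => eLpNorm (w n - U) 2 (volume.restrict D)) atTop (𝓝 0) :=
    tendsto_eLpNorm_two_of_bounded (fun n => (hw n).continuous.aestronglyMeasurable)
      hU.continuous.aestronglyMeasurable (fun n => ae_of_all _ (hwU n)) (ae_of_all _ hwlim)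
  have t2 : Tendsto (fun n => eLpNorm (cgrad (w n) - cgrad U) 2 (volume.restrict D))
      atTop (𝓝 0) := by
    refine tendsto_eLpNorm_two_of_bounded (C := d * K + d * K)
      (fun n => (continuous_cgrad ((hw n).of_le (by simp))).aestronglyMeasurable)
      hcgm.restrict (fun n => ae_of_all _ fun x => ?_) (ae_restrict_of_ae hcglim)
    exact (norm_sub_le _ _).trans (add_le_add (hcgb _ (hDb n) x) (hcgb _ hdb x))
  refine ⟨H1.ofTendsto (fun n => H1.ofSmooth (w n) (hw n)
      (memLp_of_continuous hD_open hD_bdd (hw n).continuous 2)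
      (memLp_of_continuous hD_open hD_bdd (continuous_cgrad ((hw n).of_le (by simp))) 2))
      U (cgrad U) (MemLp.of_bound hU.continuous.aestronglyMeasurable C (ae_of_all _ hC))
      (MemLp.of_bound hcgm.restrict (d * K) (ae_of_all _ (hcgb _ hdb))) t1 t2, rfl, rfl,
      fun f hf => ⟨w, hw, t1, t2, ?_⟩⟩
  -- The mollifications converge to `U` at every point, not only almost everywhere in volume, so the
  -- same dominated convergence applies to the surface measure.
  refine (tendsto_eLpNorm_two_of_bounded (μ := surfaceMeasure D)
    (fun n => (hw n).continuous.aestronglyMeasurable) hU.continuous.aestronglyMeasurable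
    (fun n => ae_of_all _ (hwU n)) (ae_of_all _ hwlim)).congr fun n => eLpNorm_congr_ae ?_
  exact (ae_eq_rfl.sub hf).symm

end Mollification

end Calderon

/-! ### Almost sure disappearance of the noise -/

namespace Calderon

theorem norm_star_L2Boundary {d : ℕ} {D : Set (E d)} (f : L2Boundary D) : ‖star f‖ = ‖f‖ := by
  rw [Lp.norm_def, Lp.norm_def]
  congr 1
  refine eLpNorm_congr_norm_ae ?_
  filter_upwards [Lp.coeFn_star f] with x hx
  rw [hx, Pi.star_apply, norm_star]

section Noise

variable {Ω : Type*} [MeasurableSpace Ω] {Pr : Measure Ω} {X : ℕ × ℕ → Ω → ℂ}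
  {d : ℕ} {D : Set (E d)}

/-- Pythagoras for the orthonormal family `X α` on finite sums, then Bessel's inequality for `f` and
for `g`. -/
theorem norm_tsum_noiseTerm_le (hX : IsWhiteNoise Pr X) (e : HilbertBasis ℕ ℂ (L2Boundary D))
    (f g : L2Boundary D) : ‖∑' α : ℕ × ℕ, noiseTerm hX e f g α‖ ^ 2 ≤ ‖f‖ ^ 2 * ‖g‖ ^ 2 := by
  have hf : Summable fun n => ‖inner ℂ (e n) f‖ ^ 2 := e.orthonormal.inner_products_summable f
  have hg : Summable fun n => ‖inner ℂ (e n) g‖ ^ 2 := e.orthonormal.inner_products_summable g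
  have hfg := hf.mul_of_nonneg hg (fun _ => by positivity) (fun _ => by positivity)
  have hsum : Tendsto (fun s : Finset (ℕ × ℕ) => ‖∑ α ∈ s, noiseTerm hX e f g α‖ ^ 2) atTop
      (𝓝 (‖∑' α : ℕ × ℕ, noiseTerm hX e f g α‖ ^ 2)) :=
    ((summable_noiseTerm hX e f g).hasSum.norm).pow 2
  refine le_of_tendsto' hsum fun s => ?_
  have h1 : ‖∑ α ∈ s, noiseTerm hX e f g α‖ ^ 2
      = ∑ α ∈ s, ‖inner ℂ (e α.1) f‖ ^ 2 * ‖inner ℂ (e α.2) g‖ ^ 2 := by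
    have := hX.orthonormal.orthogonalFamily.norm_sum
      (fun α : ℕ × ℕ => inner ℂ (e α.1) f * inner ℂ (e α.2) g) s
    simp only [LinearIsometry.toSpanSingleton_apply, norm_mul, mul_pow] at this
    exact this
  rw [h1]
  refine (hfg.sum_le_tsum s fun _ _ => by positivity).trans ?_
  rw [← hf.tsum_mul_tsum hg hfg]
  gcongr
  · exact e.orthonormal.tsum_inner_products_le f
  · exact e.orthonormal.tsum_inner_products_le g

/-- The random series `∑ |Y n|²` has finite expectation, hence is almost surely finite, so its terms
tend to zero. No independence in `n` is involved. -/
theorem ae_tendsto_zero_of_summable {Y : ℕ → Lp ℂ 2 Pr} (h : Summable fun n => ‖Y n‖ ^ 2) :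
    ∀ᵐ s ∂Pr, Tendsto (fun n => Y n s) atTop (𝓝 0) := by
  have h1 : ∫⁻ s, ∑' n, ‖Y n s‖ₑ ^ 2 ∂Pr ≠ ⊤ := by
    rw [lintegral_tsum fun n => (Lp.aestronglyMeasurable (Y n)).enorm.pow_const 2]
    have : ∀ n, ∫⁻ s, ‖Y n s‖ₑ ^ 2 ∂Pr = ENNReal.ofReal (‖Y n‖ ^ 2) := fun n => by
      rw [← eLpNorm_two_sq, ← Lp.enorm_def, ← ofReal_norm, ENNReal.ofReal_pow (norm_nonneg _)]
    simp only [this]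
    exact h.tsum_ofReal_ne_top
  filter_upwards [ae_lt_top' (AEMeasurable.tsum fun n =>
    (Lp.aestronglyMeasurable (Y n)).enorm.pow_const 2) h1] with s hs
  have h2 := ENNReal.tendsto_atTop_zero_of_tsum_ne_top hs.ne
  have h3 : Tendsto (fun n => ‖Y n s‖ ^ 2) atTop (𝓝 0) := by
    have := (ENNReal.tendsto_toReal ENNReal.zero_ne_top).comp h2
    simpa [Function.comp_def] using this
  rw [tendsto_zero_iff_norm_tendsto_zero]
  have h4 := h3.sqrt
  simpa [Real.sqrt_sq] using h4

/-- The second moment of the noise is at most `‖f N‖⁴ ≤ C² / N²`, which is summable. The decay `1/N`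
of the squared norm is thus fast enough for convergence of the whole sequence, without subsequences.
-/
theorem ae_tendsto_noisyData [IsProbabilityMeasure Pr] (hX : IsWhiteNoise Pr X)
    (e : HilbertBasis ℕ ℂ (L2Boundary D)) {γ : E d → ℝ} {f : ℕ → L2Boundary D} {C : ℝ}
    (hf : ∀ᶠ N : ℕ in atTop, ‖f N‖ ^ 2 ≤ C / N) {z : ℂ}
    (hz : Tendsto (fun N => dnPairing D γ (f N) (star (f N))) atTop (𝓝 z)) :
    ∀ᵐ s ∂Pr, Tendsto (fun N : ℕ => noisyData γ hX e (f N) (star (f N)) s) atTop (𝓝 z) := by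
  have hsum : Summable fun N => ‖∑' α : ℕ × ℕ, noiseTerm hX e (f N) (star (f N)) α‖ ^ 2 := by
    refine Summable.of_norm_bounded_eventually_nat (g := fun N : ℕ => C ^ 2 * ((N : ℝ) ^ 2)⁻¹)
      ((Real.summable_nat_pow_inv.2 one_lt_two).mul_left _) ?_
    filter_upwards [hf] with N hN
    rw [Real.norm_of_nonneg (by positivity)]
    refine (norm_tsum_noiseTerm_le hX e _ _).trans ?_
    rw [norm_star_L2Boundary]
    calc ‖f N‖ ^ 2 * ‖f N‖ ^ 2 ≤ (C / N) * (C / N) := by gcongr; exact (by positivity : (0:ℝ) ≤ _).trans hN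
      _ = _ := by ring
  have h1 := ae_tendsto_zero_of_summable hsum
  -- Elements of `L²(Ω)` are classes, so the pointwise splitting holds off a null set for each `N`;
  -- countability gives one null set for all.
  have h2 : ∀ᵐ s ∂Pr, ∀ N, noisyData γ hX e (f N) (star (f N)) s =
      dnPairing D γ (f N) (star (f N)) + (∑' α : ℕ × ℕ, noiseTerm hX e (f N) (star (f N)) α) s := by
    refine ae_all_iff.2 fun N => ?_
    filter_upwards [Lp.coeFn_add (Lp.const 2 Pr (dnPairing D γ (f N) (star (f N))))
      (∑' α : ℕ × ℕ, noiseTerm hX e (f N) (star (f N)) α),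
      Lp.coeFn_const (p := 2) (μ := Pr) (dnPairing D γ (f N) (star (f N)))] with s e1 e2
    rw [noisyData, e1, Pi.add_apply, e2, Function.const_apply]
  filter_upwards [h1, h2] with s a1 a2
  simp only [a2]
  simpa using hz.add a1

end Noise

end Calderon

/-! ### Admissible data at almost every boundary point -/

namespace Calderon

theorem norm_gradient_le {n : ℕ} {φ : E n → ℝ} {K : ℝ≥0} (hφ : LipschitzWith K φ) (x : E n) :
    ‖gradient φ x‖ ≤ K := by
  rw [gradient, LinearIsometryEquiv.norm_map]
  exact norm_fderiv_le_of_lipschitz ℝ hφ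

theorem measurable_gradient {n : ℕ} (φ : E n → ℝ) : Measurable (gradient φ) :=
  ((InnerProductSpace.toDual ℝ (E n)).symm.continuous.measurable).comp (measurable_fderiv ℝ φ)

theorem setIntegral_closedBall_zero_add {n : ℕ} (f : E n → ℝ) (p : E n) (r : ℝ) :
    ∫ x in Metric.closedBall (0 : E n) r, f (x + p) = ∫ x in Metric.closedBall p r, f x := by
  have := (measurePreserving_add_right volume p).setIntegral_preimage_emb
    (measurableEmbedding_addRight p) f (Metric.closedBall p r)
  simpa using this

/-- At a Lebesgue point the mean of `|∇φ - ∇φ(p)|` tends to zero. The deviation is bounded by `2K`,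
so its square is at most `2K` times itself, and the mean square follows. -/
theorem ae_tendsto_integral_gradient {n : ℕ} {φ : E n → ℝ} {K : ℝ≥0} (hφ : LipschitzWith K φ) :
    ∀ᵐ p ∂(volume : Measure (E n)), Tendsto (fun r : ℝ => (r ^ n)⁻¹ *
      ∫ x in Metric.closedBall (0 : E n) r, ‖gradient φ (x + p) - gradient φ p‖ ^ 2)
      (𝓝[>] 0) (𝓝 0) := by
  have hl : LocallyIntegrable (gradient φ) volume := by
    have : MemLp (gradient φ) ⊤ volume :=
      memLp_top_of_bound (measurable_gradient φ).aestronglyMeasurable K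
        (ae_of_all _ (norm_gradient_le hφ))
    exact this.locallyIntegrable le_top
  filter_upwards [(Besicovitch.vitaliFamily volume).ae_tendsto_average_norm_sub hl] with p hp
  have h1 := (hp.comp (Besicovitch.tendsto_filterAt volume p)).const_mul
    (2 * K * volume.real (Metric.ball (0 : E n) 1))
  rw [mul_zero] at h1
  refine squeeze_zero' ?_ ?_ h1
  · filter_upwards [self_mem_nhdsWithin] with r hr
    have : (0 : ℝ) < r := hr
    positivity
  · filter_upwards [self_mem_nhdsWithin] with r hr
    have hr0 : (0 : ℝ) < r := hr
    rw [setIntegral_closedBall_zero_add (fun x => ‖gradient φ x - gradient φ p‖ ^ 2)]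
    have hint : IntegrableOn (fun x => ‖gradient φ x - gradient φ p‖)
        (Metric.closedBall p r) := by
      refine ((hl.integrableOn_isCompact (isCompact_closedBall p r)).sub ?_).norm
      exact integrableOn_const (isCompact_closedBall p r).measure_lt_top.ne
    have h2 : ∫ x in Metric.closedBall p r, ‖gradient φ x - gradient φ p‖ ^ 2 ≤
        2 * K * ∫ x in Metric.closedBall p r, ‖gradient φ x - gradient φ p‖ := by
      rw [← integral_const_mul]
      refine integral_mono_of_nonneg (ae_of_all _ fun x => by positivity) (hint.const_mul _)
        (ae_of_all _ fun x => ?_)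
      have h3 : ‖gradient φ x - gradient φ p‖ ≤ 2 * K := by
        have := norm_sub_le (gradient φ x) (gradient φ p)
        linarith [norm_gradient_le hφ x, norm_gradient_le hφ p]
      simp only [sq]
      gcongr
    simp only [Function.comp_apply, setAverage_eq, Measure.addHaar_real_closedBall _ p hr0.le,
      finrank_euclideanSpace, Fintype.card_fin, smul_eq_mul, mul_inv]
    have hB : 0 < volume.real (Metric.ball (0 : E n) 1) :=
      ENNReal.toReal_pos (Metric.measure_ball_pos _ _ one_pos).ne' measure_ball_lt_top.ne
    calc _ ≤ (r ^ n)⁻¹ * (2 * K * ∫ x in Metric.closedBall p r,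
          ‖gradient φ x - gradient φ p‖) := by gcongr
      _ = _ := by field_simp

namespace BoundaryChart

variable {d : ℕ} {D : Set (E d)} {P : E d} (c : BoundaryChart D P)

/-- The same local representation near another point. -/
noncomputable def rebase {Q : E d} (hQ : Q ∈ Metric.ball P c.ρ) : BoundaryChart D Q where
  coord := c.coord
  φ := c.φ
  ρ := c.ρ - dist Q P
  ρ_pos := by simpa using hQ
  lipschitz := c.lipschitz
  mem_iff y hy := c.mem_iff y (Metric.ball_subset_ball' (by linarith) hy)
  mem_frontier_iff y hy := c.mem_frontier_iff y (Metric.ball_subset_ball' (by linarith) hy)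

/-- In the unknowns `u = ξ' - ξ_d ∇φ(p')` and `t = ξ_d` the two conditions on `ξ` decouple: take `u`
a unit vector along `g` and `t = ‖g‖`. If `g = 0` any unit vector serves, and one exists because `n
≥ 1`; this is where `d ≥ 2` is needed. -/
theorem exists_direction {n : ℕ} (hn : 1 ≤ n) (g : E n) :
    ∃ u : E n, ∃ t : ℝ, ‖u‖ ^ 2 + t ^ 2 = ‖g‖ ^ 2 + 1 ∧ inner ℝ u (-g) + t = 0 := by
  obtain ⟨u, hu, hug⟩ : ∃ u : E n, ‖u‖ = 1 ∧ inner ℝ u g = ‖g‖ := by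
    rcases eq_or_ne g 0 with rfl | hg
    · exact ⟨EuclideanSpace.single ⟨0, hn⟩ 1, by simp, by simp⟩
    · have hg0 : ‖g‖ ≠ 0 := norm_ne_zero_iff.2 hg
      refine ⟨‖g‖⁻¹ • g, by rw [norm_smul, norm_inv, norm_norm, inv_mul_cancel₀ hg0], ?_⟩
      rw [real_inner_smul_left, real_inner_self_eq_norm_sq]
      field_simp
  exact ⟨u, ‖g‖, by rw [hu]; ring, by rw [inner_neg_right, hug]; ring⟩

theorem nonempty_brownData (hd : 2 ≤ d) (h1 : DifferentiableAt ℝ c.φ (c.proj P))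
    (h2 : Tendsto (fun r : ℝ => (r ^ (d - 1))⁻¹ *
      ∫ x in Metric.closedBall (0 : E (d - 1)) r,
        ‖gradient c.φ (x + c.proj P) - gradient c.φ (c.proj P)‖ ^ 2) (𝓝[>] 0) (𝓝 0)) :
    Nonempty (BrownData D P) := by
  obtain ⟨u, t, hn, ho⟩ := exists_direction (by omega : 1 ≤ d - 1) (gradient c.φ (c.proj P))
  let χ : ContDiffBump (0 : ℝ) := ⟨1 / 2, 1, by norm_num, by norm_num⟩
  refine ⟨{ c with
    differentiableAt := h1
    lebesgue := h2
    η := χ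
    η_smooth := χ.contDiff
    η_mem := fun t => ⟨χ.nonneg, χ.le_one⟩
    η_one := fun t ht => χ.one_of_mem_closedBall (by simpa [χ] using ht)
    η_zero := fun t ht => χ.zero_of_le_dist (by simpa [χ] using ht)
    ξ := WithLp.toLp 2 (u + t • gradient c.φ (c.proj P), t)
    ξ_ne := fun h0 => ?_
    ξ_norm := ?_
    ξ_orth := ?_ }⟩
  · have ht : t = 0 := congrArg WithLp.snd h0
    have hu : u + t • gradient c.φ (c.proj P) = 0 := congrArg WithLp.fst h0
    rw [ht, zero_smul, add_zero] at hu
    rw [ht, hu] at hn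
    simp only [norm_zero] at hn
    nlinarith [sq_nonneg ‖gradient c.φ (c.proj P)‖]
  · change ‖u + t • gradient c.φ (c.proj P) - t • gradient c.φ (c.proj P)‖ ^ 2 + t ^ 2 = _
    rw [add_sub_cancel_right]
    exact hn
  · change inner ℝ (u + t • gradient c.φ (c.proj P) - t • gradient c.φ (c.proj P)) _ + t = 0
    rw [add_sub_cancel_right]
    exact ho

end BoundaryChart

/-- Rademacher's theorem and Lebesgue differentiation hold off a null set of parameters, which the
Lipschitz graph map sends to a set of surface measure zero. A chart at one point serves all nearby
points, so the exceptional set is locally null. -/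
theorem ae_nonempty_brownData {d : ℕ} (hd : 2 ≤ d) {D : Set (E d)}
    (hD_lip : HasLipschitzBoundary D) :
    ∀ᵐ P ∂(surfaceMeasure D), Nonempty (BrownData D P) := by
  rw [surfaceMeasure, ae_restrict_iff' isClosed_frontier.measurableSet, ae_iff]
  refine measure_null_of_locally_null _ fun P hP => ?_
  obtain ⟨hPD, -⟩ : P ∈ frontier D ∧ _ := by simpa using hP
  obtain ⟨c⟩ := hD_lip P hPD
  obtain ⟨K, hK⟩ := c.lipschitz
  have hnull : volume {x | ¬ (DifferentiableAt ℝ c.φ x ∧ Tendsto (fun r : ℝ => (r ^ (d - 1))⁻¹ *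
      ∫ y in Metric.closedBall (0 : E (d - 1)) r,
        ‖gradient c.φ (y + x) - gradient c.φ x‖ ^ 2) (𝓝[>] 0) (𝓝 0))} = 0 :=
    ae_iff.1 (hK.ae_differentiableAt.and (ae_tendsto_integral_gradient hK))
  refine ⟨_, inter_mem_nhdsWithin _ (Metric.ball_mem_nhds P c.ρ_pos), ?_⟩
  refine measure_mono_null (t := c.graph '' _) ?_ (le_antisymm
    ((c.graph_image_measure_le hK _).trans (by rw [hnull, mul_zero])) zero_le)
  rintro Q ⟨hQ, hQP⟩
  obtain ⟨hQD, hQn⟩ : Q ∈ frontier D ∧ ¬ Nonempty (BrownData D Q) := by simpa using hQ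
  refine ⟨c.proj Q, fun h => hQn ?_, c.graph_proj_of_mem hQP hQD⟩
  exact (c.rebase hQP).nonempty_brownData hd h.1 h.2

end Calderon

/-! ### Brown's oscillating function and the flattening map -/

namespace Calderon

instance continuousSMul_coord (d : ℕ) : ContinuousSMul ℝ (Coord d) :=
  IsBoundedSMul.continuousSMul

namespace BrownData

variable {d : ℕ} {D : Set (E d)} {P : E d} (b : BrownData D P)

/-- The cut-off `η(|x'|) η(x_d)`. -/
noncomputable def cutoff (x : Coord d) : ℝ := b.η ‖x.fst‖ * b.η x.snd

/-- The complex phase `x ↦ (iξ - e_d) · x`. -/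
noncomputable def phase : Coord d →L[ℝ] ℂ :=
  Complex.I • (Complex.ofRealCLM.comp (innerSL ℝ b.ξ)) -
    Complex.ofRealCLM.comp (WithLp.sndL 2 ℝ (E (d - 1)) ℝ)

theorem phase_apply (x : Coord d) :
    b.phase x = Complex.I * (inner ℝ b.ξ x : ℝ) - (x.snd : ℝ) := by
  simp [phase]

theorem a_eq {M : ℝ} (hM : 0 ≤ M) (N : ℝ) (x : Coord d) :
    b.a M N x = (b.cutoff (M • x) : ℂ) * Complex.exp (N * b.phase x) := by
  rw [a, phase_apply, cutoff, WithLp.smul_fst, WithLp.smul_snd, norm_smul,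
    Real.norm_of_nonneg hM]
  simp

/-- The norm is not smooth at the origin, but `η` is identically one near zero. -/
theorem contDiff_radial : ContDiff ℝ ∞ fun x : E (d - 1) => b.η ‖x‖ := by
  refine contDiff_iff_contDiffAt.2 fun x => ?_
  rcases eq_or_ne x 0 with rfl | hx
  · refine (contDiffAt_const (c := (1 : ℝ))).congr_of_eventuallyEq ?_
    filter_upwards [Metric.ball_mem_nhds (0 : E (d - 1)) (by norm_num : (0 : ℝ) < 1 / 2)] with y hy
    refine b.η_one _ ?_
    rw [abs_norm]
    exact (mem_ball_zero_iff.1 hy).le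
  · exact b.η_smooth.contDiffAt.comp x (contDiffAt_norm ℝ hx)

theorem contDiff_cutoff : ContDiff ℝ ∞ b.cutoff :=
  (b.contDiff_radial.comp (WithLp.fstL 2 ℝ (E (d - 1)) ℝ).contDiff).mul
    (b.η_smooth.comp (WithLp.sndL 2 ℝ (E (d - 1)) ℝ).contDiff)

theorem cutoff_eq_zero {x : Coord d} (hx : 1 ≤ ‖x.fst‖ ∨ 1 ≤ |x.snd|) : b.cutoff x = 0 := by
  rcases hx with hx | hx
  · rw [cutoff, b.η_zero ‖x.fst‖ (by rwa [abs_norm]), zero_mul]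
  · rw [cutoff, b.η_zero _ hx, mul_zero]

theorem cutoff_nonneg (x : Coord d) : 0 ≤ b.cutoff x :=
  mul_nonneg (b.η_mem _).1 (b.η_mem _).1

theorem cutoff_le_one (x : Coord d) : b.cutoff x ≤ 1 :=
  mul_le_one₀ (b.η_mem _).2 (b.η_mem _).1 (b.η_mem _).2

theorem hasCompactSupport_cutoff : HasCompactSupport b.cutoff := by
  refine HasCompactSupport.intro (isCompact_closedBall (0 : Coord d) 2) fun x hx => ?_
  refine b.cutoff_eq_zero ?_
  by_contra! h
  have := BoundaryChart.norm_le_add x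
  rw [Real.norm_eq_abs x.snd] at this
  refine hx (mem_closedBall_zero_iff.2 ?_)
  linarith

theorem fderiv_cutoff_eq_zero {x : Coord d} (hx : 1 < ‖x.fst‖ ∨ 1 < |x.snd|) :
    fderiv ℝ b.cutoff x = 0 := by
  have h1 : Continuous fun x : Coord d => ‖x.fst‖ :=
    (WithLp.fstL 2 ℝ (E (d - 1)) ℝ).continuous.norm
  have h2 : Continuous fun x : Coord d => |x.snd| :=
    (WithLp.sndL 2 ℝ (E (d - 1)) ℝ).continuous.abs
  have : b.cutoff =ᶠ[𝓝 x] fun _ => 0 := by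
    rcases hx with hx | hx
    · filter_upwards [h1.continuousAt.eventually (lt_mem_nhds hx)] with y hy
      exact b.cutoff_eq_zero (Or.inl hy.le)
    · filter_upwards [h2.continuousAt.eventually (lt_mem_nhds hx)] with y hy
      exact b.cutoff_eq_zero (Or.inr hy.le)
  rw [this.fderiv_eq]; simp

theorem exists_norm_fderiv_cutoff_le : ∃ C : ℝ, 0 ≤ C ∧ ∀ x, ‖fderiv ℝ b.cutoff x‖ ≤ C := by
  obtain ⟨C, hC⟩ := (b.hasCompactSupport_cutoff.fderiv ℝ).exists_bound_of_continuous
    (b.contDiff_cutoff.continuous_fderiv (by simp))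
  exact ⟨C, (norm_nonneg _).trans (hC 0), hC⟩

theorem contDiff_a {M : ℝ} (hM : 0 ≤ M) (N : ℝ) : ContDiff ℝ ∞ (b.a M N) := by
  have : b.a M N = fun x => (b.cutoff (M • x) : ℂ) * Complex.exp (N * b.phase x) :=
    funext (b.a_eq hM N)
  rw [this]
  exact (Complex.ofRealCLM.contDiff.comp (b.contDiff_cutoff.comp (contDiff_const_smul M))).mul
    (contDiff_const.mul b.phase.contDiff).cexp

theorem fderiv_a_apply {M : ℝ} (hM : 0 ≤ M) (N : ℝ) (x k : Coord d) :
    fderiv ℝ (b.a M N) x k = b.a M N x * (N * b.phase k) +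
      Complex.exp (N * b.phase x) * (M * fderiv ℝ b.cutoff (M • x) k : ℝ) := by
  have h1 : HasFDerivAt (fun x : Coord d => (b.cutoff (M • x) : ℂ))
      (Complex.ofRealCLM.comp ((fderiv ℝ b.cutoff (M • x)).comp
        (M • ContinuousLinearMap.id ℝ (Coord d)))) x := by
    have h2 : HasFDerivAt (fun x : Coord d => M • x) (M • ContinuousLinearMap.id ℝ (Coord d)) x :=
      (hasFDerivAt_id x).const_smul M
    exact Complex.ofRealCLM.hasFDerivAt.comp x
      (((b.contDiff_cutoff.differentiable (by simp) (M • x)).hasFDerivAt).comp x h2)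
  have h3 : HasFDerivAt (fun x : Coord d => Complex.exp (N * b.phase x))
      (Complex.exp (N * b.phase x) • ((N : ℂ) • b.phase)) x :=
    (b.phase.hasFDerivAt.const_mul (N : ℂ)).cexp
  rw [((h1.mul h3).congr_of_eventuallyEq (Eventually.of_forall (b.a_eq hM N))).fderiv, b.a_eq hM]
  simp
  ring

theorem norm_exp_phase (N : ℝ) (x : Coord d) :
    ‖Complex.exp (N * b.phase x)‖ = Real.exp (-(N * x.snd)) := by
  rw [Complex.norm_exp, phase_apply]
  simp

theorem a_eq_zero {M : ℝ} (hM : 0 < M) (N : ℝ) {x : Coord d}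
    (hx : M⁻¹ ≤ ‖x.fst‖ ∨ M⁻¹ ≤ |x.snd|) : b.a M N x = 0 := by
  rw [b.a_eq hM.le, b.cutoff_eq_zero, Complex.ofReal_zero, zero_mul]
  rw [WithLp.smul_fst, WithLp.smul_snd, norm_smul, smul_eq_mul, abs_mul, Real.norm_of_nonneg hM.le,
    abs_of_pos hM]
  exact hx.imp (inv_le_iff_one_le_mul₀' hM).1 (inv_le_iff_one_le_mul₀' hM).1

theorem fderiv_cutoff_smul_eq_zero {M : ℝ} (hM : 0 < M) {x : Coord d}
    (hx : M⁻¹ < ‖x.fst‖ ∨ M⁻¹ < |x.snd|) : fderiv ℝ b.cutoff (M • x) = 0 := by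
  refine b.fderiv_cutoff_eq_zero ?_
  rw [WithLp.smul_fst, WithLp.smul_snd, norm_smul, smul_eq_mul, abs_mul, Real.norm_of_nonneg hM.le,
    abs_of_pos hM]
  exact hx.imp (inv_lt_iff_one_lt_mul₀' hM).1 (inv_lt_iff_one_lt_mul₀' hM).1

theorem norm_a_le {M : ℝ} (hM : 0 ≤ M) (N : ℝ) (x : Coord d) :
    ‖b.a M N x‖ ≤ Real.exp (-(N * x.snd)) := by
  rw [b.a_eq hM, norm_mul, norm_exp_phase, Complex.norm_real,
    Real.norm_of_nonneg (b.cutoff_nonneg _)]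
  exact mul_le_of_le_one_left (Real.exp_pos _).le (b.cutoff_le_one _)

theorem hasCompactSupport_a {M : ℝ} (hM : 0 < M) (N : ℝ) : HasCompactSupport (b.a M N) := by
  refine HasCompactSupport.intro (isCompact_closedBall (0 : Coord d) (2 * M⁻¹)) fun x hx => ?_
  refine b.a_eq_zero hM N ?_
  by_contra! h
  have := BoundaryChart.norm_le_add x
  rw [Real.norm_eq_abs x.snd] at this
  refine hx (mem_closedBall_zero_iff.2 ?_)
  linarith

theorem flatten_param (z : E (d - 1) × ℝ) :
    b.flatten (b.param z) = WithLp.toLp 2 (z.1 - b.p', z.2) := by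
  simp [flatten, BoundaryChart.coord_param]

theorem exists_lipschitzWith_flatten : ∃ L : ℝ≥0, LipschitzWith L b.flatten := by
  obtain ⟨K, hK⟩ := b.lipschitz
  refine ⟨2 + K, LipschitzWith.of_dist_le_mul fun y z => ?_⟩
  rw [dist_eq_norm]
  refine (BoundaryChart.norm_le_add _).trans ?_
  have h1 := BoundaryChart.norm_fst_le (b.coord (y - z))
  have h2 := BoundaryChart.norm_snd_le (b.coord (y - z))
  rw [b.coord.norm_map, map_sub] at h1 h2
  have h3 := hK.dist_le_mul (b.coord y).fst (b.coord z).fst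
  rw [dist_eq_norm, dist_eq_norm] at h3
  rw [dist_eq_norm]
  have e1 : (b.flatten y - b.flatten z).fst = (b.coord y - b.coord z).fst := by
    simp [flatten]
  have e2 : (b.flatten y - b.flatten z).snd =
      (b.coord y - b.coord z).snd - (b.φ (b.coord y).fst - b.φ (b.coord z).fst) := by
    simp [flatten]; ring
  rw [e1, e2]
  have h4 := norm_sub_le (b.coord y - b.coord z).snd (b.φ (b.coord y).fst - b.φ (b.coord z).fst)
  have h5 : ‖(b.coord y).fst - (b.coord z).fst‖ ≤ ‖y - z‖ := h1
  have h6 := mul_le_mul_of_nonneg_left h5 K.coe_nonneg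
  simp only [NNReal.coe_add, NNReal.coe_ofNat]
  linarith

theorem hasFDerivAt_flatten {y : E d} (hy : DifferentiableAt ℝ b.φ (b.proj y)) :
    ∃ L : E d →L[ℝ] Coord d, HasFDerivAt b.flatten L y ∧ ∀ v, L v = WithLp.toLp 2
      ((b.coord v).fst, (b.coord v).snd - inner ℝ (gradient b.φ (b.proj y)) (b.coord v).fst) := by
  let c : E d →L[ℝ] Coord d := b.coord.toContinuousLinearEquiv.toContinuousLinearMap
  let p1 := (WithLp.fstL 2 ℝ (E (d - 1)) ℝ).comp c
  let p2 := (WithLp.sndL 2 ℝ (E (d - 1)) ℝ).comp c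
  have h1 : HasFDerivAt (fun y => (b.coord y).fst - b.p') p1 y := p1.hasFDerivAt.sub_const _
  have h2 : HasFDerivAt (fun y => (b.coord y).snd - b.φ (b.coord y).fst)
      (p2 - (fderiv ℝ b.φ (b.proj y)).comp p1) y :=
    p2.hasFDerivAt.sub (hy.hasFDerivAt.comp y p1.hasFDerivAt)
  have h3 := (WithLp.prodContinuousLinearEquiv 2 ℝ (E (d - 1)) ℝ).symm.toContinuousLinearMap
    |>.hasFDerivAt.comp y (h1.prodMk h2)
  refine ⟨_, h3, fun v => ?_⟩
  have e : inner ℝ (gradient b.φ (b.proj y)) (b.coord v).fst =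
      fderiv ℝ b.φ (b.proj y) (b.coord v).fst := by
    rw [gradient, InnerProductSpace.toDual_symm_apply]
  rw [e]
  rfl

end BrownData

end Calderon

/-! ### Scales, complex frequency, and the leading term of the gradient -/

namespace Calderon

theorem norm_le_card_mul_of_forall {d : ℕ} {x : EuclideanSpace ℂ (Fin d)} {B : ℝ} (hB : 0 ≤ B)
    (h : ∀ i, ‖x i‖ ≤ B) : ‖x‖ ≤ d * B := by
  rw [EuclideanSpace.norm_eq]
  refine Real.sqrt_le_iff.2 ⟨by positivity, ?_⟩
  have h' : ∀ i ∈ Finset.univ, ‖x i‖ ^ 2 ≤ B ^ 2 := fun i _ => by gcongr; exact h i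
  refine (Finset.sum_le_card_nsmul _ _ _ h').trans ?_
  rw [Finset.card_univ, Fintype.card_fin, nsmul_eq_mul, mul_pow]
  have : (d : ℝ) ≤ (d : ℝ) ^ 2 := by exact_mod_cast Nat.le_self_pow two_ne_zero d
  gcongr

namespace BrownData

variable {d : ℕ} {D : Set (E d)} {P : E d} (b : BrownData D P)

/-- The scale `M = N^{1/2}`. -/
noncomputable def scale (N : ℕ) : ℝ := (N : ℝ) ^ (1 / 2 : ℝ)

theorem scale_pos {N : ℕ} (hN : 1 ≤ N) : 0 < scale N :=
  Real.rpow_pos_of_pos (by exact_mod_cast hN) _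

theorem scale_sq (N : ℕ) : scale N ^ 2 = N := by
  rw [scale, ← Real.rpow_natCast, ← Real.rpow_mul (Nat.cast_nonneg N)]
  norm_num

theorem tendsto_scale : Tendsto scale atTop atTop :=
  (tendsto_rpow_atTop (by norm_num)).comp tendsto_natCast_atTop_atTop

/-- The normalising factor `N^{-1/2} M^{(d-1)/2} C_P`. -/
noncomputable def amp (N : ℕ) : ℝ :=
  (N : ℝ) ^ (-(1 / 2) : ℝ) * ((N : ℝ) ^ (1 / 2 : ℝ)) ^ (((d : ℝ) - 1) / 2) * b.C

theorem boundaryFun_eq (N : ℕ) (y : E d) :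
    b.boundaryFun N y = b.amp N * b.a (scale N) N (b.flatten y) := rfl

theorem C_nonneg : 0 ≤ b.C :=
  Real.rpow_nonneg (mul_nonneg (by positivity) (integral_nonneg fun _ => by positivity)) _

theorem amp_nonneg (N : ℕ) : 0 ≤ b.amp N :=
  mul_nonneg (by positivity) b.C_nonneg

/-- The only way the amplitude enters the estimates: `amp² N` balances the measure `M^{-(d-1)}` of a
disc of radius `1/M`. -/
theorem amp_sq_mul (hd : 2 ≤ d) {N : ℕ} (hN : 1 ≤ N) :
    b.amp N ^ 2 * N = scale N ^ (d - 1) * b.C ^ 2 := by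
  have hN0 : (0 : ℝ) < N := by exact_mod_cast hN
  have h1 : ((N : ℝ) ^ (-(1 / 2) : ℝ)) ^ 2 * N = 1 := by
    rw [← Real.rpow_natCast, ← Real.rpow_mul hN0.le]
    norm_num [Real.rpow_neg_one, hN0.ne']
  have h2 : ((scale N) ^ (((d : ℝ) - 1) / 2)) ^ 2 = scale N ^ (d - 1) := by
    rw [← Real.rpow_natCast, ← Real.rpow_mul (scale_pos hN).le, ← Real.rpow_natCast,
      Nat.cast_sub (by omega : 1 ≤ d)]
    congr 1
    push_cast
    ring
  have h3 : b.amp N = (N : ℝ) ^ (-(1 / 2) : ℝ) * (scale N) ^ (((d : ℝ) - 1) / 2) * b.C := rfl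
  rw [h3, mul_pow, mul_pow, h2]
  linear_combination (scale N ^ (d - 1) * b.C ^ 2) * h1

/-- The gradient `∇φ(p')`. -/
noncomputable def slope : E (d - 1) := gradient b.φ b.p'

/-- The deviation `|∇φ(x) - ∇φ(p')|`. -/
noncomputable def dev (x : E (d - 1)) : ℝ := ‖gradient b.φ x - b.slope‖

/-- The linearised flattening. -/
noncomputable def lin (v : E d) : Coord d :=
  WithLp.toLp 2 ((b.coord v).fst, (b.coord v).snd - inner ℝ b.slope (b.coord v).fst)

/-- The real part of the frequency, in the original coordinates. -/
noncomputable def reFreq : E d := b.coord.symm (WithLp.toLp 2 (b.slope, -1))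

/-- The imaginary part of the frequency, in the original coordinates. -/
noncomputable def imFreq : E d :=
  b.coord.symm (WithLp.toLp 2 (b.ξ.fst - b.ξ.snd • b.slope, b.ξ.snd))

/-- The complex frequency `Bᵗ (iξ - e_d)` in the original coordinates. -/
noncomputable def freq : EuclideanSpace ℂ (Fin d) :=
  WithLp.toLp 2 fun i => (b.reFreq i : ℂ) + Complex.I * (b.imFreq i : ℂ)

theorem inner_coord_symm (c : E d ≃ₗᵢ[ℝ] Coord d) (x : Coord d) (v : E d) :
    inner ℝ (c.symm x) v = inner ℝ x.fst (c v).fst + x.snd * (c v).snd := by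
  have h := c.inner_map_map (c.symm x) v
  rw [c.apply_symm_apply, WithLp.prod_inner_apply] at h
  rw [← h]
  simp only [WithLp.ofLp_fst, WithLp.ofLp_snd, RCLike.inner_apply, conj_trivial]
  ring

theorem phase_lin (v : E d) : b.phase (b.lin v) =
    (inner ℝ b.reFreq v : ℝ) + Complex.I * (inner ℝ b.imFreq v : ℝ) := by
  have h1 : inner ℝ b.ξ (b.lin v) = inner ℝ b.imFreq v := by
    rw [imFreq, inner_coord_symm, WithLp.prod_inner_apply]
    simp [lin, inner_sub_left, real_inner_smul_left]
    ring
  have h2 : inner ℝ b.reFreq v = -(b.lin v).snd := by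
    rw [reFreq, inner_coord_symm]
    simp [lin]
    ring
  rw [phase_apply, h1, h2]
  push_cast
  ring

theorem norm_sq_reFreq : ‖b.reFreq‖ ^ 2 = ‖b.slope‖ ^ 2 + 1 := by
  rw [reFreq, LinearIsometryEquiv.norm_map, WithLp.prod_norm_sq_eq_of_L2]
  simp

theorem norm_sq_imFreq : ‖b.imFreq‖ ^ 2 = ‖b.slope‖ ^ 2 + 1 := by
  rw [imFreq, LinearIsometryEquiv.norm_map, WithLp.prod_norm_sq_eq_of_L2]
  have := b.ξ_norm
  simpa [slope, p'] using this

theorem inner_reFreq_imFreq : inner ℝ b.reFreq b.imFreq = 0 := by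
  rw [reFreq, inner_coord_symm]
  have := b.ξ_orth
  simp only [imFreq, LinearIsometryEquiv.apply_symm_apply]
  rw [real_inner_comm]
  rw [inner_neg_right] at this
  change inner ℝ (b.ξ.fst - b.ξ.snd • gradient b.φ (b.coord P).fst)
    (gradient b.φ (b.coord P).fst) + -1 * b.ξ.snd = 0
  linarith

/-- This is `freq · freq = 0`. The two conditions on `ξ` say precisely that the real and imaginary
parts of the frequency have the same length and are orthogonal. -/
theorem phase_lin_freq :
    b.phase (b.lin b.reFreq) + Complex.I * b.phase (b.lin b.imFreq) = 0 := by
  rw [phase_lin, phase_lin, inner_reFreq_imFreq, real_inner_comm b.reFreq b.imFreq, inner_reFreq_imFreq,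
    real_inner_self_eq_norm_sq, real_inner_self_eq_norm_sq, norm_sq_reFreq, norm_sq_imFreq]
  push_cast
  linear_combination ((‖b.slope‖ : ℂ) ^ 2 + 1) * Complex.I_mul_I

theorem norm_sq_freq : ‖b.freq‖ ^ 2 = 2 * (1 + ‖b.slope‖ ^ 2) := by
  have h : ∀ i, ‖b.freq i‖ ^ 2 = b.reFreq i ^ 2 + b.imFreq i ^ 2 := fun i => by
    rw [← Complex.normSq_eq_norm_sq]
    simp [freq, Complex.normSq_apply]
    ring
  have h1 := b.norm_sq_reFreq
  have h2 := b.norm_sq_imFreq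
  rw [EuclideanSpace.norm_sq_eq] at h1 h2 ⊢
  simp only [h, Finset.sum_add_distrib]
  simp only [Real.norm_eq_abs, sq_abs] at h1 h2
  linarith

theorem freq_apply (i : Fin d) :
    b.freq i = b.phase (b.lin (EuclideanSpace.single i 1)) := by
  rw [phase_lin]
  simp [freq, EuclideanSpace.inner_single_right]

theorem sum_freq_mul_cgrad (w : E d → ℂ) (y : E d) :
    ∑ i, b.freq i * cgrad w y i =
      fderiv ℝ w y b.reFreq + Complex.I * fderiv ℝ w y b.imFreq := by
  rw [fderiv_eq_sum_cgrad, fderiv_eq_sum_cgrad, Finset.mul_sum, ← Finset.sum_add_distrib]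
  refine Finset.sum_congr rfl fun i _ => ?_
  simp [freq]
  ring

theorem fderiv_boundaryFun {N : ℕ} (hN : 1 ≤ N) {y : E d}
    (hy : DifferentiableAt ℝ b.φ (b.proj y)) (v : E d) :
    fderiv ℝ (b.boundaryFun N) y v =
      b.amp N * fderiv ℝ (b.a (scale N) N) (b.flatten y) (WithLp.toLp 2 ((b.coord v).fst,
        (b.coord v).snd - inner ℝ (gradient b.φ (b.proj y)) (b.coord v).fst)) := by
  obtain ⟨L, hL, hLv⟩ := b.hasFDerivAt_flatten hy
  have h1 := ((b.contDiff_a (scale_pos hN).le N).differentiable (by simp)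
    (b.flatten y)).hasFDerivAt.comp y hL
  have h2 := (h1.const_mul (b.amp N : ℂ)).congr_of_eventuallyEq
    (Eventually.of_forall (b.boundaryFun_eq N))
  rw [h2.fderiv]
  simp [hLv]

/-- The difference between the gradient of Brown's function and its leading term. -/
theorem fderiv_boundaryFun_sub {N : ℕ} (hN : 1 ≤ N) {z : E (d - 1) × ℝ}
    (hz : DifferentiableAt ℝ b.φ z.1) (v : E d) :
    fderiv ℝ (b.boundaryFun N) (b.param z) v
      - b.amp N * N * b.a (scale N) N (b.flatten (b.param z)) * b.phase (b.lin v) =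
      b.amp N * (b.a (scale N) N (b.flatten (b.param z)) * (N *
          (inner ℝ (gradient b.φ z.1 - b.slope) (b.coord v).fst * (1 - Complex.I * b.ξ.snd))) +
        Complex.exp (N * b.phase (b.flatten (b.param z))) *
          (scale N * fderiv ℝ b.cutoff (scale N • b.flatten (b.param z))
            (WithLp.toLp 2 ((b.coord v).fst,
              (b.coord v).snd - inner ℝ (gradient b.φ z.1) (b.coord v).fst)) : ℝ)) := by
  rw [b.fderiv_boundaryFun hN (by rwa [BoundaryChart.proj_param]), BoundaryChart.proj_param,
    b.fderiv_a_apply (scale_pos hN).le]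
  -- Using the true gradient of `φ` in place of the frozen slope changes only the last component, by
  -- the pairing of `∇φ - slope` with the horizontal part of `v`.
  have e : b.phase (WithLp.toLp 2 ((b.coord v).fst,
      (b.coord v).snd - inner ℝ (gradient b.φ z.1) (b.coord v).fst)) = b.phase (b.lin v) +
      inner ℝ (gradient b.φ z.1 - b.slope) (b.coord v).fst * (1 - Complex.I * b.ξ.snd) := by
    rw [phase_apply, phase_apply, WithLp.prod_inner_apply, WithLp.prod_inner_apply]
    simp [lin, inner_sub_left]
    ring
  rw [e]
  push_cast
  ring

end BrownData

end Calderon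

/-! ### One weight that controls all error terms -/

namespace Calderon

namespace BrownData

variable {d : ℕ} {D : Set (E d)} {P : E d} (b : BrownData D P)

/-- Two errors are added: the exponential differentiated with the wrong slope costs `N · dev`, and
differentiating the cut-off costs `M`. -/
theorem norm_fderiv_boundaryFun_sub_le {K : ℝ≥0} (hK : LipschitzWith K b.φ) {C₁ : ℝ}
    (hC₁ : ∀ x, ‖fderiv ℝ b.cutoff x‖ ≤ C₁) {N : ℕ} (hN : 1 ≤ N) {z : E (d - 1) × ℝ}
    (hz : DifferentiableAt ℝ b.φ z.1) {v : E d} (hv : ‖v‖ = 1) :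
    ‖fderiv ℝ (b.boundaryFun N) (b.param z) v
      - b.amp N * N * b.a (scale N) N (b.flatten (b.param z)) * b.phase (b.lin v)‖ ≤
      (1 + |b.ξ.snd| + C₁ * (2 + K)) *
        (b.amp N * (N * b.dev z.1 + scale N) * Real.exp (-(N * z.2))) := by
  have hM := (scale_pos hN).le
  have hC0 : 0 ≤ C₁ := (norm_nonneg _).trans (hC₁ 0)
  have hdev : 0 ≤ b.dev z.1 := norm_nonneg _
  have hA := b.amp_nonneg N
  have h1 := BoundaryChart.norm_fst_le (b.coord v)
  have h2 := BoundaryChart.norm_snd_le (b.coord v)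
  rw [b.coord.norm_map, hv] at h1 h2
  rw [b.fderiv_boundaryFun_sub hN hz, norm_mul, Complex.norm_real, Real.norm_of_nonneg hA]
  have e1 : ‖b.a (scale N) N (b.flatten (b.param z))‖ ≤ Real.exp (-(N * z.2)) := by
    simpa [b.flatten_param] using b.norm_a_le hM N (b.flatten (b.param z))
  have e2 : ‖Complex.exp (N * b.phase (b.flatten (b.param z)))‖ = Real.exp (-(N * z.2)) := by
    simpa [b.flatten_param] using b.norm_exp_phase N (b.flatten (b.param z))
  have e3 : ‖((inner ℝ (gradient b.φ z.1 - b.slope) (b.coord v).fst : ℝ) : ℂ)‖ ≤ b.dev z.1 := by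
    rw [Complex.norm_real]
    refine (norm_inner_le_norm _ _).trans ?_
    exact mul_le_of_le_one_right hdev h1
  have e4 : ‖(1 : ℂ) - Complex.I * b.ξ.snd‖ ≤ 1 + |b.ξ.snd| := by
    refine (norm_sub_le _ _).trans ?_
    simp
  have e5 : ‖fderiv ℝ b.cutoff (scale N • b.flatten (b.param z))
      (WithLp.toLp 2 ((b.coord v).fst,
        (b.coord v).snd - inner ℝ (gradient b.φ z.1) (b.coord v).fst))‖ ≤ C₁ * (2 + K) := by
    refine (ContinuousLinearMap.le_opNorm _ _).trans ?_
    refine mul_le_mul (hC₁ _) ((BoundaryChart.norm_le_add _).trans ?_) (norm_nonneg _) hC0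
    have e6 : ‖inner ℝ (gradient b.φ z.1) (b.coord v).fst‖ ≤ K :=
      (norm_inner_le_norm _ _).trans ((mul_le_of_le_one_right (norm_nonneg _) h1).trans
        (norm_gradient_le hK _))
    have e7 := norm_sub_le (b.coord v).snd (inner ℝ (gradient b.φ z.1) (b.coord v).fst)
    change ‖(b.coord v).fst‖ + ‖(b.coord v).snd - inner ℝ (gradient b.φ z.1) (b.coord v).fst‖ ≤ _
    linarith
  set X := Real.exp (-(N * z.2)) with hX
  have hX0 : 0 ≤ X := (Real.exp_pos _).le
  have hNn : (0 : ℝ) ≤ N := Nat.cast_nonneg N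
  calc _ ≤ b.amp N * (X * (N * (b.dev z.1 * (1 + |b.ξ.snd|))) +
        X * (scale N * (C₁ * (2 + K)))) := by
        refine mul_le_mul_of_nonneg_left ((norm_add_le _ _).trans (add_le_add ?_ ?_)) hA
        · rw [norm_mul, norm_mul, norm_mul, Complex.norm_natCast]
          gcongr
        · rw [norm_mul, e2, Complex.norm_real, norm_mul, Real.norm_of_nonneg hM]
          gcongr
    _ = (b.amp N * X) * (N * b.dev z.1 * (1 + |b.ξ.snd|) + scale N * (C₁ * (2 + K))) := by ring
    _ ≤ (b.amp N * X) * ((1 + |b.ξ.snd| + C₁ * (2 + K)) * (N * b.dev z.1 + scale N)) := by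
        refine mul_le_mul_of_nonneg_left ?_ (mul_nonneg hA hX0)
        have p1 : 0 ≤ N * b.dev z.1 * (C₁ * (2 + K)) := by positivity
        have p2 : 0 ≤ scale N * (1 + |b.ξ.snd|) := by positivity
        linarith
    _ = _ := by ring

theorem cgrad_boundaryFun_eq_zero {N : ℕ} (hN : 1 ≤ N) {z : E (d - 1) × ℝ}
    (hz : DifferentiableAt ℝ b.φ z.1)
    (h : (scale N)⁻¹ < ‖z.1 - b.p'‖ ∨ (scale N)⁻¹ < |z.2|) :
    cgrad (b.boundaryFun N) (b.param z) = 0 := by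
  have hM := scale_pos hN
  ext i
  have h' : (scale N)⁻¹ < ‖(b.flatten (b.param z)).fst‖ ∨
      (scale N)⁻¹ < |(b.flatten (b.param z)).snd| := by
    rw [b.flatten_param]; exact h
  simp only [cgrad]
  rw [b.fderiv_boundaryFun hN (by rwa [BoundaryChart.proj_param]), b.fderiv_a_apply hM.le,
    b.a_eq_zero hM N (h'.imp le_of_lt le_of_lt), b.fderiv_cutoff_smul_eq_zero hM h']
  simp

/-- The part of the cylinder of size `1/M` that lies over the boundary. -/
def cyl (N : ℕ) : Set (E (d - 1) × ℝ) :=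
  Metric.closedBall b.p' (scale N)⁻¹ ×ˢ Set.Ioc 0 (scale N)⁻¹

theorem measurableSet_cyl (N : ℕ) : MeasurableSet (b.cyl N) :=
  Metric.isClosed_closedBall.measurableSet.prod measurableSet_Ioc

/-- The weight that controls all error terms. -/
noncomputable def weight (N : ℕ) (z : E (d - 1) × ℝ) : ℝ :=
  b.amp N * (N * b.dev z.1 + scale N) * Real.exp (-(N * z.2))

theorem dev_nonneg (x : E (d - 1)) : 0 ≤ b.dev x := norm_nonneg _

theorem weight_nonneg {N : ℕ} (z : E (d - 1) × ℝ) : 0 ≤ b.weight N z := by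
  have h1 := b.amp_nonneg N
  have h2 := b.dev_nonneg z.1
  have h3 : 0 ≤ scale N := Real.rpow_nonneg (Nat.cast_nonneg N) _
  exact mul_nonneg (mul_nonneg h1 (by positivity)) (Real.exp_pos _).le

theorem measurable_dev : Measurable b.dev :=
  ((measurable_gradient b.φ).sub_const _).norm

theorem measurable_weight (N : ℕ) : Measurable (b.weight N) := by
  have := b.measurable_dev
  unfold weight
  fun_prop

/-- The mean-square deviation of the slope at scale `1/M`, plus a small term. -/
noncomputable def err (N : ℕ) : ℝ :=
  scale N ^ (d - 1) * (∫ x in Metric.closedBall b.p' (scale N)⁻¹, b.dev x ^ 2) +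
    volume.real (Metric.ball (0 : E (d - 1)) 1) / N

theorem err_nonneg (N : ℕ) : 0 ≤ b.err N := by
  have h3 : 0 ≤ scale N := Real.rpow_nonneg (Nat.cast_nonneg N) _
  exact add_nonneg (mul_nonneg (by positivity) (integral_nonneg fun _ => by positivity))
    (by positivity)

/-- The Lebesgue-point condition at radius `r = 1/M`, for which `r^{-(d-1)} = M^{d-1}`. -/
theorem tendsto_err : Tendsto b.err atTop (𝓝 0) := by
  have h1 : Tendsto (fun N => (scale N)⁻¹) atTop (𝓝[>] 0) :=
    tendsto_inv_atTop_nhdsGT_zero.comp tendsto_scale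
  have h2 := (b.lebesgue.comp h1).add
    ((tendsto_const_nhds (x := volume.real (Metric.ball (0 : E (d - 1)) 1))).div_atTop
      (tendsto_natCast_atTop_atTop (R := ℝ)))
  rw [add_zero] at h2
  refine h2.congr fun N => ?_
  simp only [Function.comp_apply, inv_pow, inv_inv]
  rw [err, ← setIntegral_closedBall_zero_add (fun x => b.dev x ^ 2)]
  rfl

theorem integrableOn_dev_sq {r : ℝ} :
    IntegrableOn (fun x => b.dev x ^ 2) (Metric.closedBall b.p' r) := by
  obtain ⟨K, hK⟩ := b.lipschitz
  refine Measure.integrableOn_of_bounded (M := (2 * K) ^ 2)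
    (isCompact_closedBall _ _).measure_lt_top.ne (b.measurable_dev.pow_const 2).aestronglyMeasurable
    (ae_of_all _ fun x => ?_)
  rw [norm_pow, Real.norm_of_nonneg (b.dev_nonneg x)]
  have h3 : b.dev x ≤ 2 * K := by
    have := norm_sub_le (gradient b.φ x) b.slope
    have h1 := norm_gradient_le hK x
    have h2 : ‖b.slope‖ ≤ K := norm_gradient_le hK _
    rw [dev]; linarith
  have := b.dev_nonneg x
  gcongr

theorem lintegral_exp_Ioi {c : ℝ} (hc : 0 < c) :
    ∫⁻ t in Set.Ioi (0 : ℝ), ENNReal.ofReal (Real.exp (-(c * t))) = ENNReal.ofReal c⁻¹ := by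
  have h1 : IntegrableOn (fun t : ℝ => Real.exp (-(c * t))) (Set.Ioi 0) := by
    simpa [neg_mul] using exp_neg_integrableOn_Ioi 0 hc
  rw [← ofReal_integral_eq_lintegral_ofReal h1 (ae_of_all _ fun _ => (Real.exp_pos _).le)]
  congr 1
  have h2 := integral_exp_mul_Ioi (a := -c) (by linarith) 0
  simp only [neg_mul, mul_zero, Real.exp_zero] at h2
  rw [h2]
  field_simp

/-- The normal integral of `exp(-2Nt)` contributes at most `1/(2N)`. Together with `amp² N = M^{d-1}
C²`, this turns `N² dev²` into the scaled mean square of the slope and the cut-off term `M² = N`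
into the volume of the unit ball divided by `N`. -/
theorem lintegral_weight_sq_le (hd : 2 ≤ d) {N : ℕ} (hN : 1 ≤ N) :
    ∫⁻ z in b.cyl N, ENNReal.ofReal (b.weight N z) ^ 2 ∂(volume.prod volume) ≤
      ENNReal.ofReal (b.C ^ 2 * b.err N) := by
  have hN0 : (0 : ℝ) < N := by exact_mod_cast hN
  have hM := scale_pos hN
  have hMsq := scale_sq N
  have hamp := b.amp_sq_mul hd hN
  have hpt : ∀ z : E (d - 1) × ℝ, ENNReal.ofReal (b.weight N z) ^ 2 ≤
      ENNReal.ofReal (b.amp N ^ 2 * (2 * (N ^ 2 * b.dev z.1 ^ 2 + N))) *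
        ENNReal.ofReal (Real.exp (-(2 * N * z.2))) := fun z => by
    rw [← ENNReal.ofReal_pow (b.weight_nonneg z), ← ENNReal.ofReal_mul (by positivity)]
    refine ENNReal.ofReal_le_ofReal ?_
    have e1 : Real.exp (-(2 * N * z.2)) = Real.exp (-(N * z.2)) ^ 2 := by
      rw [← Real.exp_nat_mul]; congr 1; push_cast; ring
    rw [weight, mul_pow, mul_pow, e1]
    gcongr
    nlinarith [sq_nonneg (N * b.dev z.1 - scale N)]
  have hm1 : Measurable fun x => ENNReal.ofReal (b.amp N ^ 2 * (2 * (N ^ 2 * b.dev x ^ 2 + N))) := by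
    have := b.measurable_dev
    fun_prop
  have hm2 : Measurable fun t : ℝ => ENNReal.ofReal (Real.exp (-(2 * N * t))) := by fun_prop
  calc _ ≤ ∫⁻ z in b.cyl N, ENNReal.ofReal (b.amp N ^ 2 * (2 * (N ^ 2 * b.dev z.1 ^ 2 + N))) *
        ENNReal.ofReal (Real.exp (-(2 * N * z.2))) ∂(volume.prod volume) :=
        lintegral_mono hpt
    _ = (∫⁻ x in Metric.closedBall b.p' (scale N)⁻¹,
          ENNReal.ofReal (b.amp N ^ 2 * (2 * (N ^ 2 * b.dev x ^ 2 + N)))) *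
        ∫⁻ t in Set.Ioc 0 (scale N)⁻¹, ENNReal.ofReal (Real.exp (-(2 * N * t))) := by
        rw [cyl, ← Measure.prod_restrict, lintegral_prod_mul hm1.aemeasurable hm2.aemeasurable]
    _ ≤ (∫⁻ x in Metric.closedBall b.p' (scale N)⁻¹,
          ENNReal.ofReal (b.amp N ^ 2 * (2 * (N ^ 2 * b.dev x ^ 2 + N)))) *
        ENNReal.ofReal (2 * N : ℝ)⁻¹ := by
        refine mul_le_mul_right ?_ _
        rw [← lintegral_exp_Ioi (by positivity : (0 : ℝ) < 2 * N)]
        exact lintegral_mono_set Set.Ioc_subset_Ioi_self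
    _ = ENNReal.ofReal ((∫ x in Metric.closedBall b.p' (scale N)⁻¹,
          b.amp N ^ 2 * (2 * (N ^ 2 * b.dev x ^ 2 + N))) * (2 * N : ℝ)⁻¹) := by
        have hint : IntegrableOn (fun x => b.amp N ^ 2 * (2 * (N ^ 2 * b.dev x ^ 2 + N)))
            (Metric.closedBall b.p' (scale N)⁻¹) := by
          refine ((((b.integrableOn_dev_sq).const_mul _).add ?_).const_mul 2).const_mul _
          exact integrableOn_const (isCompact_closedBall _ _).measure_lt_top.ne
        rw [ENNReal.ofReal_mul (integral_nonneg fun _ => by positivity),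
          ofReal_integral_eq_lintegral_ofReal hint (ae_of_all _ fun _ => by positivity)]
    _ ≤ _ := by
        refine ENNReal.ofReal_le_ofReal (le_of_eq ?_)
        rw [integral_const_mul, integral_const_mul, integral_add
          ((b.integrableOn_dev_sq).const_mul _)
          (integrableOn_const (isCompact_closedBall _ _).measure_lt_top.ne), integral_const_mul,
          setIntegral_const, Measure.addHaar_real_closedBall _ _ (inv_pos.2 hM).le, err]
        simp only [finrank_euclideanSpace, Fintype.card_fin, smul_eq_mul, inv_pow]
        have hA : b.amp N ^ 2 = scale N ^ (d - 1) * b.C ^ 2 / N := by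
          rw [← hamp]; field_simp
        have hS : scale N ^ (d - 1) ≠ 0 := (pow_pos hM _).ne'
        rw [hA]
        generalize scale N ^ (d - 1) = S at hS
        field_simp

end BrownData

end Calderon

/-! ### Approximation of the gradient near `P` -/

namespace Calderon

namespace BrownData

variable {d : ℕ} {D : Set (E d)} {P : E d} (b : BrownData D P)

/-- The scalar factor of the leading term of the gradient of Brown's function. -/
noncomputable def lead (N : ℕ) (y : E d) : ℂ :=
  b.amp N * N * b.a (scale N) N (b.flatten y)

theorem param_p' (hP : P ∈ frontier D) : b.param (b.p', 0) = P :=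
  b.graph_proj_of_mem (Metric.mem_ball_self b.ρ_pos) hP

/-- The parametrisation is global and Lipschitz, so the support of the cut-off shrinks to `P`. From
some `N` on it lies in the ball where the chart describes `D`, and no other part of `D` is met. -/
theorem eventually_param_mem_ball (hP : P ∈ frontier D) :
    ∀ᶠ N : ℕ in atTop, 1 ≤ N ∧ ∀ z : E (d - 1) × ℝ, ‖z.1 - b.p'‖ ≤ (scale N)⁻¹ →
      |z.2| ≤ (scale N)⁻¹ → b.param z ∈ Metric.ball P b.ρ := by
  obtain ⟨K, hK⟩ := b.lipschitz
  have h1 : Tendsto (fun N => (2 + (K : ℝ)) * (scale N)⁻¹) atTop (𝓝 0) := by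
    simpa using (tendsto_inv_atTop_zero.comp tendsto_scale).const_mul (2 + (K : ℝ))
  filter_upwards [eventually_ge_atTop 1, h1.eventually (gt_mem_nhds b.ρ_pos)] with N hN hN2
  refine ⟨hN, fun z h2 h3 => ?_⟩
  have h4 := b.dist_param_le hK z (b.p', 0)
  rw [b.param_p' hP, dist_eq_norm, Real.dist_eq, sub_zero] at h4
  have h5 : (1 + (K : ℝ)) * ‖z.1 - b.p'‖ ≤ (1 + K) * (scale N)⁻¹ := by gcongr
  rw [dist_eq_norm] at h4
  rw [mem_ball_iff_norm]
  linarith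

theorem lead_param_eq_zero {N : ℕ} (hN : 1 ≤ N) {z : E (d - 1) × ℝ}
    (h : (scale N)⁻¹ < ‖z.1 - b.p'‖ ∨ (scale N)⁻¹ < |z.2|) : b.lead N (b.param z) = 0 := by
  have h' : (scale N)⁻¹ ≤ ‖(b.flatten (b.param z)).fst‖ ∨
      (scale N)⁻¹ ≤ |(b.flatten (b.param z)).snd| := by
    rw [b.flatten_param]; exact h.imp le_of_lt le_of_lt
  rw [lead, b.a_eq_zero (scale_pos hN) N h', mul_zero]

theorem norm_lead_param_le {N : ℕ} (hN : 1 ≤ N) (z : E (d - 1) × ℝ) :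
    ‖b.lead N (b.param z)‖ ≤ b.amp N * N * Real.exp (-(N * z.2)) := by
  have e1 : ‖b.a (scale N) N (b.flatten (b.param z))‖ ≤ Real.exp (-(N * z.2)) := by
    simpa [b.flatten_param] using b.norm_a_le (scale_pos hN).le N (b.flatten (b.param z))
  rw [lead, norm_mul, norm_mul, Complex.norm_real, Complex.norm_natCast,
    Real.norm_of_nonneg (b.amp_nonneg N)]
  have := b.amp_nonneg N
  gcongr

theorem mem_cyl_iff {N : ℕ} {z : E (d - 1) × ℝ} :
    z ∈ b.cyl N ↔ ‖z.1 - b.p'‖ ≤ (scale N)⁻¹ ∧ 0 < z.2 ∧ z.2 ≤ (scale N)⁻¹ := by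
  rw [cyl, Set.mem_prod, mem_closedBall_iff_norm, Set.mem_Ioc]

/-- The factor `ρ` is left free because the lemma serves twice: with `ρ = γ` for the residual and
with `ρ = √γ` for the energy. Freezing `ρ` at `P` costs `O(1/M)` times the leading term, which the
weight absorbs. -/
theorem exists_norm_grad_sub_le (hP : P ∈ frontier D) {ρ : E d → ℝ} {Lρ Bρ : ℝ}
    (hL : ∀ y ∈ D, |ρ y - ρ P| ≤ Lρ * dist y P) (hB : ∀ y ∈ D, |ρ y| ≤ Bρ) (hL0 : 0 ≤ Lρ)
    (hB0 : 0 ≤ Bρ) :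
    ∃ A : ℝ, 0 ≤ A ∧ ∀ᶠ N : ℕ in atTop, ∀ᵐ z ∂((volume : Measure (E (d - 1))).prod
      (volume : Measure ℝ)), b.param z ∈ D →
      ‖(ρ (b.param z) : ℂ) • cgrad (b.boundaryFun N) (b.param z)
        - ((ρ P : ℂ) * b.lead N (b.param z)) • b.freq‖ ≤
        (b.cyl N).indicator (fun z => A * b.weight N z) z := by
  obtain ⟨K, hK⟩ := b.lipschitz
  obtain ⟨C₁, hC0, hC₁⟩ := b.exists_norm_fderiv_cutoff_le
  set A₀ := d * (1 + |b.ξ.snd| + C₁ * (2 + K)) with hA₀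
  have hA₀0 : 0 ≤ A₀ := by positivity
  refine ⟨Bρ * A₀ + Lρ * (2 + K) * ‖b.freq‖, by positivity, ?_⟩
  filter_upwards [b.eventually_param_mem_ball hP] with N ⟨hN, hball⟩
  have hMpos := scale_pos hN
  filter_upwards [Measure.quasiMeasurePreserving_fst.ae hK.ae_differentiableAt] with z hz hzD
  by_cases hbox : (scale N)⁻¹ < ‖z.1 - b.p'‖ ∨ (scale N)⁻¹ < |z.2|
  · rw [b.cgrad_boundaryFun_eq_zero hN hz hbox, b.lead_param_eq_zero hN hbox]
    simp only [smul_zero, mul_zero, zero_smul, sub_zero, norm_zero]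
    exact Set.indicator_nonneg (fun z _ => mul_nonneg (by positivity) (b.weight_nonneg z)) z
  · push Not at hbox
    have hpos : 0 < z.2 := (b.param_mem_iff (hball z hbox.1 hbox.2)).1 hzD
    have hzc : z ∈ b.cyl N := b.mem_cyl_iff.2 ⟨hbox.1, hpos, (le_abs_self _).trans hbox.2⟩
    rw [Set.indicator_of_mem hzc]
    have hw := b.weight_nonneg (N := N) z
    have e1 : ‖cgrad (b.boundaryFun N) (b.param z) - b.lead N (b.param z) • b.freq‖ ≤
        A₀ * b.weight N z := by
      rw [hA₀, mul_assoc]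
      refine norm_le_card_mul_of_forall (by positivity) fun i => ?_
      have := b.norm_fderiv_boundaryFun_sub_le hK hC₁ hN hz
        (v := EuclideanSpace.single i (1 : ℝ)) (by simp)
      rw [← b.freq_apply] at this
      exact this
    have e2 : |ρ (b.param z) - ρ P| ≤ Lρ * ((2 + K) * (scale N)⁻¹) := by
      refine (hL _ hzD).trans (mul_le_mul_of_nonneg_left ?_ hL0)
      have h4 := b.dist_param_le hK z (b.p', 0)
      rw [b.param_p' hP, Real.dist_eq, sub_zero, dist_eq_norm z.1] at h4
      have h5 : (1 + (K : ℝ)) * ‖z.1 - b.p'‖ ≤ (1 + K) * (scale N)⁻¹ := by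
        gcongr; exact hbox.1
      linarith [hbox.2]
    -- Since `N = M²`, a leading term of size `amp N` divided by `M` has size `amp M`, the second
    -- summand of the weight.
    have e3 : (scale N)⁻¹ * ‖b.lead N (b.param z)‖ ≤ b.weight N z := by
      have h1 := b.norm_lead_param_le hN z
      have h2 := b.dev_nonneg z.1
      have h3 := b.amp_nonneg N
      calc _ ≤ (scale N)⁻¹ * (b.amp N * N * Real.exp (-(N * z.2))) := by gcongr
        _ = b.amp N * (0 + scale N) * Real.exp (-(N * z.2)) := by
          rw [← scale_sq]; field_simp; ring
        _ ≤ _ := by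
          rw [weight]; gcongr; positivity
    have e4 : (ρ (b.param z) : ℂ) • cgrad (b.boundaryFun N) (b.param z)
        - ((ρ P : ℂ) * b.lead N (b.param z)) • b.freq =
        (ρ (b.param z) : ℂ) • (cgrad (b.boundaryFun N) (b.param z)
          - b.lead N (b.param z) • b.freq) +
        (((ρ (b.param z) - ρ P : ℝ) : ℂ) * b.lead N (b.param z)) • b.freq := by
      push_cast
      rw [smul_sub, sub_mul, sub_smul, smul_smul]
      abel
    rw [e4]
    refine (norm_add_le _ _).trans ?_
    rw [norm_smul, norm_smul, norm_mul, Complex.norm_real, Complex.norm_real, Real.norm_eq_abs,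
      Real.norm_eq_abs]
    calc _ ≤ Bρ * (A₀ * b.weight N z) + Lρ * ((2 + K) * (scale N)⁻¹) *
          ‖b.lead N (b.param z)‖ * ‖b.freq‖ := by
          gcongr
          exact hB _ hzD
      _ = Bρ * A₀ * b.weight N z + Lρ * (2 + K) * ‖b.freq‖ *
          ((scale N)⁻¹ * ‖b.lead N (b.param z)‖) := by ring
      _ ≤ Bρ * A₀ * b.weight N z + Lρ * (2 + K) * ‖b.freq‖ * b.weight N z := by gcongr
      _ = _ := by ring

theorem lintegral_eq_param (F : E d → ℝ≥0∞) : ∫⁻ y in D, F y =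
    ∫⁻ z in b.param ⁻¹' D, F (b.param z) ∂(volume.prod volume) :=
  (b.measurePreserving_param.setLIntegral_comp_preimage_emb b.measurableEmbedding_param F D).symm

/-- The `L²` form of the approximation of the gradient. -/
theorem exists_eLpNorm_grad_sub_le (hd : 2 ≤ d) (hD_open : IsOpen D)
    (hP : P ∈ frontier D) {ρ : E d → ℝ} {Lρ Bρ : ℝ}
    (hL : ∀ y ∈ D, |ρ y - ρ P| ≤ Lρ * dist y P) (hB : ∀ y ∈ D, |ρ y| ≤ Bρ) (hL0 : 0 ≤ Lρ)
    (hB0 : 0 ≤ Bρ) :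
    ∃ A : ℝ, 0 ≤ A ∧ ∀ᶠ N : ℕ in atTop,
      eLpNorm (fun y => (ρ y : ℂ) • cgrad (b.boundaryFun N) y
        - ((ρ P : ℂ) * b.lead N y) • b.freq) 2 (volume.restrict D) ≤
        ENNReal.ofReal (A * √(b.err N)) := by
  obtain ⟨A, hA, H⟩ := b.exists_norm_grad_sub_le hP hL hB hL0 hB0
  refine ⟨A * b.C, mul_nonneg hA b.C_nonneg, ?_⟩
  filter_upwards [H, eventually_ge_atTop 1] with N hN hN1
  rw [← ENNReal.pow_le_pow_left_iff two_ne_zero, eLpNorm_two_sq, b.lintegral_eq_param,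
    ← ENNReal.ofReal_pow (mul_nonneg (mul_nonneg hA b.C_nonneg) (Real.sqrt_nonneg _)),
    mul_pow, Real.sq_sqrt (b.err_nonneg N)]
  have hmD : MeasurableSet (b.param ⁻¹' D) := (hD_open.preimage b.continuous_param).measurableSet
  calc _ ≤ ∫⁻ z in b.param ⁻¹' D, (b.cyl N).indicator
        (fun z => ENNReal.ofReal A ^ 2 * ENNReal.ofReal (b.weight N z) ^ 2) z
          ∂(volume.prod volume) := by
        refine lintegral_mono_ae ((ae_restrict_iff' hmD).2 ?_)
        filter_upwards [hN] with z hz hzD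
        have h1 := hz hzD
        rw [← ofReal_norm]
        by_cases hc : z ∈ b.cyl N
        · rw [Set.indicator_of_mem hc] at h1 ⊢
          rw [← mul_pow, ← ENNReal.ofReal_mul hA]
          gcongr
        · rw [Set.indicator_of_notMem hc] at h1 ⊢
          rw [le_antisymm h1 (norm_nonneg _)]
          simp
    _ ≤ ∫⁻ z in b.cyl N, ENNReal.ofReal A ^ 2 * ENNReal.ofReal (b.weight N z) ^ 2
          ∂(volume.prod volume) := by
        rw [← lintegral_indicator (b.measurableSet_cyl N)]
        exact setLIntegral_le_lintegral _ _
    _ ≤ ENNReal.ofReal A ^ 2 * ENNReal.ofReal (b.C ^ 2 * b.err N) := by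
        rw [lintegral_const_mul' _ _ (by simp)]
        gcongr
        exact b.lintegral_weight_sq_le hd hN1
    _ = _ := by
        rw [← ENNReal.ofReal_pow hA, ← ENNReal.ofReal_mul (by positivity)]
        congr 1; ring

/-- On the support of `lead` the domain is exactly `{t > 0}`, so integrals over `D` become integrals
over a half-space, where integration by parts is available. -/
theorem setIntegral_lead_mul (hD_open : IsOpen D) (hP : P ∈ frontier D) :
    ∀ᶠ N : ℕ in atTop, b.cyl N ⊆ b.param ⁻¹' D ∧ ∀ G : E d → ℂ, ∫ y in D, b.lead N y * G y =
      ∫ z in (Set.univ : Set (E (d - 1))) ×ˢ Set.Ioi (0 : ℝ),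
        b.lead N (b.param z) * G (b.param z) ∂(volume.prod volume) := by
  filter_upwards [b.eventually_param_mem_ball hP] with N ⟨hN, hball⟩
  have hsub1 : b.cyl N ⊆ b.param ⁻¹' D := fun z hz => by
    obtain ⟨h1, h2, h3⟩ := b.mem_cyl_iff.1 hz
    exact (b.param_mem_iff (hball z h1 (by rwa [abs_of_pos h2]))).2 h2
  have hsub2 : b.cyl N ⊆ (Set.univ : Set (E (d - 1))) ×ˢ Set.Ioi (0 : ℝ) := fun z hz =>
    ⟨trivial, (b.mem_cyl_iff.1 hz).2.1⟩
  refine ⟨hsub1, fun G => ?_⟩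
  rw [← b.measurePreserving_param.setIntegral_preimage_emb b.measurableEmbedding_param
    (fun y => b.lead N y * G y) D]
  have hz : ∀ z, 0 < z.2 → z ∉ b.cyl N → b.lead N (b.param z) * G (b.param z) = 0 := by
    intro z hz2 hz
    rw [b.lead_param_eq_zero hN, zero_mul]
    by_contra! h
    exact hz (b.mem_cyl_iff.2 ⟨h.1, hz2, (le_abs_self _).trans h.2⟩)
  rw [setIntegral_eq_of_subset_of_forall_sdiff_eq_zero
      (hD_open.preimage b.continuous_param).measurableSet hsub1,
    setIntegral_eq_of_subset_of_forall_sdiff_eq_zero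
      (MeasurableSet.univ.prod measurableSet_Ioi) hsub2]
  · exact fun z hz' => hz z hz'.1.2 hz'.2
  · intro z hz'
    by_cases hbox : (scale N)⁻¹ < ‖z.1 - b.p'‖ ∨ (scale N)⁻¹ < |z.2|
    · rw [b.lead_param_eq_zero hN hbox, zero_mul]
    · push Not at hbox
      exact hz z ((b.param_mem_iff (hball z hbox.1 hbox.2)).1 hz'.1) hz'.2

end BrownData

end Calderon

/-! ### Integration by parts over a Lipschitz graph -/

namespace Calderon

theorem _root_.LipschitzWith.mul_of_bounded {X : Type*} [PseudoMetricSpace X] {f g : X → ℂ}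
    {Kf Kg Cf Cg : ℝ≥0} (hf : LipschitzWith Kf f) (hg : LipschitzWith Kg g)
    (hCf : ∀ x, ‖f x‖ ≤ Cf) (hCg : ∀ x, ‖g x‖ ≤ Cg) :
    LipschitzWith (Cf * Kg + Kf * Cg) fun x => f x * g x := by
  refine LipschitzWith.of_dist_le_mul fun x y => ?_
  have h1 := hf.dist_le_mul x y
  have h2 := hg.dist_le_mul x y
  rw [dist_eq_norm] at h1 h2 ⊢
  have e : f x * g x - f y * g y = f x * (g x - g y) + (f x - f y) * g y := by ring
  rw [e]
  refine (norm_add_le _ _).trans ?_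
  rw [norm_mul, norm_mul]
  push_cast
  calc _ ≤ (Cf : ℝ) * (Kg * dist x y) + Kf * dist x y * Cg := by
        gcongr
        · exact hCf x
        · exact hCg y
    _ = _ := by ring

/-- The integral of a directional derivative of a compactly supported Lipschitz function is zero. -/
theorem integral_eq_zero_of_hasLineDerivAt {V : Type*} [NormedAddCommGroup V] [NormedSpace ℝ V]
    [FiniteDimensional ℝ V] [MeasurableSpace V] [BorelSpace V] {μ : Measure V}
    [μ.IsAddHaarMeasure] {q q' : V → ℂ} {K : ℝ≥0} (hq : LipschitzWith K q)
    (hc : HasCompactSupport q) {v : V} (h : ∀ᵐ x ∂μ, HasLineDerivAt ℝ q (q' x) x v) :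
    ∫ x, q' x ∂μ = 0 := by
  -- Without integrability the Bochner integral is zero by convention.
  by_cases hi : Integrable q' μ
  swap
  · exact integral_undef hi
  have key : ∀ L : ℂ →L[ℝ] ℝ, L (∫ x, q' x ∂μ) = 0 := by
    intro L
    rw [← L.integral_comp_comm hi]
    -- Integration by parts against the constant function one, whose derivative vanishes; it is
    -- applied to the real and imaginary parts through `L`.
    have h1 := LipschitzWith.integral_lineDeriv_mul_eq (μ := μ)
      (LipschitzWith.const (1 : ℝ) : LipschitzWith 0 (fun _ : V => (1 : ℝ)))
      (L.lipschitz.comp hq) (hc.comp_left (map_zero L)) (-v)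
    simp only [neg_neg, mul_one] at h1
    have h0 : ∀ x : V, lineDeriv ℝ (fun _ : V => (1 : ℝ)) x (-v) = 0 := fun x => by
      simp [lineDeriv]
    simp only [h0, zero_mul, integral_zero] at h1
    rw [h1]
    refine integral_congr_ae ?_
    filter_upwards [h] with x hx
    have h2 : HasDerivAt (fun t : ℝ => q (x + t • v)) (q' x) 0 := hx
    have h3 : HasLineDerivAt ℝ (⇑L ∘ q) (L (q' x)) x v := L.hasFDerivAt.comp_hasDerivAt (0 : ℝ) h2
    exact h3.lineDeriv.symm
  exact Complex.ext (key Complex.reCLM) (key Complex.imCLM)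

namespace BoundaryChart

variable {d : ℕ} {D : Set (E d)} {P : E d} (c : BoundaryChart D P)

theorem param_add_smul_vert (x : E (d - 1)) (t : ℝ) :
    c.param (x, t) = c.param (x, 0) + t • c.vert := by
  rw [param, param, vert, ← map_smul, ← map_add]
  congr 1
  refine WithLp.ofLp_injective 2 (Prod.ext ?_ ?_)
  · simp
  · simp [add_comm]

theorem hasDerivAt_param_vert (x : E (d - 1)) (t : ℝ) :
    HasDerivAt (fun τ => c.param (x, τ)) c.vert t := by
  have : (fun τ => c.param (x, τ)) = fun τ => c.param (x, 0) + τ • c.vert :=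
    funext fun τ => c.param_add_smul_vert x τ
  rw [this]
  simpa using ((hasDerivAt_id t).smul_const c.vert).const_add (c.param (x, 0))

/-- A horizontal vector in the coordinates of the chart. -/
noncomputable def horiz (k : E (d - 1)) : E d := c.coord.symm (WithLp.toLp 2 (k, 0))

theorem horiz_add_smul_vert (v : E d) :
    c.horiz (c.coord v).fst + (c.coord v).snd • c.vert = v := by
  rw [horiz, vert, ← map_smul, ← map_add, LinearIsometryEquiv.symm_apply_eq]
  refine WithLp.ofLp_injective 2 (Prod.ext ?_ ?_)
  · simp
  · simp

theorem hasDerivAt_param_horiz {x : E (d - 1)} (hx : DifferentiableAt ℝ c.φ x) (t : ℝ)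
    (k : E (d - 1)) :
    HasDerivAt (fun τ : ℝ => c.param (x + τ • k, t))
      (c.horiz k + (inner ℝ (gradient c.φ x) k : ℝ) • c.vert) 0 := by
  have h1 : HasDerivAt (fun τ : ℝ => x + τ • k) k 0 := by
    simpa using ((hasDerivAt_id (0 : ℝ)).smul_const k).const_add x
  have h2 : HasDerivAt (fun τ : ℝ => c.φ (x + τ • k)) (inner ℝ (gradient c.φ x) k : ℝ) 0 := by
    have h3 : HasFDerivAt c.φ (fderiv ℝ c.φ x) (x + (0 : ℝ) • k) := by
      simpa using hx.hasFDerivAt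
    have h4 := h3.comp_hasDerivAt (0 : ℝ) h1
    have h5 : fderiv ℝ c.φ x k = inner ℝ (gradient c.φ x) k := by
      rw [gradient, InnerProductSpace.toDual_symm_apply]
    rwa [h5] at h4
  have h6 : HasDerivAt (fun τ : ℝ => c.horiz (x + τ • k)) (c.horiz k) 0 := by
    have : (fun τ : ℝ => c.horiz (x + τ • k)) = fun τ : ℝ => c.horiz x + τ • c.horiz k := by
      funext τ
      rw [horiz, horiz, horiz, ← map_smul, ← map_add]
      congr 1
      refine WithLp.ofLp_injective 2 (Prod.ext ?_ ?_) <;> simp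
    rw [this]
    simpa using ((hasDerivAt_id (0 : ℝ)).smul_const (c.horiz k)).const_add (c.horiz x)
  have h7 : (fun τ : ℝ => c.param (x + τ • k, t)) =
      fun τ : ℝ => c.horiz (x + τ • k) + (t + c.φ (x + τ • k)) • c.vert := by
    funext τ
    rw [← c.horiz_add_smul_vert (c.param (x + τ • k, t)), coord_param]
    rfl
  rw [h7]
  exact h6.add ((h2.const_add t).smul_const c.vert)

end BoundaryChart

/-- The part of a convolution estimate that is needed to bound a function by its derivative. -/
theorem lintegral_exp_mul_lintegral_le {N δ : ℝ} (hN : 0 < N) {g : ℝ → ℝ≥0∞}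
    (hg : Measurable g) :
    ∫⁻ t in Set.Ioc 0 δ, ENNReal.ofReal (Real.exp (-(N * t))) * ∫⁻ τ in Set.Ioc 0 t, g τ ≤
      ENNReal.ofReal N⁻¹ *
        ∫⁻ τ in Set.Ioc 0 δ, ENNReal.ofReal (Real.exp (-(N * τ))) * g τ := by
  have hm : Measurable fun t : ℝ => ENNReal.ofReal (Real.exp (-(N * t))) := by fun_prop
  have h1 : ∀ t ∈ Set.Ioc 0 δ, ENNReal.ofReal (Real.exp (-(N * t))) * ∫⁻ τ in Set.Ioc 0 t, g τ =
      ∫⁻ τ in Set.Ioc 0 δ, ({p : ℝ × ℝ | p.2 ≤ p.1}.indicator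
        fun p => ENNReal.ofReal (Real.exp (-(N * p.1))) * g p.2) (t, τ) := by
    intro t ht
    rw [← lintegral_const_mul _ hg, ← lintegral_indicator measurableSet_Ioc,
      ← lintegral_indicator measurableSet_Ioc]
    refine lintegral_congr fun τ => ?_
    simp only [Set.indicator_apply, Set.mem_Ioc, Set.mem_ofPred_eq]
    by_cases h : 0 < τ ∧ τ ≤ t
    · rw [if_pos h, if_pos ⟨h.1, h.2.trans ht.2⟩, if_pos h.2]
    · rw [if_neg h]
      split_ifs with h2 h3
      · exact absurd ⟨h2.1, h3⟩ h
      · rfl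
      · rfl
  -- Tonelli on the triangle `0 < τ ≤ t`: for fixed `τ`, integrating `exp(-Nt)` over `t ≥ τ` gives
  -- `exp(-Nτ) / N`. This is the source of the gain `1/N`.
  rw [setLIntegral_congr_fun measurableSet_Ioc h1, lintegral_lintegral_swap]
  · rw [← lintegral_const_mul' _ _ ENNReal.ofReal_ne_top]
    refine lintegral_mono fun τ => ?_
    have h2 : ∀ t, ({p : ℝ × ℝ | p.2 ≤ p.1}.indicator
        fun p => ENNReal.ofReal (Real.exp (-(N * p.1))) * g p.2) (t, τ) =
        (Set.Ici τ).indicator (fun t => ENNReal.ofReal (Real.exp (-(N * t)))) t * g τ := by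
      intro t
      simp only [Set.indicator_apply, Set.mem_ofPred_eq, Set.mem_Ici]
      split_ifs <;> simp
    simp only [h2]
    rw [lintegral_mul_const _ (hm.indicator measurableSet_Ici), ← mul_assoc]
    refine mul_le_mul_left ?_ _
    calc _ ≤ ∫⁻ t, (Set.Ici τ).indicator (fun t => ENNReal.ofReal (Real.exp (-(N * t)))) t :=
          setLIntegral_le_lintegral _ _
      _ = ∫⁻ t in Set.Ioi τ, ENNReal.ofReal (Real.exp (-(N * t))) := by
          rw [lintegral_indicator measurableSet_Ici, setLIntegral_congr Ioi_ae_eq_Ici]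
      _ = ENNReal.ofReal (∫ t in Set.Ioi τ, Real.exp (-(N * t))) := by
          rw [ofReal_integral_eq_lintegral_ofReal _ (ae_of_all _ fun _ => (Real.exp_pos _).le)]
          simpa [neg_mul, IntegrableOn] using exp_neg_integrableOn_Ioi τ hN
      _ ≤ _ := by
          rw [← ENNReal.ofReal_mul (by positivity)]
          refine ENNReal.ofReal_le_ofReal (le_of_eq ?_)
          have h3 := integral_exp_mul_Ioi (a := -N) (by linarith) τ
          simp only [neg_mul] at h3
          rw [h3]
          field_simp
  · refine (Measurable.indicator ?_ (measurableSet_le measurable_snd measurable_fst)).aemeasurable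
    fun_prop

end Calderon

namespace Calderon

namespace BoundaryChart

variable {d : ℕ} {D : Set (E d)} {P : E d} (c : BoundaryChart D P)

theorem exists_lipschitzWith_param_slice (t : ℝ) :
    ∃ K : ℝ≥0, LipschitzWith K fun x => c.param (x, t) := by
  obtain ⟨K, hK⟩ := c.lipschitz
  refine ⟨1 + K, LipschitzWith.of_dist_le_mul fun x y => ?_⟩
  simpa using c.dist_param_le hK (x, t) (y, t)

/-- The vector applied to `w` is the derivative of `x ↦ param (x, t)` in the direction `k`. The
integrand is thus almost everywhere the derivative of one compactly supported Lipschitz function of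
`x`. -/
theorem integral_horizontal_derivative {s : E (d - 1) × ℝ → ℂ} (hs : ContDiff ℝ 1 s)
    (hsc : HasCompactSupport s) {w : E d → ℂ} (hw : ContDiff ℝ 1 w) (hwc : HasCompactSupport w)
    (k : E (d - 1)) (t : ℝ) :
    ∫ x, (fderiv ℝ s (x, t) (k, 0) * w (c.param (x, t)) + s (x, t) * fderiv ℝ w (c.param (x, t))
      (c.horiz k + (inner ℝ (gradient c.φ x) k : ℝ) • c.vert)) = 0 := by
  obtain ⟨K, hK⟩ := c.lipschitz
  obtain ⟨Ks, hKs⟩ := hs.lipschitzWith_of_hasCompactSupport hsc one_ne_zero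
  obtain ⟨Kw, hKw⟩ := hw.lipschitzWith_of_hasCompactSupport hwc one_ne_zero
  obtain ⟨Kp, hKp⟩ := c.exists_lipschitzWith_param_slice t
  obtain ⟨Cs, hCs⟩ := hsc.exists_bound_of_continuous hs.continuous
  obtain ⟨Cw, hCw⟩ := hwc.exists_bound_of_continuous hw.continuous
  have hl : LipschitzWith 1 fun x : E (d - 1) => (x, t) := LipschitzWith.prodMk_right t
  have hq := (hKs.comp hl).mul_of_bounded (hKw.comp hKp)
    (Cf := Cs.toNNReal) (Cg := Cw.toNNReal)
    (fun x => (hCs _).trans (Real.le_coe_toNNReal _))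
    (fun x => (hCw _).trans (Real.le_coe_toNNReal _))
  refine integral_eq_zero_of_hasLineDerivAt hq ?_ (v := k) ?_
  · refine HasCompactSupport.mul_right ?_
    exact hsc.comp_isClosedEmbedding (Function.LeftInverse.isClosedEmbedding (f := Prod.fst)
      (fun _ => rfl) continuous_fst (by fun_prop))
  · filter_upwards [hK.ae_differentiableAt] with x hx
    have h1 : HasDerivAt (fun τ : ℝ => (x + τ • k, t)) (k, (0 : ℝ)) 0 := by
      refine HasDerivAt.prodMk ?_ (hasDerivAt_const _ _)
      simpa using ((hasDerivAt_id (0 : ℝ)).smul_const k).const_add x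
    have h2 : HasFDerivAt s (fderiv ℝ s (x, t)) (x + (0 : ℝ) • k, t) := by
      simpa using (hs.differentiable one_ne_zero (x, t)).hasFDerivAt
    have h3 : HasFDerivAt w (fderiv ℝ w (c.param (x, t))) (c.param (x + (0 : ℝ) • k, t)) := by
      simpa using (hw.differentiable one_ne_zero (c.param (x, t))).hasFDerivAt
    have h4 := (h2.comp_hasDerivAt (0 : ℝ) h1).mul
      (h3.comp_hasDerivAt (0 : ℝ) (c.hasDerivAt_param_horiz hx t k))
    exact h4.congr_deriv (by simp)

theorem integral_vertical_derivative {s : E (d - 1) × ℝ → ℂ} (hs : ContDiff ℝ 1 s)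
    (hsc : HasCompactSupport s) {w : E d → ℂ} (hw : ContDiff ℝ 1 w) (x : E (d - 1)) :
    ∫ t in Set.Ioi 0, (fderiv ℝ s (x, t) (0, 1) * w (c.param (x, t)) +
      s (x, t) * fderiv ℝ w (c.param (x, t)) c.vert) = -(s (x, 0) * w (c.param (x, 0))) := by
  have h1 : ∀ t, HasDerivAt (fun t => s (x, t) * w (c.param (x, t)))
      (fderiv ℝ s (x, t) (0, 1) * w (c.param (x, t)) +
      s (x, t) * fderiv ℝ w (c.param (x, t)) c.vert) t := fun t =>
    (((hs.differentiable one_ne_zero (x, t)).hasFDerivAt.comp_hasDerivAt t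
      ((hasDerivAt_const t x).prodMk (hasDerivAt_id t)))).mul
      ((hw.differentiable one_ne_zero (c.param (x, t))).hasFDerivAt.comp_hasDerivAt t
        (c.hasDerivAt_param_vert x t))
  have h2 : ContDiff ℝ 1 (fun t => s (x, t) * w (c.param (x, t))) := by
    have : (fun t => c.param (x, t)) = fun t => c.param (x, 0) + t • c.vert :=
      funext fun τ => c.param_add_smul_vert x τ
    refine (hs.comp (contDiff_prodMk_right x)).mul (hw.comp ?_)
    rw [this]
    fun_prop
  have h3 : HasCompactSupport (fun t => s (x, t) * w (c.param (x, t))) :=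
    HasCompactSupport.mul_right (hsc.comp_isClosedEmbedding (Function.LeftInverse.isClosedEmbedding
      (f := Prod.snd) (fun _ => rfl) continuous_snd (by fun_prop)))
  rw [← h3.integral_Ioi_deriv_eq h2 0]
  exact setIntegral_congr_fun measurableSet_Ioi fun t _ => (h1 t).deriv.symm

theorem integrable_fderiv_mul {s : E (d - 1) × ℝ → ℂ} (hs : ContDiff ℝ 1 s)
    (hsc : HasCompactSupport s) {w : E d → ℂ} (hw : ContDiff ℝ 1 w) (u : E (d - 1) × ℝ) :
    Integrable (fun z => fderiv ℝ s z u * w (c.param z)) (volume.prod volume) := by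
  have hcp := c.continuous_param
  have hcw := hw.continuous
  have hds : Continuous (fderiv ℝ s) := hs.continuous_fderiv one_ne_zero
  refine Continuous.integrable_of_hasCompactSupport (by fun_prop) ?_
  exact HasCompactSupport.mul_right
    ((hsc.fderiv ℝ).comp_left (g := fun L : E (d - 1) × ℝ →L[ℝ] ℂ => L u) rfl)

theorem integrable_mul_fderiv {s : E (d - 1) × ℝ → ℂ} (hs : ContDiff ℝ 1 s)
    (hsc : HasCompactSupport s) {w : E d → ℂ} (hw : ContDiff ℝ 1 w) (u : E d) :
    Integrable (fun z => s z * fderiv ℝ w (c.param z) u) (volume.prod volume) := by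
  have hdw : Continuous (fderiv ℝ w) := hw.continuous_fderiv one_ne_zero
  refine Continuous.integrable_of_hasCompactSupport ?_ hsc.mul_right
  exact hs.continuous.mul ((hdw.comp c.continuous_param).clm_apply continuous_const)

/-- Integration by parts over the half-space, for a function composed with the parametrisation. -/
theorem integral_mul_fderiv {s : E (d - 1) × ℝ → ℂ} (hs : ContDiff ℝ 1 s)
    (hsc : HasCompactSupport s) {w : E d → ℂ} (hw : ContDiff ℝ 1 w) (hwc : HasCompactSupport w)
    (m : E (d - 1)) (v : E d) :
    ∫ z in (Set.univ : Set (E (d - 1))) ×ˢ Set.Ioi (0 : ℝ), s z * fderiv ℝ w (c.param z) v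
      ∂(volume.prod volume) =
    -(∫ z in (Set.univ : Set (E (d - 1))) ×ˢ Set.Ioi (0 : ℝ), fderiv ℝ s z ((c.coord v).fst,
        (c.coord v).snd - inner ℝ m (c.coord v).fst) * w (c.param z) ∂(volume.prod volume)) -
    (∫ z in (Set.univ : Set (E (d - 1))) ×ˢ Set.Ioi (0 : ℝ),
      (inner ℝ (gradient c.φ z.1 - m) (c.coord v).fst : ℝ) *
        (s z * fderiv ℝ w (c.param z) c.vert) ∂(volume.prod volume)) -
    ((c.coord v).snd - inner ℝ m (c.coord v).fst : ℝ) *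
      ∫ x, s (x, 0) * w (c.param (x, 0)) := by
  obtain ⟨K, hK⟩ := c.lipschitz
  set k := (c.coord v).fst with hk
  set θ := (c.coord v).snd - inner ℝ m k with hθ
  set H := (Set.univ : Set (E (d - 1))) ×ˢ Set.Ioi (0 : ℝ) with hH
  set μ := (volume : Measure (E (d - 1))).prod (volume : Measure ℝ) with hμ
  have i1 : ∀ u, Integrable (fun z => fderiv ℝ s z u * w (c.param z)) (μ.restrict H) :=
    fun u => (c.integrable_fderiv_mul hs hsc hw u).restrict
  have i2 : ∀ u, Integrable (fun z => s z * fderiv ℝ w (c.param z) u) (μ.restrict H) :=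
    fun u => (c.integrable_mul_fderiv hs hsc hw u).restrict
  have i3 : ∀ a : E (d - 1), Integrable (fun z : E (d - 1) × ℝ =>
      (inner ℝ (gradient c.φ z.1 - a) k : ℝ) * (s z * fderiv ℝ w (c.param z) c.vert))
      (μ.restrict H) := by
    intro a
    refine (i2 c.vert).bdd_mul (c := (K + ‖a‖) * ‖k‖) ?_ (ae_of_all _ fun z => ?_)
    · refine Measurable.aestronglyMeasurable ?_
      have h1 : Measurable fun z : E (d - 1) × ℝ => gradient c.φ z.1 :=
        (measurable_gradient c.φ).comp measurable_fst
      exact Complex.measurable_ofReal.comp ((h1.sub_const a).inner measurable_const)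
    · rw [Complex.norm_real]
      refine (norm_inner_le_norm _ _).trans ?_
      gcongr
      exact (norm_sub_le _ _).trans (add_le_add_left (norm_gradient_le hK _) _)
  have hX : ∫ z in H, (fderiv ℝ s z (k, 0) * w (c.param z) + s z * fderiv ℝ w (c.param z)
      (c.horiz k + (inner ℝ (gradient c.φ z.1) k : ℝ) • c.vert)) ∂μ = 0 := by
    have hi : Integrable (fun z => fderiv ℝ s z (k, 0) * w (c.param z) +
        s z * fderiv ℝ w (c.param z)
          (c.horiz k + (inner ℝ (gradient c.φ z.1) k : ℝ) • c.vert)) (μ.restrict H) := by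
      refine ((i1 (k, 0)).add ((i2 (c.horiz k)).add (i3 0))).congr (ae_of_all _ fun z => ?_)
      simp
      ring
    rw [hμ, hH, ← Measure.prod_restrict, Measure.restrict_univ] at hi ⊢
    rw [integral_prod_symm _ hi]
    simp only [c.integral_horizontal_derivative hs hsc hw hwc k, integral_zero]
  have hT : ∫ z in H, (fderiv ℝ s z (0, 1) * w (c.param z) +
      s z * fderiv ℝ w (c.param z) c.vert) ∂μ = -∫ x, s (x, 0) * w (c.param (x, 0)) := by
    have hi := (i1 (0, 1)).add (i2 c.vert)
    rw [hμ, hH, ← Measure.prod_restrict, Measure.restrict_univ] at hi ⊢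
    rw [← integral_neg]
    refine (integral_prod _ hi).trans ?_
    exact integral_congr_ae (ae_of_all _ fun x => c.integral_vertical_derivative hs hsc hw x)
  have hXi : Integrable (fun z => fderiv ℝ s z (k, 0) * w (c.param z) +
        s z * fderiv ℝ w (c.param z)
          (c.horiz k + (inner ℝ (gradient c.φ z.1) k : ℝ) • c.vert)) (μ.restrict H) := by
    refine ((i1 (k, 0)).add ((i2 (c.horiz k)).add (i3 0))).congr (ae_of_all _ fun z => ?_)
    simp
    ring
  have hTi : Integrable (fun z => (θ : ℂ) * (fderiv ℝ s z (0, 1) * w (c.param z) +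
      s z * fderiv ℝ w (c.param z) c.vert)) (μ.restrict H) :=
    ((i1 (0, 1)).add (i2 c.vert)).const_mul (θ : ℂ)
  -- The vector `v` is split into a field tangent to the translated graphs, the constant multiple
  -- `θ` of `vert`, and the remainder containing `∇φ - m`. The first two are integrated by parts
  -- without differentiating `∇φ`; the remainder is kept as it is.
  have hpt : ∀ z, s z * fderiv ℝ w (c.param z) v =
      ((fderiv ℝ s z (k, 0) * w (c.param z) + s z * fderiv ℝ w (c.param z)
          (c.horiz k + (inner ℝ (gradient c.φ z.1) k : ℝ) • c.vert)) +
        (θ : ℂ) * (fderiv ℝ s z (0, 1) * w (c.param z) +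
          s z * fderiv ℝ w (c.param z) c.vert)) -
      fderiv ℝ s z (k, θ) * w (c.param z) -
      (inner ℝ (gradient c.φ z.1 - m) k : ℝ) * (s z * fderiv ℝ w (c.param z) c.vert) := by
    intro z
    have e1 : fderiv ℝ s z (k, θ) = fderiv ℝ s z (k, 0) + θ * fderiv ℝ s z (0, 1) := by
      have : ((k, θ) : E (d - 1) × ℝ) = (k, 0) + θ • (0, 1) := by simp
      rw [this, map_add, map_smul, Complex.real_smul]
    have e2 : fderiv ℝ w (c.param z) v = fderiv ℝ w (c.param z) (c.horiz k) +
        (c.coord v).snd * fderiv ℝ w (c.param z) c.vert := by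
      rw [← Complex.real_smul, ← map_smul, ← map_add, hk, c.horiz_add_smul_vert]
    rw [e1, e2, map_add, map_smul, Complex.real_smul, inner_sub_left, hθ]
    push_cast
    ring
  simp only [hpt]
  refine (integral_sub ((hXi.add hTi).sub (i1 (k, θ))) (i3 m)).trans ?_
  rw [integral_sub' (hXi.add hTi) (i1 (k, θ)), integral_add' hXi hTi, hX, integral_const_mul, hT]
  ring

end BoundaryChart

end Calderon

/-! ### The leading term is almost divergence-free -/

namespace Calderon

theorem BoundaryChart.enorm_comp_param_le {d : ℕ} {D : Set (E d)} {P : E d}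
    (c : BoundaryChart D P) {w : E d → ℂ} (hw : ContDiff ℝ 1 w) (x : E (d - 1)) {t : ℝ}
    (ht : 0 ≤ t) :
    ‖w (c.param (x, t))‖ₑ ≤ ‖w (c.graph x)‖ₑ +
      ∫⁻ τ in Set.Ioc 0 t, ‖fderiv ℝ w (c.param (x, τ)) c.vert‖ₑ := by
  have hdw : Continuous (fderiv ℝ w) := hw.continuous_fderiv one_ne_zero
  have hcp := c.continuous_param
  have hc : Continuous fun τ : ℝ => fderiv ℝ w (c.param (x, τ)) c.vert :=
    (hdw.comp (hcp.comp (by fun_prop))).clm_apply continuous_const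
  have h1 := intervalIntegral.integral_eq_sub_of_hasDerivAt (a := 0) (b := t)
    (f := fun τ => w (c.param (x, τ)))
    (f' := fun τ => fderiv ℝ w (c.param (x, τ)) c.vert) (fun τ _ =>
      (hw.differentiable one_ne_zero (c.param (x, τ))).hasFDerivAt.comp_hasDerivAt τ
        (c.hasDerivAt_param_vert x τ)) (hc.intervalIntegrable _ _)
  have h2 : w (c.param (x, t)) = w (c.graph x) +
      ∫ τ in Set.Ioc 0 t, fderiv ℝ w (c.param (x, τ)) c.vert := by
    rw [← intervalIntegral.integral_of_le ht, h1, BoundaryChart.graph]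
    ring
  rw [h2]
  exact (enorm_add_le _ _).trans (add_le_add_right (enorm_integral_le_lintegral_enorm _) _)

namespace BrownData

variable {d : ℕ} {D : Set (E d)} {P : E d} (b : BrownData D P)

theorem lead_param (N : ℕ) (z : E (d - 1) × ℝ) :
    b.lead N (b.param z) = b.amp N * N *
      b.a (scale N) N ((WithLp.prodContinuousLinearEquiv 2 ℝ (E (d - 1)) ℝ).symm
        (z - (b.p', 0))) := by
  rw [lead, b.flatten_param]
  congr 2
  refine WithLp.ofLp_injective 2 (Prod.ext ?_ ?_) <;> simp

/-- In chart coordinates the flattening is a translation, so `lead` becomes smooth, which the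
half-space integration by parts needs; composed with the flattening it is only known to be Lipschitz
on `ℝ^d`. -/
theorem contDiff_lead_param {N : ℕ} (hN : 1 ≤ N) :
    ContDiff ℝ ∞ fun z => b.lead N (b.param z) := by
  simp only [b.lead_param]
  refine contDiff_const.mul ((b.contDiff_a (scale_pos hN).le N).comp ?_)
  exact (ContinuousLinearEquiv.contDiff _).comp (contDiff_id.sub contDiff_const)

theorem fderiv_lead_param {N : ℕ} (hN : 1 ≤ N) (z u : E (d - 1) × ℝ) :
    fderiv ℝ (fun z => b.lead N (b.param z)) z u =
      b.amp N * N * fderiv ℝ (b.a (scale N) N) (b.flatten (b.param z)) (WithLp.toLp 2 u) := by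
  have h1 : HasFDerivAt (fun z : E (d - 1) × ℝ =>
      (WithLp.prodContinuousLinearEquiv 2 ℝ (E (d - 1)) ℝ).symm (z - (b.p', 0)))
      ((WithLp.prodContinuousLinearEquiv 2 ℝ (E (d - 1)) ℝ).symm : _ →L[ℝ] Coord d) z :=
    (ContinuousLinearEquiv.hasFDerivAt _).comp z ((hasFDerivAt_id z).sub_const _)
  have e : (WithLp.prodContinuousLinearEquiv 2 ℝ (E (d - 1)) ℝ).symm (z - (b.p', 0)) =
      b.flatten (b.param z) := by
    rw [b.flatten_param]
    refine WithLp.ofLp_injective 2 (Prod.ext ?_ ?_) <;> simp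
  have h2 : HasFDerivAt (b.a (scale N) N) (fderiv ℝ (b.a (scale N) N) (b.flatten (b.param z)))
      ((WithLp.prodContinuousLinearEquiv 2 ℝ (E (d - 1)) ℝ).symm (z - (b.p', 0))) := by
    rw [e]
    exact ((b.contDiff_a (scale_pos hN).le N).differentiable (by simp) _).hasFDerivAt
  have h3 := ((h2.comp z h1).const_mul (b.amp N * N : ℂ)).congr_of_eventuallyEq
    (Eventually.of_forall (b.lead_param N))
  rw [h3.fderiv]
  simp

theorem hasCompactSupport_lead_param {N : ℕ} (hN : 1 ≤ N) :
    HasCompactSupport fun z => b.lead N (b.param z) := by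
  refine HasCompactSupport.intro ((isCompact_closedBall b.p' (scale N)⁻¹).prod
    (isCompact_Icc (a := -(scale N)⁻¹) (b := (scale N)⁻¹))) fun z hz => ?_
  refine b.lead_param_eq_zero hN ?_
  by_contra! h
  exact hz ⟨mem_closedBall_iff_norm.2 h.1, abs_le.1 h.2⟩

/-- The frequency is characteristic, so that only derivatives of the cut-off remain. -/
theorem fderiv_lead_param_freq {N : ℕ} (hN : 1 ≤ N) (z : E (d - 1) × ℝ) :
    fderiv ℝ (fun z => b.lead N (b.param z)) z (b.lin b.reFreq).ofLp +
      Complex.I * fderiv ℝ (fun z => b.lead N (b.param z)) z (b.lin b.imFreq).ofLp =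
    b.amp N * N * Complex.exp (N * b.phase (b.flatten (b.param z))) * scale N *
      (fderiv ℝ b.cutoff (scale N • b.flatten (b.param z)) (b.lin b.reFreq) +
        Complex.I * fderiv ℝ b.cutoff (scale N • b.flatten (b.param z)) (b.lin b.imFreq)) := by
  rw [b.fderiv_lead_param hN, b.fderiv_lead_param hN, WithLp.toLp_ofLp, WithLp.toLp_ofLp,
    b.fderiv_a_apply (scale_pos hN).le, b.fderiv_a_apply (scale_pos hN).le]
  push_cast
  linear_combination (b.amp N * N * b.a (scale N) N (b.flatten (b.param z)) * N : ℂ) *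
    b.phase_lin_freq

theorem exists_norm_fderiv_lead_param_freq_le : ∃ A : ℝ, 0 ≤ A ∧ ∀ N : ℕ, 1 ≤ N →
    ∀ z : E (d - 1) × ℝ, 0 < z.2 →
    ‖fderiv ℝ (fun z => b.lead N (b.param z)) z (b.lin b.reFreq).ofLp +
      Complex.I * fderiv ℝ (fun z => b.lead N (b.param z)) z (b.lin b.imFreq).ofLp‖ ≤
    (b.cyl N).indicator (fun z => A * b.amp N * N * scale N * Real.exp (-(N * z.2))) z := by
  obtain ⟨C₁, hC0, hC₁⟩ := b.exists_norm_fderiv_cutoff_le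
  refine ⟨C₁ * (‖b.lin b.reFreq‖ + ‖b.lin b.imFreq‖), by positivity, fun N hN z hz => ?_⟩
  have hM := scale_pos hN
  have hA := b.amp_nonneg N
  rw [b.fderiv_lead_param_freq hN]
  by_cases hc : z ∈ b.cyl N
  · rw [Set.indicator_of_mem hc]
    have h1 : ‖(fderiv ℝ b.cutoff (scale N • b.flatten (b.param z)) (b.lin b.reFreq) +
        Complex.I * fderiv ℝ b.cutoff (scale N • b.flatten (b.param z)) (b.lin b.imFreq) : ℂ)‖ ≤
        C₁ * (‖b.lin b.reFreq‖ + ‖b.lin b.imFreq‖) := by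
      refine (norm_add_le _ _).trans ?_
      rw [norm_mul, Complex.norm_I, one_mul, Complex.norm_real, Complex.norm_real, mul_add]
      exact add_le_add (ContinuousLinearMap.le_of_opNorm_le _ (hC₁ _) _)
        (ContinuousLinearMap.le_of_opNorm_le _ (hC₁ _) _)
    have h2 := b.norm_exp_phase N (b.flatten (b.param z))
    have h3 : (b.flatten (b.param z)).snd = z.2 := by rw [b.flatten_param]; rfl
    rw [norm_mul, norm_mul, norm_mul, norm_mul, Complex.norm_real, Complex.norm_real,
      Complex.norm_natCast, Real.norm_of_nonneg hA, Real.norm_of_nonneg hM.le]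
    push_cast at h2
    rw [h2, h3]
    calc _ ≤ b.amp N * N * Real.exp (-(N * z.2)) * scale N *
          (C₁ * (‖b.lin b.reFreq‖ + ‖b.lin b.imFreq‖)) := by gcongr
      _ = _ := by ring
  · rw [Set.indicator_of_notMem hc]
    have hbox : (scale N)⁻¹ < ‖(b.flatten (b.param z)).fst‖ ∨
        (scale N)⁻¹ < |(b.flatten (b.param z)).snd| := by
      rw [b.flatten_param]
      by_contra! h
      exact hc (b.mem_cyl_iff.2 ⟨h.1, hz, (le_abs_self _).trans h.2⟩)
    rw [b.fderiv_cutoff_smul_eq_zero hM hbox]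
    simp

/-- The boundary terms of the integration by parts. -/
theorem lintegral_enorm_graph_le (hP : P ∈ frontier D) : ∀ᶠ N : ℕ in atTop, ∃ B : ℝ≥0∞, B ≠ ⊤ ∧
    ∀ w : E d → ℂ, Continuous w →
      ∫⁻ x in Metric.closedBall b.p' (scale N)⁻¹, ‖w (b.graph x)‖ₑ ≤
        B * eLpNorm w 2 (surfaceMeasure D) := by
  filter_upwards [b.eventually_param_mem_ball hP] with N ⟨hN, hball⟩
  have hfin : volume (Metric.closedBall b.p' (scale N)⁻¹) ≠ ⊤ :=
    (isCompact_closedBall _ _).measure_lt_top.ne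
  refine ⟨volume (Metric.closedBall b.p' (scale N)⁻¹) ^ (1 / 2 : ℝ),
    ENNReal.rpow_ne_top_of_nonneg (by norm_num) hfin, fun w hw => ?_⟩
  have hsub : b.graph '' Metric.closedBall b.p' (scale N)⁻¹ ⊆ frontier D := by
    rintro _ ⟨x, hx, rfl⟩
    refine b.graph_mem_frontier (hball (x, 0) (mem_closedBall_iff_norm.1 hx) ?_)
    simpa using (inv_pos.2 (scale_pos hN)).le
  have hm : AEMeasurable (fun x => ‖w (b.graph x)‖ₑ)
      (volume.restrict (Metric.closedBall b.p' (scale N)⁻¹)) :=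
    (hw.comp b.continuous_graph).measurable.enorm.aemeasurable
  have h1 := sq_lintegral_mul_le hm (aemeasurable_const (b := (1 : ℝ≥0∞)))
  simp only [mul_one, one_pow, lintegral_const, Measure.restrict_apply_univ, one_mul] at h1
  have h2 : (volume (Metric.closedBall b.p' (scale N)⁻¹) ^ (1 / 2 : ℝ)) ^ 2 =
      volume (Metric.closedBall b.p' (scale N)⁻¹) := by
    rw [← ENNReal.rpow_natCast, ← ENNReal.rpow_mul]
    norm_num
  rw [← ENNReal.pow_le_pow_left_iff two_ne_zero, mul_pow, h2, eLpNorm_two_sq, mul_comm]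
  refine h1.trans (mul_le_mul_left ?_ _)
  refine le_trans (le_of_eq ?_) (lintegral_mono' (b.map_graph_restrict_le hsub) le_rfl)
  rw [lintegral_map (hw.measurable.enorm.pow_const 2) b.continuous_graph.measurable]

theorem lintegral_cyl_eq (N : ℕ) {F : E (d - 1) × ℝ → ℝ≥0∞} (hF : Measurable F) :
    ∫⁻ z in b.cyl N, F z ∂(volume.prod volume) =
      ∫⁻ x in Metric.closedBall b.p' (scale N)⁻¹, ∫⁻ t in Set.Ioc 0 (scale N)⁻¹, F (x, t) := by
  rw [cyl, ← Measure.prod_restrict, lintegral_prod _ hF.aemeasurable]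

/-- The volume terms of the integration by parts are controlled by the gradient. -/
theorem lintegral_cyl_exp_mul_enorm_le {N : ℕ} (hN : 1 ≤ N) {w : E d → ℂ}
    (hw : ContDiff ℝ 1 w) :
    ∫⁻ z in b.cyl N, ENNReal.ofReal (Real.exp (-(N * z.2))) * ‖w (b.param z)‖ₑ
        ∂(volume.prod volume) ≤
      ENNReal.ofReal (scale N)⁻¹ *
        (∫⁻ x in Metric.closedBall b.p' (scale N)⁻¹, ‖w (b.graph x)‖ₑ) +
      ENNReal.ofReal (N : ℝ)⁻¹ * ∫⁻ z in b.cyl N, ENNReal.ofReal (Real.exp (-(N * z.2))) *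
        ‖fderiv ℝ w (b.param z) b.vert‖ₑ ∂(volume.prod volume) := by
  have hN0 : (0 : ℝ) < N := by exact_mod_cast hN
  have hcp := b.continuous_param
  have hcg := b.continuous_graph
  have hcw := hw.continuous
  have hdw : Continuous (fderiv ℝ w) := hw.continuous_fderiv one_ne_zero
  have hdv : Continuous fun z => fderiv ℝ w (b.param z) b.vert :=
    (hdw.comp hcp).clm_apply continuous_const
  have hme : Measurable fun z : E (d - 1) × ℝ => ENNReal.ofReal (Real.exp (-(N * z.2))) := by
    fun_prop
  have hF : Measurable fun z => ENNReal.ofReal (Real.exp (-(N * z.2))) *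
      ‖fderiv ℝ w (b.param z) b.vert‖ₑ := hme.mul hdv.measurable.enorm
  have hF0 : Measurable fun z => ENNReal.ofReal (Real.exp (-(N * z.2))) * ‖w (b.param z)‖ₑ :=
    hme.mul (hcw.comp hcp).measurable.enorm
  have hG : Measurable fun x => ENNReal.ofReal (scale N)⁻¹ * ‖w (b.graph x)‖ₑ :=
    (hcw.comp hcg).measurable.enorm.const_mul _
  rw [b.lintegral_cyl_eq N hF0, b.lintegral_cyl_eq N hF,
    ← lintegral_const_mul' _ _ ENNReal.ofReal_ne_top,
    ← lintegral_const_mul' _ _ ENNReal.ofReal_ne_top,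
    ← lintegral_add_left hG]
  refine lintegral_mono fun x => ?_
  calc _ ≤ ∫⁻ t in Set.Ioc 0 (scale N)⁻¹, (‖w (b.graph x)‖ₑ +
          ENNReal.ofReal (Real.exp (-(N * t))) *
            ∫⁻ τ in Set.Ioc 0 t, ‖fderiv ℝ w (b.param (x, τ)) b.vert‖ₑ) := by
        refine setLIntegral_mono' measurableSet_Ioc fun t ht => ?_
        -- The function is bounded by its boundary value plus the integral of its vertical
        -- derivative; on the boundary term the exponential is simply bounded by one.
        refine (mul_le_mul_right (b.enorm_comp_param_le hw x ht.1.le) _).trans ?_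
        rw [mul_add]
        refine add_le_add_left (mul_le_of_le_one_left zero_le ?_) _
        rw [ENNReal.ofReal_le_one, Real.exp_le_one_iff]
        have := mul_pos hN0 ht.1
        linarith
    _ ≤ _ := by
        rw [lintegral_add_left measurable_const]
        refine add_le_add (le_of_eq ?_) (lintegral_exp_mul_lintegral_le hN0
          (hdv.comp (by fun_prop : Continuous fun τ : ℝ => (x, τ))).measurable.enorm)
        rw [lintegral_const, Measure.restrict_apply_univ, Real.volume_Ioc, sub_zero, mul_comm]

theorem lintegral_weight_mul_cgrad_le (hd : 2 ≤ d) {N : ℕ} (hN : 1 ≤ N)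
    (hsub : b.cyl N ⊆ b.param ⁻¹' D) {w : E d → ℂ} (hw : ContDiff ℝ 1 w) :
    ∫⁻ z in b.cyl N, ENNReal.ofReal (b.weight N z) * ‖cgrad w (b.param z)‖ₑ
        ∂(volume.prod volume) ≤
      ENNReal.ofReal (b.C * √(b.err N)) * eLpNorm (cgrad w) 2 (volume.restrict D) := by
  have hm1 : Measurable fun z => ENNReal.ofReal (b.weight N z) :=
    (b.measurable_weight N).ennreal_ofReal
  have hm2 : Measurable fun z => ‖cgrad w (b.param z)‖ₑ :=
    ((continuous_cgrad hw).comp b.continuous_param).measurable.enorm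
  rw [← ENNReal.pow_le_pow_left_iff two_ne_zero, mul_pow, eLpNorm_two_sq, b.lintegral_eq_param,
    ← ENNReal.ofReal_pow (mul_nonneg b.C_nonneg (Real.sqrt_nonneg _)), mul_pow,
    Real.sq_sqrt (b.err_nonneg N)]
  refine (sq_lintegral_mul_le hm1.aemeasurable hm2.aemeasurable).trans ?_
  gcongr
  exact b.lintegral_weight_sq_le hd hN

end BrownData

end Calderon

namespace Calderon

namespace BrownData

variable {d : ℕ} {D : Set (E d)} {P : E d} (b : BrownData D P)

theorem enorm_setIntegral_le_lintegral_cyl {N : ℕ} {f : E (d - 1) × ℝ → ℂ}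
    {g : E (d - 1) × ℝ → ℝ≥0∞} (hg : ∀ z ∈ b.cyl N, ‖f z‖ₑ ≤ g z)
    (hf : ∀ z, 0 < z.2 → z ∉ b.cyl N → f z = 0) :
    ‖∫ z in (Set.univ : Set (E (d - 1))) ×ˢ Set.Ioi (0 : ℝ), f z ∂(volume.prod volume)‖ₑ ≤
      ∫⁻ z in b.cyl N, g z ∂(volume.prod volume) := by
  have hsub : b.cyl N ⊆ (Set.univ : Set (E (d - 1))) ×ˢ Set.Ioi (0 : ℝ) := fun z hz =>
    ⟨trivial, (b.mem_cyl_iff.1 hz).2.1⟩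
  rw [setIntegral_eq_of_subset_of_forall_sdiff_eq_zero
      (MeasurableSet.univ.prod measurableSet_Ioi) hsub fun z hz => hf z hz.1.2 hz.2]
  exact (enorm_integral_le_lintegral_enorm _).trans
    (setLIntegral_mono' (b.measurableSet_cyl N) hg)

theorem enorm_fderiv_apply_le (w : E d → ℂ) (x v : E d) :
    ‖fderiv ℝ w x v‖ₑ ≤ ENNReal.ofReal ‖v‖ * ‖cgrad w x‖ₑ := by
  rw [← ofReal_norm, ← ofReal_norm, ← ENNReal.ofReal_mul (norm_nonneg _)]
  exact ENNReal.ofReal_le_ofReal (norm_fderiv_apply_le w x v)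

theorem lead_param_eq_zero_of_notMem_cyl {N : ℕ} (hN : 1 ≤ N) {z : E (d - 1) × ℝ} (hz : 0 < z.2)
    (hc : z ∉ b.cyl N) : b.lead N (b.param z) = 0 := by
  refine b.lead_param_eq_zero hN ?_
  by_contra! h
  exact hc (b.mem_cyl_iff.2 ⟨h.1, hz, (le_abs_self _).trans h.2⟩)

/-- The remainder of the integration by parts has size `amp N · dev · exp(-Nt) |∇w|`, which is the
first half of the weight. -/
theorem enorm_integral_dev_le {N : ℕ} (hN : 1 ≤ N) (w : E d → ℂ) (v : E d) :
    ‖∫ z in (Set.univ : Set (E (d - 1))) ×ˢ Set.Ioi (0 : ℝ),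
      (inner ℝ (gradient b.φ z.1 - b.slope) (b.coord v).fst : ℝ) *
        (b.lead N (b.param z) * fderiv ℝ w (b.param z) b.vert) ∂(volume.prod volume)‖ₑ ≤
      ENNReal.ofReal ‖v‖ * ∫⁻ z in b.cyl N, ENNReal.ofReal (b.weight N z) *
        ‖cgrad w (b.param z)‖ₑ ∂(volume.prod volume) := by
  rw [← lintegral_const_mul' _ _ ENNReal.ofReal_ne_top]
  refine b.enorm_setIntegral_le_lintegral_cyl (fun z hz => ?_) fun z hz hc => ?_
  · have h1 := b.norm_lead_param_le hN z
    have h2 : |inner ℝ (gradient b.φ z.1 - b.slope) (b.coord v).fst| ≤ b.dev z.1 * ‖v‖ := by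
      refine (abs_real_inner_le_norm _ _).trans ?_
      refine mul_le_mul_of_nonneg_left ?_ (norm_nonneg _)
      have := BoundaryChart.norm_fst_le (b.coord v)
      rwa [b.coord.norm_map] at this
    have h3 := norm_fderiv_apply_le w (b.param z) b.vert
    rw [b.norm_vert, one_mul] at h3
    have h4 := b.amp_nonneg N
    have h5 := b.dev_nonneg z.1
    have h6 := (scale_pos hN).le
    rw [← ofReal_norm, ← ofReal_norm, ← ENNReal.ofReal_mul (b.weight_nonneg z),
      ← ENNReal.ofReal_mul (norm_nonneg _), norm_mul, norm_mul, Complex.norm_real,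
      Real.norm_eq_abs]
    refine ENNReal.ofReal_le_ofReal ?_
    calc _ ≤ b.dev z.1 * ‖v‖ * (b.amp N * N * Real.exp (-(N * z.2)) *
          ‖cgrad w (b.param z)‖) := by gcongr
      _ = ‖v‖ * (b.amp N * (N * b.dev z.1 + 0) * Real.exp (-(N * z.2)) *
          ‖cgrad w (b.param z)‖) := by ring
      _ ≤ _ := by
          rw [weight]
          gcongr
  · rw [b.lead_param_eq_zero_of_notMem_cyl hN hz hc, zero_mul, mul_zero]

theorem enorm_integral_lead_graph_le {N : ℕ} (hN : 1 ≤ N) (w : E d → ℂ) :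
    ‖∫ x, b.lead N (b.param (x, 0)) * w (b.param (x, 0))‖ₑ ≤
      ENNReal.ofReal (b.amp N * N) *
        ∫⁻ x in Metric.closedBall b.p' (scale N)⁻¹, ‖w (b.graph x)‖ₑ := by
  rw [← lintegral_const_mul' _ _ ENNReal.ofReal_ne_top, ← setIntegral_eq_integral_of_forall_compl_eq_zero
    (s := Metric.closedBall b.p' (scale N)⁻¹)]
  · refine (enorm_integral_le_lintegral_enorm _).trans (lintegral_mono fun x => ?_)
    rw [enorm_mul]
    refine mul_le_mul_left ?_ _
    rw [← ofReal_norm]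
    have := b.norm_lead_param_le hN (x, 0)
    simp only [mul_zero, neg_zero, Real.exp_zero, mul_one] at this
    exact ENNReal.ofReal_le_ofReal this
  · intro x hx
    rw [b.lead_param_eq_zero hN, zero_mul]
    rw [mem_closedBall_iff_norm, not_le] at hx
    exact Or.inl hx

/-- The leading term of the gradient of Brown's function is almost divergence-free. -/
theorem exists_enorm_integral_lead_le (hd : 2 ≤ d) (hD_open : IsOpen D) (hP : P ∈ frontier D) :
    ∃ A : ℝ, 0 ≤ A ∧ ∀ᶠ N : ℕ in atTop, ∃ B : ℝ≥0∞, B ≠ ⊤ ∧ ∀ w : E d → ℂ, ContDiff ℝ ∞ w →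
      HasCompactSupport w → ‖∫ y in D, b.lead N y * ∑ i, b.freq i * cgrad w y i‖ₑ ≤
        ENNReal.ofReal (A * √(b.err N)) * eLpNorm (cgrad w) 2 (volume.restrict D) +
        B * eLpNorm w 2 (surfaceMeasure D) := by
  obtain ⟨A₁, hA₁, H₁⟩ := b.exists_norm_fderiv_lead_param_freq_le
  refine ⟨(A₁ + ‖b.reFreq‖ + ‖b.imFreq‖) * b.C, mul_nonneg (by positivity) b.C_nonneg, ?_⟩
  filter_upwards [b.setIntegral_lead_mul hD_open hP, b.lintegral_enorm_graph_le hP,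
    eventually_ge_atTop 1] with N ⟨hsub, hint⟩ ⟨B₀, hB₀, hG⟩ hN
  set Θ : ℂ := ((b.lin b.reFreq).snd + Complex.I * (b.lin b.imFreq).snd) with hΘ
  have hN0 : (0 : ℝ) < N := by exact_mod_cast hN
  have hM := scale_pos hN
  have hamp := b.amp_nonneg N
  -- This constant depends on `N` and is not uniformly controlled. It only has to be finite, since
  -- it multiplies boundary norms that vanish for zero-trace functions.
  refine ⟨(ENNReal.ofReal (A₁ * b.amp N * N * scale N) * ENNReal.ofReal (scale N)⁻¹ +
    ‖Θ‖ₑ * ENNReal.ofReal (b.amp N * N)) * B₀, by finiteness, fun w hw hwc => ?_⟩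
  have hw1 : ContDiff ℝ 1 w := hw.of_le (by simp)
  have hs1 : ContDiff ℝ 1 fun z => b.lead N (b.param z) :=
    (b.contDiff_lead_param hN).of_le (by simp)
  have hsc := b.hasCompactSupport_lead_param hN
  set H := (Set.univ : Set (E (d - 1))) ×ˢ Set.Ioi (0 : ℝ) with hH
  set T := ∫⁻ z in b.cyl N, ENNReal.ofReal (b.weight N z) * ‖cgrad w (b.param z)‖ₑ
    ∂(volume.prod volume) with hT
  set G := ∫⁻ x in Metric.closedBall b.p' (scale N)⁻¹, ‖w (b.graph x)‖ₑ with hGdef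
  have hT' := b.lintegral_weight_mul_cgrad_le hd hN hsub hw1
  have hG' := hG w hw.continuous
  have hY := fun v => b.enorm_integral_dev_le hN w v
  have hZ := b.enorm_integral_lead_graph_le hN w
  have i1 := fun u => (b.integrable_fderiv_mul hs1 hsc hw1 u).restrict (s := H)
  have i2 := fun u => (b.integrable_mul_fderiv hs1 hsc hw1 u).restrict (s := H)
  -- The term where only the cut-off is differentiated has size `amp N M · exp(-Nt) |w|`. Passing
  -- from `w` to its vertical derivative gains `1/N`, leaving `amp M · exp(-Nt) |∇w|`, the second
  -- half of the weight.
  have hX : ‖∫ z in H, (fderiv ℝ (fun z => b.lead N (b.param z)) z (b.lin b.reFreq).ofLp +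
      Complex.I * fderiv ℝ (fun z => b.lead N (b.param z)) z (b.lin b.imFreq).ofLp) *
        w (b.param z) ∂(volume.prod volume)‖ₑ ≤
      ENNReal.ofReal (A₁ * b.amp N * N * scale N) * ENNReal.ofReal (scale N)⁻¹ * G +
        ENNReal.ofReal A₁ * T := by
    calc _ ≤ ∫⁻ z in b.cyl N, ENNReal.ofReal (A₁ * b.amp N * N * scale N) *
          (ENNReal.ofReal (Real.exp (-(N * z.2))) * ‖w (b.param z)‖ₑ) ∂(volume.prod volume) := by
          refine b.enorm_setIntegral_le_lintegral_cyl (fun z hz => ?_) fun z hz hc => ?_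
          · have := H₁ N hN z (b.mem_cyl_iff.1 hz).2.1
            rw [Set.indicator_of_mem hz] at this
            rw [enorm_mul, ← mul_assoc, ← ENNReal.ofReal_mul (by positivity), ← ofReal_norm]
            gcongr
          · have := H₁ N hN z hz
            rw [Set.indicator_of_notMem hc, norm_le_zero_iff] at this
            rw [this, zero_mul]
      _ ≤ ENNReal.ofReal (A₁ * b.amp N * N * scale N) * (ENNReal.ofReal (scale N)⁻¹ * G +
          ENNReal.ofReal (N : ℝ)⁻¹ * ∫⁻ z in b.cyl N, ENNReal.ofReal (Real.exp (-(N * z.2))) *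
            ‖fderiv ℝ w (b.param z) b.vert‖ₑ ∂(volume.prod volume)) := by
          rw [lintegral_const_mul' _ _ ENNReal.ofReal_ne_top]
          gcongr
          exact b.lintegral_cyl_exp_mul_enorm_le hN hw1
      _ ≤ _ := by
          rw [mul_add, ← mul_assoc, ← mul_assoc]
          refine add_le_add_right ?_ _
          rw [hT, ← ENNReal.ofReal_mul (by positivity),
            ← lintegral_const_mul' _ _ ENNReal.ofReal_ne_top,
            ← lintegral_const_mul' _ _ ENNReal.ofReal_ne_top]
          refine lintegral_mono fun z => ?_
          have h1 := enorm_fderiv_apply_le w (b.param z) b.vert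
          rw [b.norm_vert, ENNReal.ofReal_one, one_mul] at h1
          rw [← mul_assoc, ← mul_assoc, ← ENNReal.ofReal_mul (by positivity),
            ← ENNReal.ofReal_mul hA₁]
          refine mul_le_mul' (ENNReal.ofReal_le_ofReal ?_) h1
          have h2 := b.dev_nonneg z.1
          calc _ = A₁ * (b.amp N * (0 + scale N) * Real.exp (-(N * z.2))) := by
                field_simp; ring
            _ ≤ _ := by
                rw [weight]
                gcongr
                positivity
  -- The identity is applied to the real and imaginary parts of `freq` separately and recombined, so
  -- that the null condition can act on the derivatives of `lead`.
  have hsum : ∫ y in D, b.lead N y * ∑ i, b.freq i * cgrad w y i =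
      -(∫ z in H, (fderiv ℝ (fun z => b.lead N (b.param z)) z (b.lin b.reFreq).ofLp +
      Complex.I * fderiv ℝ (fun z => b.lead N (b.param z)) z (b.lin b.imFreq).ofLp) *
        w (b.param z) ∂(volume.prod volume)) -
      (∫ z in H, (inner ℝ (gradient b.φ z.1 - b.slope) (b.coord b.reFreq).fst : ℝ) *
        (b.lead N (b.param z) * fderiv ℝ w (b.param z) b.vert) ∂(volume.prod volume)) -
      Complex.I * (∫ z in H, (inner ℝ (gradient b.φ z.1 - b.slope) (b.coord b.imFreq).fst : ℝ) *
        (b.lead N (b.param z) * fderiv ℝ w (b.param z) b.vert) ∂(volume.prod volume)) -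
      Θ * ∫ x, b.lead N (b.param (x, 0)) * w (b.param (x, 0)) := by
    have e0 : ∫ y in D, b.lead N y * ∑ i, b.freq i * cgrad w y i =
        (∫ z in H, b.lead N (b.param z) * fderiv ℝ w (b.param z) b.reFreq
          ∂(volume.prod volume)) +
        Complex.I * ∫ z in H, b.lead N (b.param z) * fderiv ℝ w (b.param z) b.imFreq
          ∂(volume.prod volume) := by
      rw [hint, ← integral_const_mul, ← integral_add (i2 _) ((i2 _).const_mul _)]
      refine integral_congr_ae (ae_of_all _ fun z => ?_)
      simp only [sum_freq_mul_cgrad]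
      ring
    have e1 : ∫ z in H, (fderiv ℝ (fun z => b.lead N (b.param z)) z (b.lin b.reFreq).ofLp +
        Complex.I * fderiv ℝ (fun z => b.lead N (b.param z)) z (b.lin b.imFreq).ofLp) *
          w (b.param z) ∂(volume.prod volume) =
        (∫ z in H, fderiv ℝ (fun z => b.lead N (b.param z)) z (b.lin b.reFreq).ofLp *
          w (b.param z) ∂(volume.prod volume)) + Complex.I *
        ∫ z in H, fderiv ℝ (fun z => b.lead N (b.param z)) z (b.lin b.imFreq).ofLp *
          w (b.param z) ∂(volume.prod volume) := by
      rw [← integral_const_mul, ← integral_add (i1 _) ((i1 _).const_mul _)]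
      refine integral_congr_ae (ae_of_all _ fun z => ?_)
      ring
    have e2 : ∀ v, ∫ z in H, b.lead N (b.param z) * fderiv ℝ w (b.param z) v
        ∂(volume.prod volume) =
      -(∫ z in H, fderiv ℝ (fun z => b.lead N (b.param z)) z (b.lin v).ofLp * w (b.param z)
        ∂(volume.prod volume)) -
      (∫ z in H, (inner ℝ (gradient b.φ z.1 - b.slope) (b.coord v).fst : ℝ) *
        (b.lead N (b.param z) * fderiv ℝ w (b.param z) b.vert) ∂(volume.prod volume)) -
      (b.lin v).snd * ∫ x, b.lead N (b.param (x, 0)) * w (b.param (x, 0)) :=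
      fun v => b.integral_mul_fderiv hs1 hsc hw1 hwc b.slope v
    rw [e0, e1, e2, e2, hΘ]
    ring
  rw [hsum]
  have hI : ‖Complex.I‖ₑ = 1 := by rw [← ofReal_norm, Complex.norm_I, ENNReal.ofReal_one]
  refine (enorm_sub_le.trans (add_le_add_left (enorm_sub_le.trans
    (add_le_add_left enorm_sub_le _)) _)).trans ?_
  rw [enorm_neg, enorm_mul, enorm_mul, hI, one_mul]
  calc _ ≤ ENNReal.ofReal (A₁ * b.amp N * N * scale N) * ENNReal.ofReal (scale N)⁻¹ * G +
        ENNReal.ofReal A₁ * T + ENNReal.ofReal ‖b.reFreq‖ * T + ENNReal.ofReal ‖b.imFreq‖ * T +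
        ‖Θ‖ₑ * (ENNReal.ofReal (b.amp N * N) * G) :=
        add_le_add (add_le_add (add_le_add hX (hY _)) (hY _)) (mul_le_mul_right hZ _)
    _ = (ENNReal.ofReal A₁ + ENNReal.ofReal ‖b.reFreq‖ + ENNReal.ofReal ‖b.imFreq‖) * T +
        (ENNReal.ofReal (A₁ * b.amp N * N * scale N) * ENNReal.ofReal (scale N)⁻¹ +
          ‖Θ‖ₑ * ENNReal.ofReal (b.amp N * N)) * G := by ring
    _ ≤ (ENNReal.ofReal A₁ + ENNReal.ofReal ‖b.reFreq‖ + ENNReal.ofReal ‖b.imFreq‖) *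
          (ENNReal.ofReal (b.C * √(b.err N)) * eLpNorm (cgrad w) 2 (volume.restrict D)) +
        (ENNReal.ofReal (A₁ * b.amp N * N * scale N) * ENNReal.ofReal (scale N)⁻¹ +
          ‖Θ‖ₑ * ENNReal.ofReal (b.amp N * N)) * (B₀ * eLpNorm w 2 (surfaceMeasure D)) := by
        gcongr
    _ = _ := by
        rw [← ENNReal.ofReal_add hA₁ (norm_nonneg _), ← ENNReal.ofReal_add (by positivity)
          (norm_nonneg _), ← mul_assoc, ← mul_assoc, ← ENNReal.ofReal_mul (by positivity),
          mul_assoc _ B₀, ← mul_assoc (A₁ + ‖b.reFreq‖ + ‖b.imFreq‖) b.C]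

end BrownData

end Calderon

/-! ### Normalisation of the energy and size of the boundary data -/

namespace Calderon

namespace BrownData

variable {d : ℕ} {D : Set (E d)} {P : E d} (b : BrownData D P)

theorem hasCompactSupport_radial : HasCompactSupport fun x : E (d - 1) => b.η ‖x‖ := by
  refine HasCompactSupport.intro (isCompact_closedBall (0 : E (d - 1)) 1) fun x hx => ?_
  rw [mem_closedBall_zero_iff, not_le] at hx
  exact b.η_zero _ (hx.le.trans (le_abs_self _))

theorem C_sq_mul :
    b.C ^ 2 * ((1 + ‖b.slope‖ ^ 2) * ∫ x : E (d - 1), b.η ‖x‖ ^ 2) = 1 := by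
  have hI : 0 < ∫ x : E (d - 1), b.η ‖x‖ ^ 2 := by
    refine Continuous.integral_pos_of_hasCompactSupport_nonneg_nonzero (x := 0)
      (b.contDiff_radial.continuous.pow 2) ?_ (fun x => by positivity) ?_
    · exact b.hasCompactSupport_radial.comp_left (g := fun t : ℝ => t ^ 2) (by simp)
    · rw [norm_zero, b.η_one 0 (by norm_num)]; norm_num
  have hpos : 0 < (1 + ‖b.slope‖ ^ 2) * ∫ x : E (d - 1), b.η ‖x‖ ^ 2 := by positivity
  have h : b.C = ((1 + ‖b.slope‖ ^ 2) * ∫ x : E (d - 1), b.η ‖x‖ ^ 2) ^ (-(1 / 2) : ℝ) := rfl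
  rw [h, ← Real.rpow_natCast, ← Real.rpow_mul hpos.le]
  norm_num [Real.rpow_neg_one, hpos.ne']
  field_simp

/-- The integral in the normal direction, after rescaling. -/
noncomputable def profile (N : ℕ) : ℝ :=
  ∫ t in Set.Ioi (0 : ℝ), b.η ((scale N)⁻¹ * t) ^ 2 * Real.exp (-(2 * t))

theorem profile_nonneg (N : ℕ) : 0 ≤ b.profile N :=
  integral_nonneg fun _ => by positivity

/-- At depth `t/N` the normal cut-off is `η(t/M)`, which tends to one. Dominated convergence leaves
the integral of `exp(-2t)`. -/
theorem tendsto_profile : Tendsto b.profile atTop (𝓝 (1 / 2)) := by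
  have hexp : ∫ t in Set.Ioi (0 : ℝ), Real.exp (-(2 * t)) = 1 / 2 := by
    have h := integral_exp_mul_Ioi (a := -2) (by norm_num) 0
    simp only [neg_mul, mul_zero, Real.exp_zero] at h
    rw [h]; norm_num
  rw [← hexp]
  refine tendsto_integral_of_dominated_convergence (fun t => Real.exp (-(2 * t)))
    (fun N => ?_) ?_ (fun N => ae_of_all _ fun t => ?_) (ae_of_all _ fun t => ?_)
  · have := b.η_smooth.continuous
    exact Continuous.aestronglyMeasurable (by fun_prop)
  · simpa [neg_mul, IntegrableOn] using exp_neg_integrableOn_Ioi 0 (two_pos)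
  · have h := b.η_mem ((scale N)⁻¹ * t)
    rw [Real.norm_of_nonneg (by positivity)]
    exact mul_le_of_le_one_left (Real.exp_pos _).le (pow_le_one₀ h.1 h.2)
  · have h1 : Tendsto (fun N => |(scale N)⁻¹ * t|) atTop (𝓝 0) := by
      simpa using ((tendsto_inv_atTop_zero.comp tendsto_scale).mul_const t).abs
    refine tendsto_const_nhds.congr' ?_
    filter_upwards [h1.eventually (gt_mem_nhds (show (0 : ℝ) < 1 / 2 by norm_num))] with N hN
    rw [b.η_one _ hN.le, one_pow, one_mul]

theorem lead_mul_conj_param {N : ℕ} (hN : 1 ≤ N) (z : E (d - 1) × ℝ) :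
    b.lead N (b.param z) * (starRingEnd ℂ) (b.lead N (b.param z)) =
      ((b.amp N * N) ^ 2 : ℝ) * ((b.η ‖scale N • (z.1 - b.p')‖ ^ 2 : ℝ) *
        (b.η ((scale N)⁻¹ * (N * z.2)) ^ 2 * Real.exp (-(2 * (N * z.2))) : ℝ)) := by
  have hM := scale_pos hN
  have e1 : b.lead N (b.param z) = (b.amp N * N * b.cutoff (scale N • b.flatten (b.param z)) : ℝ) *
      Complex.exp (N * b.phase (b.flatten (b.param z))) := by
    rw [lead, b.a_eq hM.le]
    push_cast
    ring
  have e2 : b.cutoff (scale N • b.flatten (b.param z)) =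
      b.η ‖scale N • (z.1 - b.p')‖ * b.η ((scale N)⁻¹ * (N * z.2)) := by
    have : (scale N)⁻¹ * (N * z.2) = scale N * z.2 := by
      rw [← scale_sq]; field_simp
    rw [b.flatten_param, this]
    rfl
  have e3 : ‖Complex.exp (N * b.phase (b.flatten (b.param z)))‖ = Real.exp (-(N * z.2)) := by
    have := b.norm_exp_phase N (b.flatten (b.param z))
    rw [b.flatten_param] at this ⊢
    exact_mod_cast this
  rw [Complex.mul_conj, Complex.normSq_eq_norm_sq, e1, norm_mul, Complex.norm_real, e3, mul_pow,
    Real.norm_eq_abs, sq_abs, e2, ← Real.exp_nat_mul]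
  rw [← Complex.ofReal_mul, ← Complex.ofReal_mul]
  congr 1
  push_cast
  ring_nf

/-- The squared modulus separates in `x` and `t`. Rescaling by `M` and by `N` produces `(amp N)²
M^{-(d-1)} N^{-1} = C²`. -/
theorem integral_norm_sq_lead (hd : 2 ≤ d) (hD_open : IsOpen D) (hP : P ∈ frontier D) :
    ∀ᶠ N : ℕ in atTop, ∫ y in D, ‖b.lead N y‖ ^ 2 =
      b.C ^ 2 * (∫ x : E (d - 1), b.η ‖x‖ ^ 2) * b.profile N := by
  filter_upwards [b.setIntegral_lead_mul hD_open hP, eventually_ge_atTop 1] with N ⟨_, hint⟩ hN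
  have hN0 : (0 : ℝ) < N := by exact_mod_cast hN
  have hM := scale_pos hN
  have e1 : ((∫ y in D, ‖b.lead N y‖ ^ 2 : ℝ) : ℂ) =
      ∫ y in D, b.lead N y * (starRingEnd ℂ) (b.lead N y) := by
    rw [← integral_complex_ofReal]
    refine integral_congr_ae (ae_of_all _ fun y => ?_)
    simp only [Complex.mul_conj, Complex.normSq_eq_norm_sq]
  have e2 : ∫ x : E (d - 1), b.η ‖scale N • (x - b.p')‖ ^ 2 =
      (scale N ^ (d - 1))⁻¹ * ∫ x : E (d - 1), b.η ‖x‖ ^ 2 := by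
    rw [integral_sub_right_eq_self (fun x : E (d - 1) => b.η ‖scale N • x‖ ^ 2),
      Measure.integral_comp_smul volume (fun x : E (d - 1) => b.η ‖x‖ ^ 2), finrank_euclideanSpace,
      Fintype.card_fin, abs_of_pos (by positivity), smul_eq_mul]
  have e3 : ∫ t in Set.Ioi (0 : ℝ), b.η ((scale N)⁻¹ * (N * t)) ^ 2 *
      Real.exp (-(2 * (N * t))) = (N : ℝ)⁻¹ * b.profile N := by
    rw [integral_comp_mul_left_Ioi (fun t => b.η ((scale N)⁻¹ * t) ^ 2 * Real.exp (-(2 * t))) 0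
      hN0, mul_zero]
    rfl
  rw [hint] at e1
  simp only [b.lead_mul_conj_param hN] at e1
  rw [integral_const_mul, setIntegral_prod_mul (fun x => ((b.η ‖scale N • (x - b.p')‖ ^ 2 : ℝ) : ℂ))
    (fun t => ((b.η ((scale N)⁻¹ * (N * t)) ^ 2 * Real.exp (-(2 * (N * t))) : ℝ) : ℂ)),
    integral_complex_ofReal, integral_complex_ofReal, setIntegral_univ, e2, e3,
    ← Complex.ofReal_mul, ← Complex.ofReal_mul] at e1
  rw [Complex.ofReal_injective e1]
  have h1 := b.amp_sq_mul hd hN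
  have h2 : b.amp N ^ 2 = (N : ℝ)⁻¹ * (scale N ^ (d - 1) * b.C ^ 2) := by
    rw [← h1]; field_simp
  rw [mul_pow, h2]
  field_simp

theorem continuous_lead {N : ℕ} (hN : 1 ≤ N) : Continuous (b.lead N) := by
  obtain ⟨L, hL⟩ := b.exists_lipschitzWith_flatten
  exact continuous_const.mul ((b.contDiff_a (scale_pos hN).le N).continuous.comp hL.continuous)

/-- Here `C` is seen to be the right constant: `‖freq‖² = 2 (1 + |slope|²)`, the profile tends to
`1/2`, and `C²` cancels the rest. -/
theorem tendsto_eLpNorm_lead (hd : 2 ≤ d) (hD_open : IsOpen D) (hD_bdd : Bornology.IsBounded D)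
    (hP : P ∈ frontier D) {r : ℝ} (hr : 0 ≤ r) :
    Tendsto (fun N => eLpNorm (fun y => ((r : ℂ) * b.lead N y) • b.freq) 2 (volume.restrict D))
      atTop (𝓝 (ENNReal.ofReal r)) := by
  have h1 : Tendsto (fun N => ENNReal.ofReal (r * √(2 * b.profile N))) atTop
      (𝓝 (ENNReal.ofReal r)) := by
    refine ENNReal.tendsto_ofReal ?_
    simpa using ((b.tendsto_profile.const_mul 2).sqrt).const_mul r
  refine h1.congr' ?_
  filter_upwards [b.integral_norm_sq_lead hd hD_open hP, eventually_ge_atTop 1] with N hint hN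
  have hinj : ∀ p q : ℝ≥0∞, p ^ 2 = q ^ 2 → p = q := fun p q h =>
    le_antisymm ((ENNReal.pow_le_pow_left_iff two_ne_zero).1 h.le)
      ((ENNReal.pow_le_pow_left_iff two_ne_zero).1 h.ge)
  refine hinj _ _ ?_
  rw [eLpNorm_two_sq,
    ← ENNReal.ofReal_pow (by positivity), mul_pow,
    Real.sq_sqrt (mul_nonneg zero_le_two (b.profile_nonneg N))]
  have e1 : ∀ y, ‖((r : ℂ) * b.lead N y) • b.freq‖ₑ ^ 2 =
      ENNReal.ofReal (r ^ 2 * ‖b.freq‖ ^ 2) * ENNReal.ofReal (‖b.lead N y‖ ^ 2) := by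
    intro y
    rw [← ofReal_norm, ← ENNReal.ofReal_pow (norm_nonneg _), ← ENNReal.ofReal_mul (by positivity),
      norm_smul, norm_mul, Complex.norm_real, Real.norm_of_nonneg hr]
    congr 1; ring
  simp only [e1]
  rw [lintegral_const_mul' _ _ ENNReal.ofReal_ne_top, ← ofReal_integral_eq_lintegral_ofReal
    _ (ae_of_all _ fun y => by positivity), hint, ← ENNReal.ofReal_mul (by positivity), norm_sq_freq]
  · congr 1
    linear_combination (-2 * r ^ 2 * b.profile N) * b.C_sq_mul
  · exact (memLp_of_continuous hD_open hD_bdd (b.continuous_lead hN) 2).integrable_norm_pow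
      two_ne_zero

/-- On `∂D` near `P` the last flattened coordinate is zero, so the exponential has modulus one and
only the tangential cut-off localises. -/
theorem norm_boundaryFun_le_indicator (hP : P ∈ frontier D) : ∀ᶠ N : ℕ in atTop,
    ∀ y ∈ frontier D, ‖b.boundaryFun N y‖ₑ ^ 2 ≤
      (Metric.ball P b.ρ ∩ b.proj ⁻¹' Metric.closedBall b.p' (scale N)⁻¹).indicator
        (fun _ => ENNReal.ofReal (b.amp N ^ 2)) y := by
  filter_upwards [b.eventually_param_mem_ball hP] with N ⟨hN, hball⟩
  intro y hy
  have hM := scale_pos hN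
  by_cases h : (scale N)⁻¹ ≤ ‖(b.flatten y).fst‖ ∨ (scale N)⁻¹ ≤ |(b.flatten y).snd|
  · rw [b.boundaryFun_eq, b.a_eq_zero hM N h]
    simp
  · push Not at h
    have hp : b.param (b.proj y, (b.flatten y).snd) = y := b.param_eq_of_coord (by
      simp [flatten, BoundaryChart.proj])
    have hyb : y ∈ Metric.ball P b.ρ := by
      rw [← hp]
      exact hball _ h.1.le h.2.le
    have hmem : y ∈ Metric.ball P b.ρ ∩ b.proj ⁻¹' Metric.closedBall b.p' (scale N)⁻¹ :=
      ⟨hyb, mem_closedBall_iff_norm.2 h.1.le⟩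
    rw [Set.indicator_of_mem hmem, ← ofReal_norm,
      ← ENNReal.ofReal_pow (norm_nonneg _)]
    refine ENNReal.ofReal_le_ofReal ?_
    have h0 : (b.flatten y).snd = 0 := by
      have := (b.mem_frontier_iff y hyb).1 hy
      simp [flatten, this]
    have h1 := b.norm_a_le hM.le N (b.flatten y)
    rw [h0, mul_zero, neg_zero, Real.exp_zero] at h1
    rw [b.boundaryFun_eq, norm_mul, Complex.norm_real, Real.norm_of_nonneg (b.amp_nonneg N)]
    have h2 := b.amp_nonneg N
    gcongr
    exact mul_le_of_le_one_right h2 h1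

/-- Brown's boundary data are of size `N^{-1/2}` in `L²(∂D)`. -/
theorem exists_norm_sq_le (hd : 2 ≤ d) (hP : P ∈ frontier D) : ∃ A : ℝ, ∀ᶠ N : ℕ in atTop,
    ∀ f : L2Boundary D, ⇑f =ᵐ[surfaceMeasure D] b.boundaryFun N → ‖f‖ ^ 2 ≤ A / N := by
  obtain ⟨K, hK⟩ := b.lipschitz
  set V := volume (Metric.ball (0 : E (d - 1)) 1) with hV
  have hVfin : V ≠ ⊤ := measure_ball_lt_top.ne
  refine ⟨b.C ^ 2 * ((1 + K : ℝ≥0) ^ (d - 1) * V.toReal), ?_⟩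
  filter_upwards [b.norm_boundaryFun_le_indicator hP, eventually_ge_atTop 1] with N H hN f hf
  have hN0 : (0 : ℝ) < N := by exact_mod_cast hN
  have hM := scale_pos hN
  have hmeas : MeasurableSet (Metric.ball P b.ρ ∩
      b.proj ⁻¹' Metric.closedBall b.p' (scale N)⁻¹) :=
    Metric.isOpen_ball.measurableSet.inter
      (Metric.isClosed_closedBall.preimage b.lipschitzWith_proj.continuous).measurableSet
  have hσ := b.surfaceMeasure_le_of_subset hK hmeas Set.inter_subset_left
    (S := Metric.closedBall b.p' (scale N)⁻¹) (by rintro _ ⟨y, ⟨hy, _⟩, rfl⟩; exact hy.2)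
  have h1 : ‖f‖ₑ ^ 2 ≤ ENNReal.ofReal (b.C ^ 2 * ((1 + K : ℝ≥0) ^ (d - 1) * V.toReal) / N) := by
    rw [Lp.enorm_def, eLpNorm_congr_ae hf, eLpNorm_two_sq]
    calc _ ≤ ∫⁻ y, (Metric.ball P b.ρ ∩
          b.proj ⁻¹' Metric.closedBall b.p' (scale N)⁻¹).indicator
            (fun _ => ENNReal.ofReal (b.amp N ^ 2)) y ∂(surfaceMeasure D) := by
          refine lintegral_mono_ae ?_
          filter_upwards [ae_restrict_mem isClosed_frontier.measurableSet] with y hy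
          exact H y hy
      _ ≤ ENNReal.ofReal (b.amp N ^ 2) * (((1 + K : ℝ≥0) : ℝ≥0∞) ^ (d - 1) *
          (ENNReal.ofReal ((scale N)⁻¹ ^ (d - 1)) * V)) := by
          rw [lintegral_indicator_const hmeas]
          refine mul_le_mul_right (hσ.trans (le_of_eq ?_)) _
          rw [Measure.addHaar_closedBall _ _ (inv_pos.2 hM).le, finrank_euclideanSpace,
            Fintype.card_fin]
      _ = _ := by
          -- The scaling is `amp² M^{-(d-1)} = C² / N`.
          have e : b.C ^ 2 * ((1 + K : ℝ≥0) ^ (d - 1) * V.toReal) / N = b.amp N ^ 2 *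
              (((1 + K : ℝ≥0) : ℝ) ^ (d - 1) * ((scale N)⁻¹ ^ (d - 1) * V.toReal)) := by
            have h2 : b.amp N ^ 2 = (N : ℝ)⁻¹ * (scale N ^ (d - 1) * b.C ^ 2) := by
              rw [← b.amp_sq_mul hd hN]; field_simp
            rw [h2, inv_pow]
            field_simp
          rw [e, ENNReal.ofReal_mul (by positivity), ENNReal.ofReal_mul (by positivity),
            ENNReal.ofReal_mul (by positivity), ENNReal.ofReal_toReal hVfin,
            ENNReal.ofReal_pow (p := ((1 + K : ℝ≥0) : ℝ)) (NNReal.coe_nonneg _),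
            ENNReal.ofReal_coe_nnreal]
  rw [← ofReal_norm, ← ENNReal.ofReal_pow (norm_nonneg _)] at h1
  exact (ENNReal.ofReal_le_ofReal_iff (by positivity)).1 h1

end BrownData

end Calderon

/-! ### Limit of the quadratic form and conclusion -/

namespace Calderon

theorem norm_sum_mul_le {d : ℕ} (a b : EuclideanSpace ℂ (Fin d)) :
    ‖∑ i, a i * b i‖ ≤ ‖a‖ * ‖b‖ := by
  refine (norm_sum_le _ _).trans ?_
  rw [EuclideanSpace.norm_eq, EuclideanSpace.norm_eq]
  simp only [norm_mul]
  exact Real.sum_mul_le_sqrt_mul_sqrt _ _ _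

theorem tendsto_eLpNorm_of_sub {α F : Type*} [MeasurableSpace α] [NormedAddCommGroup F]
    {μ : Measure α} {f g : ℕ → α → F} {r : ℝ≥0∞} (hr : r ≠ ⊤)
    (hf : ∀ᶠ N in atTop, AEStronglyMeasurable (f N) μ)
    (hg : ∀ᶠ N in atTop, AEStronglyMeasurable (g N) μ)
    (hfg : Tendsto (fun N => eLpNorm (f N - g N) 2 μ) atTop (𝓝 0))
    (hlim : Tendsto (fun N => eLpNorm (g N) 2 μ) atTop (𝓝 r)) :
    Tendsto (fun N => eLpNorm (f N) 2 μ) atTop (𝓝 r) := by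
  have h1 := ENNReal.Tendsto.sub hlim hfg (Or.inl hr)
  have h2 := hlim.add hfg
  rw [tsub_zero] at h1
  rw [add_zero] at h2
  refine tendsto_of_tendsto_of_tendsto_of_le_of_le' h1 h2 ?_ ?_
  · filter_upwards [hf, hg] with N hfN hgN
    rw [tsub_le_iff_right]
    have := eLpNorm_sub_le (p := 2) hfN (hfN.sub hgN) one_le_two
    rwa [sub_sub_cancel] at this
  · filter_upwards [hf, hg] with N hfN hgN
    have := eLpNorm_add_le (p := 2) hgN (hfN.sub hgN) one_le_two
    rwa [add_sub_cancel] at this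

namespace IsElliptic

variable {d : ℕ} {D : Set (E d)} {γ : E d → ℝ} {m m' : ℝ} (h : IsElliptic D γ m m')

/-- Moving the weight into the integrand as `√γ` puts the energy in the form covered by the gradient
approximation with `ρ = √γ`. -/
theorem enorm_gradLp (u : H1 D) : ‖h.gradLp u‖ₑ =
    eLpNorm (fun y => (√(γ y) : ℂ) • u.grad y) 2 (volume.restrict D) := by
  have hinj : ∀ p q : ℝ≥0∞, p ^ 2 = q ^ 2 → p = q := fun p q h =>
    le_antisymm ((ENNReal.pow_le_pow_left_iff two_ne_zero).1 h.le)
      ((ENNReal.pow_le_pow_left_iff two_ne_zero).1 h.ge)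
  refine hinj _ _ ?_
  rw [gradLp, Lp.enorm_toLp, eLpNorm_two_sq, eLpNorm_two_sq, weighted,
    lintegral_withDensity_eq_lintegral_mul₀ h.meas.ennreal_ofReal
      (u.memLp_grad.1.enorm.pow_const 2)]
  refine lintegral_congr_ae (h.lower.mono fun y hy => ?_)
  have h0 : 0 ≤ γ y := h.pos.le.trans hy
  simp only [Pi.mul_apply]
  rw [enorm_smul, mul_pow, ← ofReal_norm (√(γ y) : ℂ), Complex.norm_real,
    Real.norm_of_nonneg (Real.sqrt_nonneg _), ← ENNReal.ofReal_pow (Real.sqrt_nonneg _),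
    Real.sq_sqrt h0]

end IsElliptic

namespace BrownData

variable {d : ℕ} {D : Set (E d)} {P : E d} (b : BrownData D P) {γ : E d → ℝ} {m m' L : ℝ}

theorem tendsto_norm_gradLp (hd : 2 ≤ d) (hD_open : IsOpen D) (hD_bdd : Bornology.IsBounded D)
    (hP : P ∈ frontier D) (h : IsElliptic D γ m m') (hL0 : 0 ≤ L)
    (hL : ∀ y ∈ D, |γ y - γ P| ≤ L * dist y P) (hm : ∀ y ∈ D, m ≤ γ y)
    (hm' : ∀ y ∈ D, γ y ≤ m') (hmP : m ≤ γ P) {u : ℕ → H1 D}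
    (hu : ∀ N, 1 ≤ N → (u N).grad = cgrad (b.boundaryFun N)) :
    Tendsto (fun N => ‖h.gradLp (u N)‖) atTop (𝓝 √(γ P)) := by
  have hsm : 0 < √m := Real.sqrt_pos.2 h.pos
  -- The square root inherits the Lipschitz bound at `P` because `√(γ y) + √(γ P) ≥ √m > 0`.
  have hLs : ∀ y ∈ D, |√(γ y) - √(γ P)| ≤ L / √m * dist y P := by
    intro y hy
    have h1 : m ≤ γ y := hm y hy
    have h2 : (√(γ y) - √(γ P)) * (√(γ y) + √(γ P)) = γ y - γ P := by
      have e1 := Real.mul_self_sqrt (h.pos.le.trans h1)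
      have e2 := Real.mul_self_sqrt (h.pos.le.trans hmP)
      linear_combination e1 - e2
    have h3 : √m ≤ √(γ y) + √(γ P) :=
      (Real.sqrt_le_sqrt h1).trans (le_add_of_nonneg_right (Real.sqrt_nonneg _))
    rw [div_mul_eq_mul_div, le_div_iff₀ hsm]
    refine le_trans ?_ (hL y hy)
    rw [← h2, abs_mul, abs_of_nonneg (a := √(γ y) + √(γ P)) (by positivity)]
    gcongr
  obtain ⟨A, hA, HA⟩ := b.exists_eLpNorm_grad_sub_le hd hD_open hP (ρ := fun y => √(γ y)) hLs
    (fun y hy => by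
      rw [abs_of_nonneg (Real.sqrt_nonneg _)]; exact Real.sqrt_le_sqrt (hm' y hy))
    (by positivity) (Real.sqrt_nonneg m')
  have herr : Tendsto (fun N => ENNReal.ofReal (A * √(b.err N))) atTop (𝓝 0) := by
    simpa using ENNReal.tendsto_ofReal ((b.tendsto_err.sqrt).const_mul A)
  have key : Tendsto (fun N => eLpNorm (fun y => (√(γ y) : ℂ) • (u N).grad y) 2
      (volume.restrict D)) atTop (𝓝 (ENNReal.ofReal √(γ P))) := by
    refine tendsto_eLpNorm_of_sub ENNReal.ofReal_ne_top
      (Eventually.of_forall fun N => ?_) ?_ ?_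
      (b.tendsto_eLpNorm_lead hd hD_open hD_bdd hP (Real.sqrt_nonneg (γ P)))
    · exact (Complex.measurable_ofReal.comp_aemeasurable
        h.meas.sqrt).aestronglyMeasurable.smul (u N).memLp_grad.1
    · filter_upwards [eventually_ge_atTop 1] with N hN
      have := b.continuous_lead hN
      exact Continuous.aestronglyMeasurable (by fun_prop)
    · refine tendsto_of_tendsto_of_tendsto_of_le_of_le' tendsto_const_nhds herr
        (Eventually.of_forall fun _ => zero_le) ?_
      filter_upwards [HA, eventually_ge_atTop 1] with N hN hN1
      rw [hu N hN1]
      exact hN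
  have := (ENNReal.tendsto_toReal ENNReal.ofReal_ne_top).comp key
  rw [ENNReal.toReal_ofReal (Real.sqrt_nonneg _)] at this
  refine this.congr fun N => ?_
  rw [Function.comp_apply, ← h.enorm_gradLp, toReal_enorm]

/-- Brown's function is an approximate solution of the conductivity equation. -/
theorem exists_norm_inner_gradLp_le (hd : 2 ≤ d) (hD_open : IsOpen D)
    (hD_bdd : Bornology.IsBounded D) (hP : P ∈ frontier D) (h : IsElliptic D γ m m') (hL0 : 0 ≤ L)
    (hL : ∀ y ∈ D, |γ y - γ P| ≤ L * dist y P) (hm : ∀ y ∈ D, m ≤ γ y)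
    (hm' : ∀ y ∈ D, γ y ≤ m') (hm0' : 0 ≤ m') {u : ℕ → H1 D}
    (hu : ∀ N, 1 ≤ N → (u N).grad = cgrad (b.boundaryFun N)) :
    ∃ A : ℝ, 0 ≤ A ∧ ∀ᶠ N in atTop, ∀ v : H1 D, v.HasTrace 0 →
      ‖inner ℂ (h.gradLp v) (h.gradLp (u N))‖ ≤ A * √(b.err N) * ‖h.gradLp v‖ := by
  obtain ⟨A₁, hA₁, H₁⟩ := b.exists_eLpNorm_grad_sub_le hd hD_open hP (ρ := γ) hL
    (fun y hy => by rw [abs_of_nonneg (h.pos.le.trans (hm y hy))]; exact hm' y hy) hL0 hm0'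
  obtain ⟨A₂, hA₂, H₂⟩ := b.exists_enorm_integral_lead_le hd hD_open hP
  refine ⟨(A₁ + |γ P| * A₂) * ((ENNReal.ofReal m)⁻¹ ^ (1 / 2 : ℝ)).toReal, by positivity, ?_⟩
  filter_upwards [H₁, H₂, eventually_ge_atTop 1] with N h1 ⟨B, hB, h2⟩ hN v hv
  have hs := Real.sqrt_nonneg (b.err N)
  have key := h.norm_inner_gradLp_le hD_open hD_bdd (u := u N)
    (ε := ENNReal.ofReal ((A₁ + |γ P| * A₂) * √(b.err N))) (B := ENNReal.ofReal |γ P| * B)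
    ENNReal.ofReal_ne_top (ENNReal.mul_ne_top ENNReal.ofReal_ne_top hB) ?_ hv
  · rw [ENNReal.toReal_mul, ENNReal.toReal_ofReal (by positivity)] at key
    refine key.trans (le_of_eq ?_)
    ring
  intro w hw hwc
  have hw1 : ContDiff ℝ 1 w := hw.of_le (by simp)
  set g : E d → EuclideanSpace ℂ (Fin d) := fun y => (γ y : ℂ) • cgrad (b.boundaryFun N) y
        - ((γ P : ℂ) * b.lead N y) • b.freq with hg
  have hwL : MemLp (cgrad w) 2 (volume.restrict D) :=
    memLp_of_continuous hD_open hD_bdd (continuous_cgrad hw1) 2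
  have hlead := b.continuous_lead hN
  have hgm : AEStronglyMeasurable g (volume.restrict D) := by
    refine AEStronglyMeasurable.sub ?_ (Continuous.aestronglyMeasurable (by fun_prop))
    rw [← hu N hN]
    exact (Complex.measurable_ofReal.comp_aemeasurable h.meas).aestronglyMeasurable.smul
      (u N).memLp_grad.1
  have hgL : MemLp g 2 (volume.restrict D) := ⟨hgm, h1.trans_lt ENNReal.ofReal_lt_top⟩
  have hi1 : Integrable (fun y => ∑ i, g y i * cgrad w y i) (volume.restrict D) :=
    integrable_finsetSum _ fun i _ =>
      integrable_mul_of_memLp_two (memLp_apply hgL i) (memLp_apply hwL i)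
  have hi2 : Integrable (fun y => (γ P : ℂ) * (b.lead N y * ∑ i, b.freq i * cgrad w y i))
      (volume.restrict D) := by
    refine Integrable.const_mul ?_ _
    have hc : Continuous fun y => ∑ i, b.freq i * cgrad w y i := by
      have := continuous_cgrad hw1
      fun_prop
    exact integrable_mul_of_memLp_two (memLp_of_continuous hD_open hD_bdd hlead 2)
      (memLp_of_continuous hD_open hD_bdd hc 2)
  -- The flux `γ ∇u` is the frozen leading flux plus `g`. The error `g` is small in `L²` and needs
  -- only Cauchy–Schwarz; the frozen part is almost divergence-free.
  have hsplit : ∫ x in D, (γ x : ℂ) * ∑ i : Fin d, (u N).grad x i * cgrad w x i =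
      (∫ y in D, ∑ i, g y i * cgrad w y i) +
        (γ P : ℂ) * ∫ y in D, b.lead N y * ∑ i, b.freq i * cgrad w y i := by
    rw [← integral_const_mul, ← integral_add hi1 hi2]
    refine integral_congr_ae (ae_of_all _ fun y => ?_)
    simp only [hg, hu N hN, PiLp.sub_apply, PiLp.smul_apply, smul_eq_mul, Finset.mul_sum]
    rw [← Finset.sum_add_distrib]
    refine Finset.sum_congr rfl fun i _ => ?_
    ring
  have hCS : ‖∫ y in D, ∑ i, g y i * cgrad w y i‖ₑ ≤
      eLpNorm g 2 (volume.restrict D) * eLpNorm (cgrad w) 2 (volume.restrict D) := by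
    refine (enorm_integral_le_lintegral_enorm _).trans ?_
    rw [← ENNReal.pow_le_pow_left_iff two_ne_zero, mul_pow, eLpNorm_two_sq, eLpNorm_two_sq]
    refine le_trans ?_ (sq_lintegral_mul_le hgm.enorm hwL.1.enorm)
    gcongr with y
    rw [← ofReal_norm, ← ofReal_norm, ← ofReal_norm, ← ENNReal.ofReal_mul (norm_nonneg _)]
    exact ENNReal.ofReal_le_ofReal (norm_sum_mul_le _ _)
  have hγP : ‖(γ P : ℂ)‖ₑ = ENNReal.ofReal |γ P| := by
    rw [← ofReal_norm, Complex.norm_real, Real.norm_eq_abs]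
  rw [hsplit]
  refine (enorm_add_le _ _).trans ?_
  rw [enorm_mul, hγP]
  calc _ ≤ ENNReal.ofReal (A₁ * √(b.err N)) * eLpNorm (cgrad w) 2 (volume.restrict D) +
        ENNReal.ofReal |γ P| * (ENNReal.ofReal (A₂ * √(b.err N)) *
          eLpNorm (cgrad w) 2 (volume.restrict D) + B * eLpNorm w 2 (surfaceMeasure D)) := by
        gcongr
        · exact hCS.trans (mul_le_mul_left h1 _)
        · exact h2 w hw hwc
    _ = _ := by
        rw [mul_add, ← mul_assoc, ← mul_assoc, ← ENNReal.ofReal_mul (abs_nonneg _), ← add_assoc,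
          ← add_mul, ← ENNReal.ofReal_add (by positivity) (by positivity)]
        congr 3
        ring

/-- The energy of Brown's function tends to `γ P`, and the pairing differs from it by at most the
square of a residual of order `√err`. -/
theorem tendsto_dnPairing (hd : 2 ≤ d) (hD_open : IsOpen D)
    (hD_bdd : Bornology.IsBounded D) (hP : P ∈ frontier D) (h : IsElliptic D γ m m') (hL0 : 0 ≤ L)
    (hL : ∀ y ∈ D, |γ y - γ P| ≤ L * dist y P) (hm : ∀ y ∈ D, m ≤ γ y)
    (hm' : ∀ y ∈ D, γ y ≤ m') (hmP : m ≤ γ P) (hm0' : 0 ≤ m') {u : ℕ → H1 D}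
    {f : ℕ → L2Boundary D}
    (hu : ∀ N, 1 ≤ N → (u N).grad = cgrad (b.boundaryFun N))
    (hf : ∀ N, 1 ≤ N → (u N).HasTrace (f N)) :
    Tendsto (fun N => dnPairing D γ (f N) (star (f N))) atTop (𝓝 (γ P : ℂ)) := by
  obtain ⟨A, hA, H⟩ := b.exists_norm_inner_gradLp_le hd hD_open hD_bdd hP h hL0 hL hm hm' hm0' hu
  have h1 : Tendsto (fun N => (‖h.gradLp (u N)‖ : ℂ) ^ 2) atTop (𝓝 (γ P : ℂ)) := by
    have := (b.tendsto_norm_gradLp hd hD_open hD_bdd hP h hL0 hL hm hm' hmP hu).pow 2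
    rw [Real.sq_sqrt (h.pos.le.trans hmP)] at this
    exact_mod_cast (Complex.continuous_ofReal.tendsto _).comp this
  have h2 : Tendsto (fun N => dnPairing D γ (f N) (star (f N)) - (‖h.gradLp (u N)‖ : ℂ) ^ 2)
      atTop (𝓝 0) := by
    have h3 : Tendsto (fun N => (A * √(b.err N)) ^ 2) atTop (𝓝 0) := by
      simpa using ((b.tendsto_err.sqrt).const_mul A).pow 2
    refine squeeze_zero_norm' ?_ h3
    filter_upwards [H, eventually_ge_atTop 1] with N hN hN1
    exact h.norm_dnPairing_sub_le hD_open hD_bdd b.toBoundaryChart (hf N hN1)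
      (mul_nonneg hA (Real.sqrt_nonneg _)) hN
  simpa using h2.add h1

theorem exists_lipschitzWith_boundaryFun {N : ℕ} (hN : 1 ≤ N) :
    (∃ K : ℝ≥0, LipschitzWith K (b.boundaryFun N)) ∧ ∃ C, ∀ y, ‖b.boundaryFun N y‖ ≤ C := by
  obtain ⟨L, hL⟩ := b.exists_lipschitzWith_flatten
  have hcs := b.hasCompactSupport_a (scale_pos hN) N
  have hcd := b.contDiff_a (scale_pos hN).le N
  obtain ⟨K, hK⟩ := hcd.lipschitzWith_of_hasCompactSupport hcs (by simp)
  obtain ⟨C, hC⟩ := hcs.exists_bound_of_continuous hcd.continuous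
  refine ⟨⟨_, (lipschitzWith_smul (b.amp N : ℂ)).comp (hK.comp hL)⟩, b.amp N * C, fun y => ?_⟩
  rw [b.boundaryFun_eq, norm_mul, Complex.norm_real, Real.norm_of_nonneg (b.amp_nonneg N)]
  exact mul_le_mul_of_nonneg_left (hC _) (b.amp_nonneg N)

end BrownData

end Calderon

theorem theorem1 {d : ℕ} (hd : 2 ≤ d) {D : Set (Calderon.E d)} (hD_open : IsOpen D)
    (hD_conn : IsConnected D) (hD_bdd : Bornology.IsBounded D)
    (hD_lip : Calderon.HasLipschitzBoundary D)
    {γ : Calderon.E d → ℝ} (hγ_lip : ∃ K : ℝ≥0, LipschitzOnWith K γ (closure D))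
    (hγ_pos : ∃ γ₀ : ℝ, 0 < γ₀ ∧ ∀ x ∈ closure D, γ₀ ≤ γ x)
    {Ω : Type*} [MeasurableSpace Ω] {Pr : Measure Ω} [IsProbabilityMeasure Pr]
    {X : ℕ × ℕ → Ω → ℂ} (hX : Calderon.IsWhiteNoise Pr X)
    (e : HilbertBasis ℕ ℂ (Calderon.L2Boundary D)) :
    ∀ᵐ P ∂(Calderon.surfaceMeasure D),
      Nonempty (Calderon.BrownData D P) ∧
      ∀ b : Calderon.BrownData D P, ∃ f : ℕ → Calderon.L2Boundary D,
        (∀ N : ℕ, 1 ≤ N →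
          ⇑(f N) =ᵐ[Calderon.surfaceMeasure D] b.boundaryFun N ∧ f N ∈ Calderon.HHalf D) ∧
        ∀ᵐ s ∂Pr, Tendsto (fun N : ℕ => Calderon.noisyData γ hX e (f N) (star (f N)) s)
          atTop (𝓝 (γ P : ℂ)) := by
  obtain ⟨K, hK⟩ := hγ_lip
  obtain ⟨γ₀, hγ₀, hlow⟩ := hγ_pos
  have hfin := Calderon.isFiniteMeasure_surfaceMeasure hD_bdd hD_lip
  obtain ⟨m', hm'⟩ := hD_bdd.isCompact_closure.exists_bound_of_continuousOn hK.continuousOn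
  have hup : ∀ x ∈ closure D, γ x ≤ m' := fun x hx => (le_abs_self _).trans (hm' x hx)
  have hell : Calderon.IsElliptic D γ γ₀ m' :=
    { meas := (hK.continuousOn.mono subset_closure).aemeasurable hD_open.measurableSet
      pos := hγ₀
      lower := (ae_restrict_mem hD_open.measurableSet).mono fun x hx => hlow x (subset_closure hx)
      upper := (ae_restrict_mem hD_open.measurableSet).mono fun x hx => hup x (subset_closure hx) }
  -- The exceptional set of boundary points depends on `D` alone, not on `γ`, the noise or the
  -- basis.
  filter_upwards [Calderon.ae_nonempty_brownData hd hD_lip,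
    ae_restrict_mem isClosed_frontier.measurableSet] with P hne hP
  refine ⟨hne, fun b => ?_⟩
  have hPc : P ∈ closure D := frontier_subset_closure hP
  have hex : ∀ N : ℕ, 1 ≤ N → ∃ (u : Calderon.H1 D) (f : Calderon.L2Boundary D),
      ⇑f =ᵐ[Calderon.surfaceMeasure D] b.boundaryFun N ∧
        u.grad = Calderon.cgrad (b.boundaryFun N) ∧ u.HasTrace f := by
    intro N hN
    obtain ⟨⟨KU, hKU⟩, C, hC⟩ := b.exists_lipschitzWith_boundaryFun hN
    obtain ⟨u, _, hug, hut⟩ := Calderon.exists_H1_of_lipschitzWith hD_open hD_bdd hKU hC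
    have hmem : MemLp (b.boundaryFun N) 2 (Calderon.surfaceMeasure D) :=
      MemLp.of_bound hKU.continuous.aestronglyMeasurable C (ae_of_all _ hC)
    exact ⟨u, hmem.toLp _, hmem.coeFn_toLp, hug, hut _ hmem.coeFn_toLp⟩
  -- At `N = 0` nothing is required; the data of `N = 1` are reused so that sequences on all of `ℕ`
  -- can be chosen.
  have hex' : ∀ N : ℕ, ∃ (u : Calderon.H1 D) (f : Calderon.L2Boundary D), 1 ≤ N →
      ⇑f =ᵐ[Calderon.surfaceMeasure D] b.boundaryFun N ∧
        u.grad = Calderon.cgrad (b.boundaryFun N) ∧ u.HasTrace f := by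
    intro N
    by_cases hN : 1 ≤ N
    · obtain ⟨u, f, h⟩ := hex N hN
      exact ⟨u, f, fun _ => h⟩
    · obtain ⟨u, f, _⟩ := hex 1 le_rfl
      exact ⟨u, f, fun h => absurd h hN⟩
  choose u f huf using hex'
  refine ⟨f, fun N hN => ⟨(huf N hN).1, u N, (huf N hN).2.2⟩, ?_⟩
  obtain ⟨A, hA⟩ := b.exists_norm_sq_le hd hP
  refine Calderon.ae_tendsto_noisyData (C := A) hX e ?_ ?_
  · filter_upwards [hA, eventually_ge_atTop 1] with N hN hN1
    exact hN _ (huf N hN1).1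
  · refine b.tendsto_dnPairing hd hD_open hD_bdd hP hell K.coe_nonneg (fun y hy => ?_)
      (fun y hy => hlow y (subset_closure hy)) (fun y hy => hup y (subset_closure hy))
      (hlow P hPc) ((norm_nonneg _).trans (hm' P hPc)) (fun N hN => (huf N hN).2.1)
      fun N hN => (huf N hN).2.2
    have := hK.dist_le_mul y (subset_closure hy) P hPc
    rwa [Real.dist_eq] at this
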